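/- For a pair of PDEs $z_y=F(x,y,z,z_x)$, $z_{xxx}=H(x,y,z,z_x,z_{xx})$ consider, on the space $\mathbb R^5$ with coordinates $(x,y,z,p,r)$, $p=z_x$, $r=z_{xx}$, the total derivative $D=\partial_x+p\,\partial_z+r\,\partial_p+H\,\partial_r$ and the coframe $$\omega^1=dz-p\,dx-F\,dy,\quad \omega^2=dp-r\,dx-DF\,dy,\quad \omega^3=dr-H\,dx-D^2F\,dy,\quad \omega^4=dx,\quad \omega^5=dy .$$ An infinitesimal point automorphism on an open set $U$ is a smooth vector field $X$ on $U$ with $$\mathcal L_X\omega^1\wedge\omega^1=0,\qquad \mathcal L_X\omega^i\wedge\omega^1\wedge\omega^2\wedge\omega^3=0\ (i=2,3),\qquad \mathcal L_X\omega^j\wedge\omega^1\wedge\omega^4\wedge\omega^5=0\ (j=4,5).$$ Consider the following models: * **(ii)** $z_y=\tfrac14 z_x^2$, $z_{xxx}=z_{xx}^3$, on $\Omega=\mathbb R^5$; * **(iiia)** $z_y=\tfrac14 z_x^{\,b}$, $z_{xxx}=(2-b)\,z_{xx}^2/z_x$, with $1<b<2$, on $\Omega=\{p>0\}$; * **(iiib)**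 $z_y=f(z_x)$, $z_{xxx}=h(z_x)\,z_{xx}^2$, with $b>0$, on $\Omega=\{p\in I\}$, where $f$ is a smooth function on an open set $I\subset\mathbb R$ with $p+bf(p)\ne0$, $f(p)\neq bp$ and $$\bigl(p^2+f(p)^2\bigr)\exp\Bigl(2b\arctan\tfrac{bp-f(p)}{p+bf(p)}\Bigr)=1+b^2\quad(p\in I),\qquad h(p)=\frac{(b^2-3)p-4bf(p)}{(f(p)-bp)^2}.$$ For each of these models and every nonempty connected open set $U\subset\Omega$, the infinitesimal point automorphisms on $U$ form a Lie algebra under the commutator of vector fields. This Lie algebra is $5$-dimensional and solvable, and has as a basis the (restrictions to $U$ of the) vector fields $X_1,\dots,X_5$, where $X_3=\partial_x$, $X_4=\partial_y$, $X_5=\partial_z$ in all cases, and * **(ii)** $X_1=x\partial_x+\tfrac12y\partial_y+\tfrac32z\partial_z+\tfrac12p\partial_p-\tfrac12r\partial_r$, $\ X_2=y\partial_x-2x\partial_z-2\partial_p$, with brackets $[X_1,X_2]=-\tfrac12X_2$, $[X_1,X_3]=-X_3$, $[X_1,X_4]=-\tfrac12X_4$, $[X_1,X_5]=-\tfrac32X_5$,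 $[X_2,X_3]=2X_5$, $[X_2,X_4]=-X_3$, $[X_2,X_5]=0$; * **(iiia)** $X_1=x\partial_x+\tfrac{b}{b-1}z\partial_z+\tfrac{1}{b-1}p\partial_p-\tfrac{b-2}{b-1}r\partial_r$, $\ X_2=y\partial_y-\tfrac1{b-1}z\partial_z-\tfrac1{b-1}p\partial_p-\tfrac1{b-1}r\partial_r$, with brackets $[X_1,X_2]=0$, $[X_1,X_3]=-X_3$, $[X_1,X_4]=0$, $[X_1,X_5]=-\tfrac{b}{b-1}X_5$, $[X_2,X_3]=0$, $[X_2,X_4]=-X_4$, $[X_2,X_5]=\tfrac1{b-1}X_5$; * **(iiib)** $X_1=x\partial_x+y\partial_y+z\partial_z-r\partial_r$, $\ X_2=-y\partial_x+x\partial_y+bz\,\partial_z+(-f(p)+bp)\,\partial_p+(-2Df+br)\,\partial_r$, where $Df=f'(p)\,r$, with brackets $[X_1,X_2]=0$, $[X_1,X_3]=-X_3$, $[X_1,X_4]=-X_4$, $[X_1,X_5]=-X_5$, $[X_2,X_3]=-X_4$, $[X_2,X_4]=X_3$, $[X_2,X_5]=-bX_5$; and $[X_3,X_4]=[X_3,X_5]=[X_4,X_5]=0$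 in all cases. In each case the span of $\partial_x,\partial_y,\partial_z$ is a $3$-dimensional abelian ideal. -/

import Mathlib

open scoped ContDiff

namespace ParaCR

/-- The space `ℝ⁵` of second jets, with coordinates
`m 0 = x`, `m 1 = y`, `m 2 = z`, `m 3 = p = z_x`, `m 4 = r = z_xx`. -/
abbrev Jet : Type := Fin 5 → ℝ

/-! ### The Lie algebra of smooth vector fields on an open subset of the jet space -/

/-- Smooth vector fields on the open set `U`. A field on `U` is represented by its
extension by zero to all of `ℝ⁵`, so that two of them are equal iff they agree on `U`. -/
def VF (U : TopologicalSpace.Opens Jet) : Submodule ℝ (Jet → Jet) where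
  carrier := {V | ContDiffOn ℝ ∞ V (U : Set Jet) ∧ ∀ m ∉ U, V m = 0}
  add_mem' := by
    rintro V W ⟨hV, hV0⟩ ⟨hW, hW0⟩
    exact ⟨hV.add hW, fun m hm => by simp [hV0 m hm, hW0 m hm]⟩
  zero_mem' := ⟨contDiffOn_const, fun _ _ => rfl⟩
  smul_mem' := by
    rintro c V ⟨hV, hV0⟩
    exact ⟨hV.const_smul c, fun m hm => by simp [hV0 m hm]⟩

namespace VF

variable {U : TopologicalSpace.Opens Jet}

theorem contDiffAt (V : VF U) {m : Jet} (hm : m ∈ U) : ContDiffAt ℝ ∞ V.1 m :=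
  V.2.1.contDiffAt (U.isOpen.mem_nhds hm)

theorem differentiableAt (V : VF U) {m : Jet} (hm : m ∈ U) : DifferentiableAt ℝ V.1 m :=
  (contDiffAt V hm).differentiableAt (by simp)

theorem ext_on {V W : VF U} (h : ∀ m ∈ U, V.1 m = W.1 m) : V = W := by
  apply Subtype.ext
  funext m
  by_cases hm : m ∈ U
  · exact h m hm
  · exact (V.2.2 m hm).trans (W.2.2 m hm).symm

open Classical in
/-- The commutator `[V, W] = V W - W V` of vector fields on `U`:
`[V, W](m) = DW(m) V(m) - DV(m) W(m)` for `m ∈ U`. -/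
noncomputable instance : Bracket (VF U) (VF U) where
  bracket V W :=
    ⟨fun m => if m ∈ U then VectorField.lieBracket ℝ V.1 W.1 m else 0, by
      refine ⟨?_, fun m hm => if_neg hm⟩
      have h : ContDiffOn ℝ ∞ (VectorField.lieBracket ℝ V.1 W.1) (U : Set Jet) := fun m hm =>
        ((contDiffAt V hm).lieBracket_vectorField (contDiffAt W hm) (m := ∞)
          (by simp)).contDiffWithinAt
      exact h.congr fun m hm => if_pos hm⟩

theorem bracket_apply (V W : VF U) {m : Jet} (hm : m ∈ U) :
    (⁅V, W⁆ : VF U).1 m = VectorField.lieBracket ℝ V.1 W.1 m := if_pos hm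

theorem bracket_eventuallyEq (V W : VF U) {m : Jet} (hm : m ∈ U) :
    (⁅V, W⁆ : VF U).1 =ᶠ[nhds m] VectorField.lieBracket ℝ V.1 W.1 := by
  filter_upwards [U.isOpen.mem_nhds hm] with n hn using bracket_apply V W hn

noncomputable instance : LieRing (VF U) where
  add_lie V₁ V₂ W := ext_on fun m hm => by
    have h := VectorField.lieBracket_add_left (W := W.1)
      (differentiableAt V₁ hm) (differentiableAt V₂ hm)
    change (⁅V₁ + V₂, W⁆ : VF U).1 m = (⁅V₁, W⁆ : VF U).1 m + (⁅V₂, W⁆ : VF U).1 m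
    rw [bracket_apply _ _ hm, bracket_apply _ _ hm, bracket_apply _ _ hm]
    exact h
  lie_add V W₁ W₂ := ext_on fun m hm => by
    have h := VectorField.lieBracket_add_right (V := V.1)
      (differentiableAt W₁ hm) (differentiableAt W₂ hm)
    change (⁅V, W₁ + W₂⁆ : VF U).1 m = (⁅V, W₁⁆ : VF U).1 m + (⁅V, W₂⁆ : VF U).1 m
    rw [bracket_apply _ _ hm, bracket_apply _ _ hm, bracket_apply _ _ hm]
    exact h
  lie_self V := ext_on fun m hm => by
    rw [bracket_apply _ _ hm]
    simp [VectorField.lieBracket]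
  leibniz_lie V₁ V₂ V₃ := ext_on fun m hm => by
    have h := VectorField.leibniz_identity_lieBracket (𝕜 := ℝ) (n := ∞)
      (by rw [minSmoothness_of_isRCLikeNormedField]; exact WithTop.coe_le_coe.2 le_top)
      (contDiffAt V₁ hm) (contDiffAt V₂ hm) (contDiffAt V₃ hm)
    have e (A B C : VF U) : (⁅A, ⁅B, C⁆⁆ : VF U).1 m =
        VectorField.lieBracket ℝ A.1 (VectorField.lieBracket ℝ B.1 C.1) m := by
      rw [bracket_apply _ _ hm]
      exact Filter.EventuallyEq.lieBracket_vectorField_eq Filter.EventuallyEq.rfl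
        (bracket_eventuallyEq B C hm)
    have e' (A B C : VF U) : (⁅⁅A, B⁆, C⁆ : VF U).1 m =
        VectorField.lieBracket ℝ (VectorField.lieBracket ℝ A.1 B.1) C.1 m := by
      rw [bracket_apply _ _ hm]
      exact Filter.EventuallyEq.lieBracket_vectorField_eq
        (bracket_eventuallyEq A B hm) Filter.EventuallyEq.rfl
    change (⁅V₁, ⁅V₂, V₃⁆⁆ : VF U).1 m =
      (⁅⁅V₁, V₂⁆, V₃⁆ : VF U).1 m + (⁅V₂, ⁅V₁, V₃⁆⁆ : VF U).1 m
    rw [e, e, e', h]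

noncomputable instance : LieAlgebra ℝ (VF U) where
  lie_smul c V W := ext_on fun m hm => by
    have h := VectorField.lieBracket_const_smul_right (c := c) (V := V.1)
      (differentiableAt W hm)
    change (⁅V, c • W⁆ : VF U).1 m = c • (⁅V, W⁆ : VF U).1 m
    rw [bracket_apply _ _ hm, bracket_apply _ _ hm]
    exact h

end VF

/-! ### The para-CR structure of a pair of PDEs and its point symmetries -/

/-- The total derivative `D = ∂_x + p ∂_z + r ∂_p + H ∂_r` attached to `z_xxx = H`. -/
noncomputable def totalD (H : Jet → ℝ) (g : Jet → ℝ) (m : Jet) : ℝ :=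
  fderiv ℝ g m ![1, 0, m 3, m 4, H m]

/-- The coordinate differential `d(m i)`. -/
noncomputable def dCoord (i : Fin 5) : Jet →L[ℝ] ℝ := ContinuousLinearMap.proj i

/-- The coframe `ω¹, …, ω⁵` (with indices shifted to `0, …, 4`) of the pair
`z_y = F`, `z_xxx = H`, where `F` and `H` are functions of `(x, y, z, p, r)`:
`dz - p dx - F dy`, `dp - r dx - DF dy`, `dr - H dx - D²F dy`, `dx`, `dy`. -/
noncomputable def coframe (F H : Jet → ℝ) : Fin 5 → Jet → (Jet →L[ℝ] ℝ) :=
  ![fun m => dCoord 2 - m 3 • dCoord 0 - F m • dCoord 1,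
    fun m => dCoord 3 - m 4 • dCoord 0 - totalD H F m • dCoord 1,
    fun m => dCoord 4 - H m • dCoord 0 - totalD H (totalD H F) m • dCoord 1,
    fun _ => dCoord 0,
    fun _ => dCoord 1]

/-- The Lie derivative of a one-form:
`(L_X θ)_m (v) = (Dθ(m) (X m)) (v) + θ_m (DX(m) v)`. -/
noncomputable def lieDeriv (X : Jet → Jet) (θ : Jet → (Jet →L[ℝ] ℝ)) (m : Jet) :
    Jet →L[ℝ] ℝ :=
  fderiv ℝ θ m (X m) + (θ m).comp (fderiv ℝ X m)

/-- The wedge product `α₁ ∧ ⋯ ∧ α_k` of covectors: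
`(α₁ ∧ ⋯ ∧ α_k)(v₁, …, v_k) = det (α_i (v_j))`. -/
noncomputable def wedge {k : ℕ} (α : Fin k → (Jet →L[ℝ] ℝ)) (v : Fin k → Jet) : ℝ :=
  Matrix.det (Matrix.of fun i j => α i (v j))

/-- `X` is an infinitesimal point automorphism, on `U`, of the para-CR structure of the pair
`z_y = F`, `z_xxx = H`: its Lie derivative preserves `ω¹` up to a factor, the span of
`ω¹, ω², ω³`, and the span of `ω¹, ω⁴, ω⁵`. -/
def IsPointSymmetry (F H : Jet → ℝ) (U : Set Jet) (X : Jet → Jet) : Prop :=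
  ∀ m ∈ U,
    wedge ![lieDeriv X (coframe F H 0) m, coframe F H 0 m] = 0 ∧
    wedge ![lieDeriv X (coframe F H 1) m,
      coframe F H 0 m, coframe F H 1 m, coframe F H 2 m] = 0 ∧
    wedge ![lieDeriv X (coframe F H 2) m,
      coframe F H 0 m, coframe F H 1 m, coframe F H 2 m] = 0 ∧
    wedge ![lieDeriv X (coframe F H 3) m,
      coframe F H 0 m, coframe F H 3 m, coframe F H 4 m] = 0 ∧
    wedge ![lieDeriv X (coframe F H 4) m,
      coframe F H 0 m, coframe F H 3 m, coframe F H 4 m] = 0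

/-- `L` is the Lie algebra of all smooth infinitesimal point automorphisms on `U` of the pair
`z_y = F`, `z_xxx = H`. -/
def IsPointSymmetryAlgebra (F H : Jet → ℝ) (U : TopologicalSpace.Opens Jet)
    (L : LieSubalgebra ℝ (VF U)) : Prop :=
  ∀ X : VF U, X ∈ L ↔ IsPointSymmetry F H U X.1

/-! ### The homogeneous models -/

/-- Model (ii): `z_y = (z_x)² / 4`. -/
noncomputable def F₂ (m : Jet) : ℝ := 1 / 4 * m 3 ^ 2

/-- Model (ii): `z_xxx = (z_xx)³`. -/
noncomputable def H₂ (m : Jet) : ℝ := m 4 ^ 3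

/-- Model (iiia): `z_y = (z_x)^b / 4`, where `z_x > 0`. -/
noncomputable def F₃a (b : ℝ) (m : Jet) : ℝ := 1 / 4 * m 3 ^ b

/-- Model (iiia): `z_xxx = (2 - b) (z_xx)² / z_x`, where `z_x > 0`. -/
noncomputable def H₃a (b : ℝ) (m : Jet) : ℝ := (2 - b) * (m 4 ^ 2 / m 3)

/-- `f` is a smooth solution on the open set `I` of the implicit equation
`(p² + f(p)²) exp (2 b arctan ((b p - f(p)) / (p + b f(p)))) = 1 + b²`, at places where this
equation and the function `h` of model (iiib) make sense. -/
structure IsImplicitSolution (b : ℝ) (I : Set ℝ) (f : ℝ → ℝ) : Prop where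
  isOpen : IsOpen I
  smooth : ContDiffOn ℝ ∞ f I
  arctan_denom_ne : ∀ p ∈ I, p + b * f p ≠ 0
  h_denom_ne : ∀ p ∈ I, f p - b * p ≠ 0
  eqn : ∀ p ∈ I,
    (p ^ 2 + f p ^ 2) * Real.exp (2 * b * Real.arctan ((b * p - f p) / (p + b * f p))) =
      1 + b ^ 2

/-- Model (iiib): `z_y = f(z_x)`. -/
def F₃b (f : ℝ → ℝ) (m : Jet) : ℝ := f (m 3)

/-- Model (iiib): `h(p) = ((b² - 3) p - 4 b f(p)) / (f(p) - b p)²`. -/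
noncomputable def h₃b (b : ℝ) (f : ℝ → ℝ) (p : ℝ) : ℝ :=
  ((b ^ 2 - 3) * p - 4 * b * f p) / (f p - b * p) ^ 2

/-- Model (iiib): `z_xxx = h(z_x) (z_xx)²`. -/
noncomputable def H₃b (b : ℝ) (f : ℝ → ℝ) (m : Jet) : ℝ := h₃b b f (m 3) * m 4 ^ 2

end ParaCR

open ParaCR

namespace ParaCR

/-! ### Wedge products and spans of covectors -/

/-! Each wedge condition says that a Lie derivative vanishes on the common kernel of the forms it is
wedged with, so automorphisms are the solutions of linear first-order equations
(`isPointSymmetry_iff`). These equations force the x, y, z components to depend on x, y, z alone and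
determine the p and r components by prolongation. A symmetry is therefore known from its projection
to xyz-space (`SymmetryEquations.eq_zero`).

The equation z_y = f(z_x) attaches to each base point the curve p ↦ (p, f(p)) of contact planes dz =
p dx + f(p) dy. A symmetry preserves these curves, so the 3×3 Jacobian J of its base components
satisfies a tangency condition along the curve (`ModelData.eventually_tangency`). With the base
point fixed and p varying, this is an identity between monomials in p and f(p), and their linear
independence gives linear relations on J. In (iiia), p and f(p) are eigenfunctions of p d/dp with
eigenvalues 1 and b. In (iiib) the curve is a logarithmic spiral, and p ± i f(p) are eigenfunctions
of (bp - f) d/dp with eigenvalues b ± i. Products of eigenfunctions have the sums as eigenvalues,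
and distinct eigenvalues give independence by a Vandermonde argument
(`eq_zero_of_sum_eigenfunctions`). In both cases J lies in a two-dimensional space, and the symmetry
of second derivatives makes it constant on the connected set U; the third-order equation is not
needed for this bound. In (ii) the curve is a conic and J is only confined to a four-dimensional
space; comparing powers of r in the third-order equation (`third_order_ii`) removes two more
dimensions and again makes J constant.

Hence the base components are affine, with linear part in the span of two explicit matrices. The two
corresponding linear fields and the three translations are checked to be symmetries, so they span
all of them (`mem_span_generators_iff`). Brackets are read off from the matrices, and the resulting
table bounds the derived series (`BracketTable.isSolvable`). -/

theorem wedge_two_eq_zero_iff {α β : Jet →L[ℝ] ℝ} {w : Jet} (hw : β w = 1) :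
    wedge ![α, β] = 0 ↔ ∀ v, β v = 0 → α v = 0 := by
  constructor
  · intro h v hv
    -- With β v = 0 and β w = 1, the determinant at (v, w) is α v.
    have := congrFun h ![v, w]
    simpa [wedge, Matrix.det_fin_two, hv, hw] using this
  · intro h
    have key : ∀ v, α v = α w * β v := by
      intro v
      have := h (v - β v • w) (by simp [hw])
      simp only [map_sub, map_smul, smul_eq_mul] at this
      linarith
    funext v
    simp only [wedge, Matrix.det_fin_two, Matrix.of_apply, Pi.zero_apply,
      Matrix.cons_val_zero, Matrix.cons_val_one]
    rw [key (v 0), key (v 1)]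
    ring

/-- The vectors `w₁`, `w₂`, `w₃` are dual to the `βᵢ`. They isolate α v as a determinant when v is
in the common kernel, and they give the coefficients of α in the span of the `βᵢ`. -/
theorem wedge_four_eq_zero_iff {α β₁ β₂ β₃ : Jet →L[ℝ] ℝ} {w₁ w₂ w₃ : Jet}
    (h₁₁ : β₁ w₁ = 1) (h₁₂ : β₁ w₂ = 0) (h₁₃ : β₁ w₃ = 0)
    (h₂₁ : β₂ w₁ = 0) (h₂₂ : β₂ w₂ = 1) (h₂₃ : β₂ w₃ = 0)
    (h₃₁ : β₃ w₁ = 0) (h₃₂ : β₃ w₂ = 0) (h₃₃ : β₃ w₃ = 1) :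
    wedge ![α, β₁, β₂, β₃] = 0 ↔ ∀ v, β₁ v = 0 → β₂ v = 0 → β₃ v = 0 → α v = 0 := by
  constructor
  · intro h v h1 h2 h3
    have := congrFun h ![v, w₁, w₂, w₃]
    simpa [wedge, Matrix.det_succ_column_zero, Fin.sum_univ_succ, Fin.succAbove, *] using this
  · intro h
    have key : ∀ v, α v = α w₁ * β₁ v + α w₂ * β₂ v + α w₃ * β₃ v := by
      intro v
      have := h (v - β₁ v • w₁ - β₂ v • w₂ - β₃ v • w₃) (by simp [*]) (by simp [*]) (by simp [*])
      simp only [map_sub, map_smul, smul_eq_mul] at this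
      linarith
    funext v
    rw [wedge, Pi.zero_apply, ← Matrix.exists_vecMul_eq_zero_iff]
    -- The relation α = Σ α(wᵢ) βᵢ is a linear dependence between the rows of the matrix.
    refine ⟨![-1, α w₁, α w₂, α w₃], fun h0 => by simpa using congrFun h0 0, ?_⟩
    funext j
    simp only [Matrix.vecMul, dotProduct, Fin.sum_univ_four, Matrix.of_apply, Pi.zero_apply,
      Matrix.cons_val]
    rw [key (v j)]
    ring

/-! ### Point symmetries as linear equations on kernels -/

theorem hasFDerivAt_contactForm (i : Fin 5) {a c : Jet → ℝ} {m : Jet}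
    (ha : DifferentiableAt ℝ a m) (hc : DifferentiableAt ℝ c m) :
    HasFDerivAt (fun m => dCoord i - a m • dCoord 0 - c m • dCoord 1)
      (-(fderiv ℝ a m).smulRight (dCoord 0) - (fderiv ℝ c m).smulRight (dCoord 1)) m := by
  have := ((hasFDerivAt_const (dCoord i) m).sub
    (ha.hasFDerivAt.smul_const (dCoord 0))).sub (hc.hasFDerivAt.smul_const (dCoord 1))
  rwa [zero_sub] at this

theorem lieDeriv_contactForm (X : Jet → Jet) (i : Fin 5) {a c : Jet → ℝ} {m : Jet}
    (ha : DifferentiableAt ℝ a m) (hc : DifferentiableAt ℝ c m) (v : Jet) :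
    lieDeriv X (fun m => dCoord i - a m • dCoord 0 - c m • dCoord 1) m v =
      fderiv ℝ X m v i - a m * fderiv ℝ X m v 0 - c m * fderiv ℝ X m v 1
        - fderiv ℝ a m (X m) * v 0 - fderiv ℝ c m (X m) * v 1 := by
  rw [lieDeriv, (hasFDerivAt_contactForm i ha hc).fderiv]
  simp [dCoord]
  ring

theorem lieDeriv_dCoord (X : Jet → Jet) (i : Fin 5) (m v : Jet) :
    lieDeriv X (fun _ => dCoord i) m v = fderiv ℝ X m v i := by
  simp [lieDeriv, dCoord]

theorem differentiableAt_coord (i : Fin 5) (m : Jet) : DifferentiableAt ℝ (fun m : Jet => m i) m :=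
  (dCoord i).differentiableAt

theorem fderiv_coord (i : Fin 5) (m v : Jet) : fderiv ℝ (fun m : Jet => m i) m v = v i :=
  congrArg (fun L : Jet →L[ℝ] ℝ => L v) (dCoord i).fderiv

/-- The equations of an infinitesimal point automorphism at the point `m`. -/
structure SymmetryEquations (F H : Jet → ℝ) (X : Jet → Jet) (m : Jet) : Prop where
  contact : ∀ v : Jet, v 2 = m 3 * v 0 + F m * v 1 →
    fderiv ℝ X m v 2 - m 3 * fderiv ℝ X m v 0 - F m * fderiv ℝ X m v 1
      - X m 3 * v 0 - fderiv ℝ F m (X m) * v 1 = 0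
  second : ∀ v : Jet, v 2 = m 3 * v 0 + F m * v 1 → v 3 = m 4 * v 0 + totalD H F m * v 1 →
    v 4 = H m * v 0 + totalD H (totalD H F) m * v 1 →
    fderiv ℝ X m v 3 - m 4 * fderiv ℝ X m v 0 - totalD H F m * fderiv ℝ X m v 1
      - X m 4 * v 0 - fderiv ℝ (totalD H F) m (X m) * v 1 = 0
  third : ∀ v : Jet, v 2 = m 3 * v 0 + F m * v 1 → v 3 = m 4 * v 0 + totalD H F m * v 1 →
    v 4 = H m * v 0 + totalD H (totalD H F) m * v 1 →
    fderiv ℝ X m v 4 - H m * fderiv ℝ X m v 0 - totalD H (totalD H F) m * fderiv ℝ X m v 1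
      - fderiv ℝ H m (X m) * v 0 - fderiv ℝ (totalD H (totalD H F)) m (X m) * v 1 = 0
  fst : ∀ v : Jet, v 0 = 0 → v 1 = 0 → v 2 = 0 → fderiv ℝ X m v 0 = 0
  snd : ∀ v : Jet, v 0 = 0 → v 1 = 0 → v 2 = 0 → fderiv ℝ X m v 1 = 0

/-- Membership of a covector in a span is the same as vanishing on the common kernel of that span.
Differentiability of the coefficients of the coframe is what allows the Lie derivatives to be
expanded. -/
theorem isPointSymmetry_iff {F H : Jet → ℝ} {U : Set Jet}
    (hF : ∀ m ∈ U, DifferentiableAt ℝ F m) (hH : ∀ m ∈ U, DifferentiableAt ℝ H m)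
    (hDF : ∀ m ∈ U, DifferentiableAt ℝ (totalD H F) m)
    (hDDF : ∀ m ∈ U, DifferentiableAt ℝ (totalD H (totalD H F)) m) (X : Jet → Jet) :
    IsPointSymmetry F H U X ↔ ∀ m ∈ U, SymmetryEquations F H X m := by
  refine forall₂_congr fun m hm => ?_
  rw [wedge_two_eq_zero_iff (w := Pi.single 2 1) (by simp [coframe, dCoord]),
    wedge_four_eq_zero_iff (w₁ := Pi.single 2 1) (w₂ := Pi.single 3 1) (w₃ := Pi.single 4 1)
      (by simp [coframe, dCoord]) (by simp [coframe, dCoord]) (by simp [coframe, dCoord])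
      (by simp [coframe, dCoord]) (by simp [coframe, dCoord]) (by simp [coframe, dCoord])
      (by simp [coframe, dCoord]) (by simp [coframe, dCoord]) (by simp [coframe, dCoord]),
    wedge_four_eq_zero_iff (w₁ := Pi.single 2 1) (w₂ := Pi.single 3 1) (w₃ := Pi.single 4 1)
      (by simp [coframe, dCoord]) (by simp [coframe, dCoord]) (by simp [coframe, dCoord])
      (by simp [coframe, dCoord]) (by simp [coframe, dCoord]) (by simp [coframe, dCoord])
      (by simp [coframe, dCoord]) (by simp [coframe, dCoord]) (by simp [coframe, dCoord]),
    wedge_four_eq_zero_iff (w₁ := Pi.single 2 1) (w₂ := ![1, 0, m 3, 0, 0])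
      (w₃ := ![0, 1, F m, 0, 0])
      (by simp [coframe, dCoord]) (by simp [coframe, dCoord]) (by simp [coframe, dCoord])
      (by simp [coframe, dCoord]) (by simp [coframe, dCoord]) (by simp [coframe, dCoord])
      (by simp [coframe, dCoord]) (by simp [coframe, dCoord]) (by simp [coframe, dCoord]),
    -- For ω¹, dx, dy the dual vectors are ∂_z, ∂_x + p ∂_z and ∂_y + F ∂_z; the last two are
    -- corrected so as to lie in the kernel of ω¹.
    wedge_four_eq_zero_iff (w₁ := Pi.single 2 1) (w₂ := ![1, 0, m 3, 0, 0])
      (w₃ := ![0, 1, F m, 0, 0])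
      (by simp [coframe, dCoord]) (by simp [coframe, dCoord]) (by simp [coframe, dCoord])
      (by simp [coframe, dCoord]) (by simp [coframe, dCoord]) (by simp [coframe, dCoord])
      (by simp [coframe, dCoord]) (by simp [coframe, dCoord]) (by simp [coframe, dCoord])]
  have e0 (v : Jet) : coframe F H 0 m v = v 2 - m 3 * v 0 - F m * v 1 := by
    simp [coframe, dCoord]
  have e1 (v : Jet) : coframe F H 1 m v = v 3 - m 4 * v 0 - totalD H F m * v 1 := by
    simp [coframe, dCoord]
  have e2 (v : Jet) :
      coframe F H 2 m v = v 4 - H m * v 0 - totalD H (totalD H F) m * v 1 := by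
    simp [coframe, dCoord]
  have e3 (v : Jet) : coframe F H 3 m v = v 0 := rfl
  have e4 (v : Jet) : coframe F H 4 m v = v 1 := rfl
  have l0 (v : Jet) := lieDeriv_contactForm X 2 (differentiableAt_coord 3 m) (hF m hm) v
  have l1 (v : Jet) := lieDeriv_contactForm X 3 (differentiableAt_coord 4 m) (hDF m hm) v
  have l2 (v : Jet) := lieDeriv_contactForm X 4 (hH m hm) (hDDF m hm) v
  simp only [fderiv_coord] at l0 l1
  change (∀ v, _ → lieDeriv X
      (fun m => dCoord 2 - m 3 • dCoord 0 - F m • dCoord 1) m v = 0) ∧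
    (∀ v, _ → _ → _ → lieDeriv X
      (fun m => dCoord 3 - m 4 • dCoord 0 - totalD H F m • dCoord 1) m v = 0) ∧
    (∀ v, _ → _ → _ → lieDeriv X
      (fun m => dCoord 4 - H m • dCoord 0 - totalD H (totalD H F) m • dCoord 1) m v = 0) ∧
    (∀ v, _ → _ → _ → lieDeriv X (fun _ => dCoord 0) m v = 0) ∧
    (∀ v, _ → _ → _ → lieDeriv X (fun _ => dCoord 1) m v = 0) ↔ _
  simp only [e0, e1, e2, e3, e4, l0, l1, l2, lieDeriv_dCoord]
  have eq (a b c : ℝ) : a - b - c = 0 ↔ a = b + c :=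
    ⟨fun h => by linarith, fun h => by linarith⟩
  constructor
  · rintro ⟨h0, h1, h2, h3, h4⟩
    refine ⟨fun v hv => h0 v ((eq _ _ _).2 hv), fun v a b c => h1 v ((eq _ _ _).2 a)
      ((eq _ _ _).2 b) ((eq _ _ _).2 c), fun v a b c => h2 v ((eq _ _ _).2 a)
      ((eq _ _ _).2 b) ((eq _ _ _).2 c), fun v a b c => h3 v (by simp [a, b, c]) a b,
      fun v a b c => h4 v (by simp [a, b, c]) a b⟩
  · rintro ⟨h0, h1, h2, h3, h4⟩
    refine ⟨fun v hv => h0 v ((eq _ _ _).1 hv), fun v a b c => h1 v ((eq _ _ _).1 a)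
      ((eq _ _ _).1 b) ((eq _ _ _).1 c), fun v a b c => h2 v ((eq _ _ _).1 a)
      ((eq _ _ _).1 b) ((eq _ _ _).1 c), fun v a b c => h3 v b c (by simpa [b, c] using a),
      fun v a b c => h4 v b c (by simpa [b, c] using a)⟩

/-- Point symmetries form a linear space, described here by the symmetry equations. -/
theorem SymmetryEquations.add {F H : Jet → ℝ} {X Y : Jet → Jet} {m : Jet}
    (hX : DifferentiableAt ℝ X m) (hY : DifferentiableAt ℝ Y m)
    (h : SymmetryEquations F H X m) (h' : SymmetryEquations F H Y m) :
    SymmetryEquations F H (X + Y) m := by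
  have e : fderiv ℝ (X + Y) m = fderiv ℝ X m + fderiv ℝ Y m := fderiv_add hX hY
  constructor <;> intro v
  · intro a
    have := h.contact v a
    have := h'.contact v a
    simp only [e, _root_.add_apply, Pi.add_apply, map_add]
    linarith
  · intro a b c
    have := h.second v a b c
    have := h'.second v a b c
    simp only [e, _root_.add_apply, Pi.add_apply, map_add]
    linarith
  · intro a b c
    have := h.third v a b c
    have := h'.third v a b c
    simp only [e, _root_.add_apply, Pi.add_apply, map_add]
    linarith
  · intro a b c
    simp [e, h.fst v a b c, h'.fst v a b c]
  · intro a b c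
    simp [e, h.snd v a b c, h'.snd v a b c]

theorem SymmetryEquations.smul {F H : Jet → ℝ} {X : Jet → Jet} {m : Jet}
    (hX : DifferentiableAt ℝ X m) (h : SymmetryEquations F H X m) (c : ℝ) :
    SymmetryEquations F H (c • X) m := by
  have e : fderiv ℝ (c • X) m = c • fderiv ℝ X m := fderiv_const_smul hX c
  constructor <;> intro v
  · intro h2
    simp only [e, _root_.smul_apply, Pi.smul_apply, map_smul, smul_eq_mul]
    linear_combination c * h.contact v h2
  · intro h2 h3 h4
    simp only [e, _root_.smul_apply, Pi.smul_apply, map_smul, smul_eq_mul]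
    linear_combination c * h.second v h2 h3 h4
  · intro h2 h3 h4
    simp only [e, _root_.smul_apply, Pi.smul_apply, map_smul, smul_eq_mul]
    linear_combination c * h.third v h2 h3 h4
  · intro h0 h1 h2
    simp [e, h.fst v h0 h1 h2]
  · intro h0 h1 h2
    simp [e, h.snd v h0 h1 h2]

/-- A point symmetry with vanishing `x`, `y` and `z` components vanishes. -/
theorem SymmetryEquations.eq_zero {F H : Jet → ℝ} {U : TopologicalSpace.Opens Jet} {X : VF U}
    (h : ∀ m ∈ U, SymmetryEquations F H X.1 m)
    (h0 : ∀ m ∈ U, X.1 m 0 = 0) (h1 : ∀ m ∈ U, X.1 m 1 = 0) (h2 : ∀ m ∈ U, X.1 m 2 = 0) :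
    X = 0 := by
  have d {i : Fin 5} (hi : ∀ m ∈ U, X.1 m i = 0) {m : Jet} (hm : m ∈ U) (v : Jet) :
      fderiv ℝ X.1 m v i = 0 := by
    have e := fderiv_apply (VF.differentiableAt X hm) i
    have : (fun m => X.1 m i) =ᶠ[nhds m] fun _ => 0 := by
      filter_upwards [U.isOpen.mem_nhds hm] with n hn using hi n hn
    rw [this.fderiv_eq] at e
    simpa using (congrArg (fun L : Jet →L[ℝ] ℝ => L v) e).symm
  -- Prolongation: the contact equation on ∂_x + p ∂_z expresses the p component through derivatives
  -- of the base components, and the second equation on D then expresses the r component.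
  have h3 : ∀ m ∈ U, X.1 m 3 = 0 := fun m hm => by
    simpa [d h0 hm, d h1 hm, d h2 hm] using (h m hm).contact ![1, 0, m 3, 0, 0] (by simp)
  have h4 : ∀ m ∈ U, X.1 m 4 = 0 := fun m hm => by
    simpa [d h0 hm, d h1 hm, d h3 hm] using
      (h m hm).second ![1, 0, m 3, m 4, H m] (by simp) (by simp) (by simp)
  refine VF.ext_on fun m hm => ?_
  funext i
  fin_cases i
  exacts [h0 m hm, h1 m hm, h2 m hm, h3 m hm, h4 m hm]

/-! ### Independence of eigenfunctions of a first-order operator -/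

/-- Functions `g i` with `g i' = l i * g i * w` for distinct `l i` are linearly independent
near any point where none of them vanishes. -/
theorem eq_zero_of_sum_eigenfunctions {𝕜 : Type*} [NontriviallyNormedField 𝕜] [NormedAlgebra ℝ 𝕜]
    {n : ℕ} {c l : Fin n → 𝕜} {g : Fin n → ℝ → 𝕜} {w : ℝ → 𝕜} {p₀ : ℝ}
    (hl : Function.Injective l)
    (hw : ∀ᶠ p in nhds p₀, w p ≠ 0)
    (hg : ∀ᶠ p in nhds p₀, ∀ i, HasDerivAt (g i) (l i * g i p * w p) p)
    (hsum : ∀ᶠ p in nhds p₀, ∑ i, c i * g i p = 0) (h0 : ∀ i, g i p₀ ≠ 0) (i : Fin n) :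
    c i = 0 := by
  -- Applying w⁻¹ d/dp to the relation multiplies its i-th term by `l i`, so iteration gives a
  -- relation weighted by every power of the `l i`.
  have key : ∀ k : ℕ, ∀ᶠ p in nhds p₀, ∑ i, c i * g i p * l i ^ k = 0 := by
    intro k
    induction k with
    | zero => simpa using hsum
    | succ k ih =>
      filter_upwards [ih.eventually_nhds, hg, hw] with p hp hgp hwp
      have h1 : HasDerivAt (fun p => ∑ i, c i * g i p * l i ^ k)
          (∑ i, c i * (l i * g i p * w p) * l i ^ k) p :=
        HasDerivAt.fun_sum fun i _ => ((hgp i).const_mul (c i)).mul_const (l i ^ k)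
      have h2 : (∑ i, c i * (l i * g i p * w p) * l i ^ k) = 0 :=
        h1.unique ((hasDerivAt_const p (0 : 𝕜)).congr_of_eventuallyEq hp)
      have h3 : (∑ i, c i * g i p * l i ^ (k + 1)) * w p = 0 := by
        rw [← h2, Finset.sum_mul]
        exact Finset.sum_congr rfl fun i _ => by ring
      exact (mul_eq_zero.1 h3).resolve_right hwp
  -- Vandermonde argument at `p₀`: the `l i` are distinct, so every term `c i * g i p₀` vanishes.
  have := Matrix.eq_zero_of_forall_pow_sum_mul_pow_eq_zero (v := fun i => c i * g i p₀) hl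
    fun k => (key k).self_of_nhds
  exact (mul_eq_zero.1 (congrFun this i)).resolve_right (h0 i)

/-- Independence of the monomials `u, v, u², uv, v², u²v, uv²` in two eigenfunctions. -/
theorem eq_zero_of_monomials {𝕜 : Type*} [NontriviallyNormedField 𝕜] [NormedAlgebra ℝ 𝕜]
    {l₁ l₂ : 𝕜} {u v w : ℝ → 𝕜} {p₀ : ℝ}
    (hl : Function.Injective
      ![l₁, l₂, 2 * l₁, l₁ + l₂, 2 * l₂, 2 * l₁ + l₂, l₁ + 2 * l₂])
    (hw : ∀ᶠ p in nhds p₀, w p ≠ 0)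
    (hu : ∀ᶠ p in nhds p₀, HasDerivAt u (l₁ * u p * w p) p)
    (hv : ∀ᶠ p in nhds p₀, HasDerivAt v (l₂ * v p * w p) p)
    (hu0 : u p₀ ≠ 0) (hv0 : v p₀ ≠ 0) {c : Fin 7 → 𝕜}
    (hsum : ∀ᶠ p in nhds p₀, c 0 * u p + c 1 * v p + c 2 * (u p * u p) + c 3 * (u p * v p)
      + c 4 * (v p * v p) + c 5 * (u p * u p * v p) + c 6 * (u p * (v p * v p)) = 0)
    (i : Fin 7) : c i = 0 := by
  refine eq_zero_of_sum_eigenfunctions (g := ![u, v, fun p => u p * u p, fun p => u p * v p,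
    fun p => v p * v p, fun p => u p * u p * v p, fun p => u p * (v p * v p)]) hl hw ?_ ?_ ?_ i
  · filter_upwards [hu, hv] with p hup hvp i
    have huu := hup.mul hup
    have huv := hup.mul hvp
    have hvv := hvp.mul hvp
    have h21 := huu.mul hvp
    have h12 := hup.mul hvv
    fin_cases i
    · exact hup
    · exact hvp
    · exact huu.congr_deriv (by simp; ring)
    · exact huv.congr_deriv (by simp; ring)
    · exact hvv.congr_deriv (by simp; ring)
    · exact h21.congr_deriv (by simp; ring)
    · exact h12.congr_deriv (by simp; ring)
  · filter_upwards [hsum] with p hp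
    simpa [Fin.sum_univ_seven] using hp
  · intro i
    fin_cases i <;> simp [hu0, hv0]

/-- A polynomial function of degree at most four vanishing near a point is zero. -/
theorem eq_zero_of_quartic {c₀ c₁ c₂ c₃ c₄ p₀ : ℝ}
    (h : ∀ᶠ p in nhds p₀, c₀ + c₁ * p + c₂ * p ^ 2 + c₃ * p ^ 3 + c₄ * p ^ 4 = 0) :
    c₀ = 0 ∧ c₁ = 0 ∧ c₂ = 0 ∧ c₃ = 0 ∧ c₄ = 0 := by
  open Polynomial in
  let P : ℝ[X] := C c₀ + C c₁ * X + C c₂ * X ^ 2 + C c₃ * X ^ 3 + C c₄ * X ^ 4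
  have hP : P = 0 := by
    refine Polynomial.eq_zero_of_infinite_isRoot P (Set.Infinite.mono ?_
      (infinite_of_mem_nhds p₀ h))
    intro p hp
    simpa [P, Polynomial.IsRoot] using hp
  have hc (k : ℕ) : P.coeff k = 0 := by rw [hP, Polynomial.coeff_zero]
  refine ⟨?_, ?_, ?_, ?_, ?_⟩
  · simpa [P, Polynomial.coeff_X, Polynomial.coeff_X_pow, Polynomial.coeff_C] using hc 0
  · simpa [P, Polynomial.coeff_X, Polynomial.coeff_X_pow, Polynomial.coeff_C] using hc 1
  · simpa [P, Polynomial.coeff_X, Polynomial.coeff_X_pow, Polynomial.coeff_C] using hc 2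
  · simpa [P, Polynomial.coeff_X, Polynomial.coeff_X_pow, Polynomial.coeff_C] using hc 3
  · simpa [P, Polynomial.coeff_X, Polynomial.coeff_X_pow, Polynomial.coeff_C] using hc 4

/-! ### The logarithmic spiral -/

/-- The implicit equation of model (iiib) is the differential equation of a logarithmic spiral. -/
theorem IsImplicitSolution.hasDerivAt {b : ℝ} {I : Set ℝ} {f : ℝ → ℝ}
    (hf : IsImplicitSolution b I f) {p : ℝ} (hp : p ∈ I) :
    HasDerivAt f ((p + b * f p) / (b * p - f p)) p := by
  have hd : HasDerivAt f (deriv f p) p :=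
    ((hf.smooth.contDiffAt (hf.isOpen.mem_nhds hp)).differentiableAt (by simp)).hasDerivAt
  have hn1 := hf.arctan_denom_ne p hp
  have hn2 : b * p - f p ≠ 0 := fun h => hf.h_denom_ne p hp (by linarith)
  have hq := (((hasDerivAt_id p).const_mul b).sub hd).div
    ((hasDerivAt_id p).add (hd.const_mul b)) hn1
  have hE := ((hq.arctan).const_mul (2 * b)).exp
  have hG := ((((hasDerivAt_id p).pow 2).add (hd.pow 2)).mul hE)
  have hev : (fun p => (p ^ 2 + f p ^ 2) *
      Real.exp (2 * b * Real.arctan ((b * p - f p) / (p + b * f p)))) =ᶠ[nhds p]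
      fun _ => 1 + b ^ 2 := by
    filter_upwards [hf.isOpen.mem_nhds hp] with q hq using hf.eqn q hq
  have h0 := hG.unique ((hasDerivAt_const p (1 + b ^ 2)).congr_of_eventuallyEq hev)
  -- Otherwise the implicit equation would read 0 = 1 + b².
  have hsq : p ^ 2 + f p ^ 2 ≠ 0 := fun h => by
    have := hf.eqn p hp
    rw [h, zero_mul] at this
    nlinarith [sq_nonneg b]
  simp only [id, Pi.add_apply, Pi.sub_apply, Pi.pow_apply, Pi.div_apply] at h0
  have hpos := Real.exp_pos (2 * b * Real.arctan ((b * p - f p) / (p + b * f p)))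
  set E := Real.exp (2 * b * Real.arctan ((b * p - f p) / (p + b * f p))) with hEdef
  have hb : (1 + b ^ 2 : ℝ) ≠ 0 := by positivity
  -- Where θ = arctan(f/p) is defined, (bp - f)/(p + bf) is tan(arctan b - θ), so its arctangent has
  -- derivative -θ' = (f - p f')/(p² + f²). `hone` and `hquot` verify this algebraically, which also
  -- covers p = 0. In polar form the implicit equation is ρ² exp(-2bθ) = const.
  have hone : 1 + ((b * p - f p) / (p + b * f p)) ^ 2 =
      (1 + b ^ 2) * (p ^ 2 + f p ^ 2) / (p + b * f p) ^ 2 := by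
    field_simp
    ring
  have hquot : 1 / ((1 + b ^ 2) * (p ^ 2 + f p ^ 2) / (p + b * f p) ^ 2) *
      (((b * 1 - deriv f p) * (p + b * f p) - (b * p - f p) * (1 + b * deriv f p)) /
        (p + b * f p) ^ 2) = (f p - p * deriv f p) / (p ^ 2 + f p ^ 2) := by
    rw [show (b * 1 - deriv f p) * (p + b * f p) - (b * p - f p) * (1 + b * deriv f p) =
      (1 + b ^ 2) * (f p - p * deriv f p) by ring]
    field_simp
  rw [hone] at h0
  have h1 : p + f p * deriv f p + b * (f p - p * deriv f p) = 0 := by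
    have h2 : 2 * E * (p + f p * deriv f p + b * (f p - p * deriv f p)) = 0 := by
      rw [← h0, hquot]
      field_simp
      ring
    exact (mul_eq_zero.1 h2).resolve_left (by positivity)
  have : deriv f p = (p + b * f p) / (b * p - f p) := by
    rw [eq_div_iff hn2]
    linarith
  rwa [this] at hd

/-- Independence of the monomials `p, f, p², pf, f², p(p²+f²), f(p²+f²)` on a logarithmic
spiral. -/
theorem eq_zero_of_spiral {b p₀ : ℝ} (hb : 0 < b) {f : ℝ → ℝ}
    (hf : ∀ᶠ p in nhds p₀, HasDerivAt f ((p + b * f p) / (b * p - f p)) p)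
    (hn : ∀ᶠ p in nhds p₀, b * p - f p ≠ 0) {c : Fin 7 → ℝ}
    (h : ∀ᶠ p in nhds p₀, c 0 * p + c 1 * f p + c 2 * p ^ 2 + c 3 * (p * f p) + c 4 * f p ^ 2
      + (p ^ 2 + f p ^ 2) * (c 5 * p + c 6 * f p) = 0) (i : Fin 7) : c i = 0 := by
  have hI : Complex.I * Complex.I = -1 := Complex.I_mul_I
  -- If p ± i f vanished, then p = f = 0, which contradicts bp - f ≠ 0.
  have hne (s : ℝ) (hs : s ^ 2 = 1) : (p₀ : ℂ) + s * f p₀ * Complex.I ≠ 0 := fun h0 => by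
    have hre := congrArg Complex.re h0
    have him := congrArg Complex.im h0
    simp at hre him
    have hf0 : f p₀ = 0 := him.resolve_left (by rintro rfl; norm_num at hs)
    exact hn.self_of_nhds (by rw [hf0, hre]; ring)
  -- For s = ±1 the spiral equation is (bp - f)(1 + s i f') = (b + s i)(p + s i f).
  have hder (s : ℝ) (hs : s ^ 2 = 1) : ∀ᶠ p in nhds p₀,
      HasDerivAt (fun p : ℝ => (p : ℂ) + s * f p * Complex.I)
        (((b : ℂ) + s * Complex.I) * (p + s * f p * Complex.I) * ((b * p - f p : ℝ) : ℂ)⁻¹) p := by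
    filter_upwards [hf, hn] with p hfp hnp
    have h1 := (Complex.ofRealCLM.hasDerivAt (x := p)).add
      (((hfp.ofReal_comp).const_mul (s : ℂ)).mul_const Complex.I)
    refine h1.congr_deriv ?_
    have hnp' : (b : ℂ) * p - f p ≠ 0 := by exact_mod_cast hnp
    have hs' : (s : ℂ) ^ 2 = 1 := by exact_mod_cast hs
    simp only [Complex.ofRealCLM_apply, Complex.ofReal_one, Complex.ofReal_div,
      Complex.ofReal_add, Complex.ofReal_mul, Complex.ofReal_sub]
    have hinv := mul_inv_cancel₀ hnp'
    rw [div_eq_mul_inv]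
    linear_combination -hinv - ((b : ℂ) * p - f p)⁻¹ * f p * s ^ 2 * hI
      + ((b : ℂ) * p - f p)⁻¹ * f p * hs'
  have key := eq_zero_of_monomials (𝕜 := ℂ) (p₀ := p₀)
    (u := fun p : ℝ => (p : ℂ) + (1 : ℝ) * f p * Complex.I)
    (v := fun p : ℝ => (p : ℂ) + (-1 : ℝ) * f p * Complex.I)
    (w := fun p => ((b * p - f p : ℝ) : ℂ)⁻¹) (l₁ := (b : ℂ) + (1 : ℝ) * Complex.I)
    (l₂ := (b : ℂ) + (-1 : ℝ) * Complex.I)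
    -- The coefficients after substituting p = (u + v)/2, f = (u - v)/(2i) and p² + f² = uv.
    (c := ![(c 0 - c 1 * Complex.I) / 2, (c 0 + c 1 * Complex.I) / 2,
      (c 2 - c 4 - c 3 * Complex.I) / 4, (c 2 + c 4) / 2, (c 2 - c 4 + c 3 * Complex.I) / 4,
      (c 5 - c 6 * Complex.I) / 2, (c 5 + c 6 * Complex.I) / 2])
    (by
      -- The eigenvalues are b ± i, 2b ± 2i, 2b and 3b ± i. Since b > 0, the real part separates the
      -- degrees, and the imaginary part separates the monomials of one degree.
      intro i j hij
      have hre := congrArg Complex.re hij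
      have him := congrArg Complex.im hij
      fin_cases i <;> fin_cases j <;> first | rfl | (exfalso; norm_num at hre him; done) |
        (exfalso; norm_num at hre him; linarith))
    (by filter_upwards [hn] with p hp using inv_ne_zero (by exact_mod_cast hp))
    (hder 1 (by norm_num)) (hder (-1) (by norm_num)) (hne 1 (by norm_num))
    (hne (-1) (by norm_num))
    (by
      filter_upwards [h] with p hp
      have hp' : (c 0 * p + c 1 * f p + c 2 * p ^ 2 + c 3 * (p * f p) + c 4 * f p ^ 2
        + (p ^ 2 + f p ^ 2) * (c 5 * p + c 6 * f p) : ℂ) = 0 := by exact_mod_cast hp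
      have hI2 : Complex.I ^ 2 = -1 := Complex.I_sq
      have hI4 : Complex.I ^ 4 = 1 := Complex.I_pow_four
      rw [← hp']
      simp only [Matrix.cons_val, Complex.ofReal_one, Complex.ofReal_neg]
      ring_nf
      simp only [hI2, hI4]
      ring)
  -- The `c i` are real, so the remaining coefficients are complex conjugates of these and carry no
  -- further information.
  have k0 := key 0
  have k2 := key 2
  have k3 := key 3
  have k5 := key 5
  have hre0 := congrArg Complex.re k0
  have him0 := congrArg Complex.im k0
  have hre2 := congrArg Complex.re k2
  have him2 := congrArg Complex.im k2
  have hre3 := congrArg Complex.re k3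
  have hre5 := congrArg Complex.re k5
  have him5 := congrArg Complex.im k5
  simp at hre0 him0 hre2 him2 hre3 hre5 him5
  fin_cases i <;> simp <;> linarith

/-! ### Partial derivatives of smooth functions on an open set -/

/-- The partial derivative along the `j`-th coordinate. -/
noncomputable def pd (j : Fin 5) (g : Jet → ℝ) (m : Jet) : ℝ := fderiv ℝ g m (Pi.single j 1)

theorem fderiv_eq_sum_pd (g : Jet → ℝ) (m v : Jet) :
    fderiv ℝ g m v = v 0 * pd 0 g m + v 1 * pd 1 g m + v 2 * pd 2 g m + v 3 * pd 3 g m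
      + v 4 * pd 4 g m := by
  have h : v = v 0 • Pi.single 0 1 + v 1 • Pi.single 1 1 + v 2 • Pi.single 2 1
      + v 3 • Pi.single 3 1 + v 4 • Pi.single 4 1 := by
    funext i
    fin_cases i <;> simp
  conv_lhs => rw [h]
  simp only [map_add, map_smul, smul_eq_mul, pd]

section

variable {U : TopologicalSpace.Opens Jet} {g h : Jet → ℝ}

theorem differentiableAt_of_smooth (hg : ContDiffOn ℝ ∞ g U) {m : Jet} (hm : m ∈ U) :
    DifferentiableAt ℝ g m :=
  (hg.contDiffAt (U.isOpen.mem_nhds hm)).differentiableAt (by simp)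

theorem contDiffOn_pd (hg : ContDiffOn ℝ ∞ g U) (j : Fin 5) : ContDiffOn ℝ ∞ (pd j g) U :=
  (hg.fderiv_of_isOpen U.isOpen (by simp)).clm_apply contDiffOn_const

theorem pd_comm (hg : ContDiffOn ℝ ∞ g U) {m : Jet} (hm : m ∈ U) (i j : Fin 5) :
    pd i (pd j g) m = pd j (pd i g) m := by
  have hs : IsSymmSndFDerivAt ℝ g m :=
    (hg.contDiffAt (U.isOpen.mem_nhds hm)).isSymmSndFDerivAt (by
      rw [minSmoothness_of_isRCLikeNormedField]; exact WithTop.coe_le_coe.2 le_top)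
  have hd : DifferentiableAt ℝ (fderiv ℝ g) m :=
    ((hg.fderiv_of_isOpen U.isOpen (m := ∞) (by simp)).contDiffAt
      (U.isOpen.mem_nhds hm)).differentiableAt (by simp)
  have e (i j : Fin 5) : pd i (pd j g) m =
      fderiv ℝ (fderiv ℝ g) m (Pi.single i 1) (Pi.single j 1) := by
    have : HasFDerivAt (pd j g) _ m := hd.hasFDerivAt.clm_apply (hasFDerivAt_const _ m)
    rw [pd, this.fderiv]
    simp
  rw [e, e]
  exact hs _ _

theorem pd_congr (hgh : ∀ m ∈ U, g m = h m) {m : Jet} (hm : m ∈ U) (i : Fin 5) :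
    pd i g m = pd i h m := by
  have : g =ᶠ[nhds m] h := by
    filter_upwards [U.isOpen.mem_nhds hm] with n hn using hgh n hn
  rw [pd, this.fderiv_eq, pd]

theorem pd_const (c : ℝ) (i : Fin 5) (m : Jet) : pd i (fun _ => c) m = 0 := by simp [pd]

theorem pd_eq_zero_of_eq_const {c : ℝ} (hg : ∀ m ∈ U, g m = c) {m : Jet} (hm : m ∈ U)
    (i : Fin 5) : pd i g m = 0 := by rw [pd_congr hg hm, pd_const]

theorem pd_coord (i j : Fin 5) (m : Jet) :
    pd i (fun m => m j) m = if i = j then 1 else 0 := by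
  rw [pd, fderiv_coord, Pi.single_apply]
  simp only [eq_comm]

theorem pd_add {m : Jet} (hg : DifferentiableAt ℝ g m) (hh : DifferentiableAt ℝ h m)
    (i : Fin 5) : pd i (fun m => g m + h m) m = pd i g m + pd i h m := by
  simp only [pd]
  rw [fderiv_fun_add hg hh]
  rfl

theorem pd_sub {m : Jet} (hg : DifferentiableAt ℝ g m) (hh : DifferentiableAt ℝ h m)
    (i : Fin 5) : pd i (fun m => g m - h m) m = pd i g m - pd i h m := by
  simp only [pd]
  rw [fderiv_fun_sub hg hh]
  rfl

theorem pd_const_mul {m : Jet} (hg : DifferentiableAt ℝ g m) (c : ℝ)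
    (i : Fin 5) : pd i (fun m => c * g m) m = c * pd i g m := by
  simp only [pd]
  rw [fderiv_const_mul hg]
  rfl

theorem pd_mul {m : Jet} (hg : DifferentiableAt ℝ g m) (hh : DifferentiableAt ℝ h m)
    (i : Fin 5) : pd i (fun m => g m * h m) m = g m * pd i h m + h m * pd i g m := by
  simp only [pd]
  rw [fderiv_fun_mul hg hh]
  rfl

theorem pd_pd_eq_zero (hg : ContDiffOn ℝ ∞ g U) {i : Fin 5} (hi : ∀ m ∈ U, pd i g m = 0)
    (j : Fin 5) : ∀ m ∈ U, pd i (pd j g) m = 0 := fun m hm => by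
  rw [pd_comm hg hm]
  exact pd_eq_zero_of_eq_const hi hm j

theorem eventually_update_mem {m : Jet} (hm : m ∈ U) (i : Fin 5) :
    ∀ᶠ t in nhds (m i), Function.update m i t ∈ U := by
  have hc : ContinuousAt (Function.update m i) (m i) :=
    (hasDerivAt_update m i (m i)).continuousAt
  refine hc.eventually_mem (U.isOpen.mem_nhds ?_)
  rwa [Function.update_eq_self]

/-- A function whose `i`-th partial derivative vanishes is locally constant along the `i`-th
coordinate lines. -/
theorem eventually_update_eq (hg : ContDiffOn ℝ ∞ g U) {i : Fin 5} (hi : ∀ m ∈ U, pd i g m = 0)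
    {m : Jet} (hm : m ∈ U) : ∀ᶠ t in nhds (m i), g (Function.update m i t) = g m := by
  -- A coordinate line may meet U in a disconnected set, so constancy is only claimed on an interval
  -- around `m i`.
  obtain ⟨ε, hε, hball⟩ := Metric.eventually_nhds_iff_ball.1 (eventually_update_mem hm i)
  have hder : ∀ t ∈ Metric.ball (m i) ε,
      HasDerivAt (fun t => g (Function.update m i t)) 0 t := fun t ht => by
    have := (differentiableAt_of_smooth hg (hball t ht)).hasFDerivAt.comp_hasDerivAt t
      (hasDerivAt_update m i t)
    exact this.congr_deriv (hi _ (hball t ht))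
  filter_upwards [Metric.ball_mem_nhds (m i) hε] with t ht
  have := Metric.isOpen_ball.is_const_of_deriv_eq_zero
    (convex_ball (m i) ε).isPreconnected
    (fun t ht => (hder t ht).differentiableAt.differentiableWithinAt)
    (fun t ht => (hder t ht).deriv) ht (Metric.mem_ball_self hε)
  simpa only [Function.update_eq_self] using this

/-- This freezes the Jacobian of the base components while p or r moves, so that an equation on U
becomes an identity in one real variable with constant coefficients. -/
theorem eventually_pd_update_eq (hg : ContDiffOn ℝ ∞ g U) {i : Fin 5}
    (hi : ∀ m ∈ U, pd i g m = 0) {m : Jet} (hm : m ∈ U) :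
    ∀ᶠ t in nhds (m i), ∀ j, pd j g (Function.update m i t) = pd j g m :=
  Filter.eventually_all.2 fun j =>
    eventually_update_eq (contDiffOn_pd hg j) (pd_pd_eq_zero hg hi j) hm

theorem exists_eq_const (hU : IsConnected (U : Set Jet)) (hg : ContDiffOn ℝ ∞ g U)
    (h0 : ∀ m ∈ U, pd 0 g m = 0) (h1 : ∀ m ∈ U, pd 1 g m = 0) (h2 : ∀ m ∈ U, pd 2 g m = 0)
    (h3 : ∀ m ∈ U, pd 3 g m = 0) (h4 : ∀ m ∈ U, pd 4 g m = 0) :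
    ∃ c, ∀ m ∈ U, g m = c := by
  refine U.isOpen.exists_is_const_of_fderiv_eq_zero hU.isPreconnected (𝕜 := ℝ)
    (fun m hm => (differentiableAt_of_smooth hg hm).differentiableWithinAt) fun m hm => ?_
  ext v
  rw [fderiv_eq_sum_pd, h0 m hm, h1 m hm, h2 m hm, h3 m hm, h4 m hm]
  simp

/-- A function with constant first derivatives is affine. -/
theorem exists_eq_affine (hU : IsConnected (U : Set Jet)) (hg : ContDiffOn ℝ ∞ g U)
    {a₀ a₁ a₂ : ℝ} (h0 : ∀ m ∈ U, pd 0 g m = a₀) (h1 : ∀ m ∈ U, pd 1 g m = a₁)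
    (h2 : ∀ m ∈ U, pd 2 g m = a₂) (h3 : ∀ m ∈ U, pd 3 g m = 0) (h4 : ∀ m ∈ U, pd 4 g m = 0) :
    ∃ c, ∀ m ∈ U, g m = a₀ * m 0 + a₁ * m 1 + a₂ * m 2 + c := by
  have hd (i : Fin 5) (m : Jet) := differentiableAt_coord i m
  have hs (i : Fin 5) (a : ℝ) : ContDiffOn ℝ ∞ (fun m : Jet => a * m i) U :=
    contDiffOn_const.mul (dCoord i).contDiff.contDiffOn
  have e (i : Fin 5) (m : Jet) (hm : m ∈ U) :
      pd i (fun m => g m - (a₀ * m 0 + a₁ * m 1 + a₂ * m 2)) m =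
        pd i g m - (a₀ * (if i = 0 then 1 else 0) + a₁ * (if i = 1 then 1 else 0)
          + a₂ * (if i = 2 then 1 else 0)) := by
    have d0 := (hd 0 m).const_mul a₀
    have d1 := (hd 1 m).const_mul a₁
    have d2 := (hd 2 m).const_mul a₂
    rw [pd_sub (differentiableAt_of_smooth hg hm) ((d0.fun_add d1).fun_add d2),
      pd_add (d0.fun_add d1) d2, pd_add d0 d1, pd_const_mul (hd 0 m), pd_const_mul (hd 1 m),
      pd_const_mul (hd 2 m), pd_coord, pd_coord, pd_coord]
  obtain ⟨c, hc⟩ := exists_eq_const hU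
    (g := fun m => g m - (a₀ * m 0 + a₁ * m 1 + a₂ * m 2))
    (hg.sub (((hs 0 a₀).add (hs 1 a₁)).add (hs 2 a₂)))
    (fun m hm => by rw [e 0 m hm, h0 m hm]; simp) (fun m hm => by rw [e 1 m hm, h1 m hm]; simp)
    (fun m hm => by rw [e 2 m hm, h2 m hm]; simp) (fun m hm => by rw [e 3 m hm, h3 m hm]; simp)
    (fun m hm => by rw [e 4 m hm, h4 m hm]; simp)
  exact ⟨c, fun m hm => by linarith [hc m hm]⟩

theorem VF.contDiffOn_comp (X : VF U) (i : Fin 5) : ContDiffOn ℝ ∞ (fun m => X.1 m i) U :=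
  (dCoord i).contDiff.comp_contDiffOn X.2.1

theorem VF.fderiv_comp (X : VF U) {m : Jet} (hm : m ∈ U) (v : Jet) (i : Fin 5) :
    fderiv ℝ X.1 m v i = v 0 * pd 0 (fun m => X.1 m i) m + v 1 * pd 1 (fun m => X.1 m i) m
      + v 2 * pd 2 (fun m => X.1 m i) m + v 3 * pd 3 (fun m => X.1 m i) m
      + v 4 * pd 4 (fun m => X.1 m i) m := by
  rw [← fderiv_eq_sum_pd, fderiv_apply (VF.differentiableAt X hm) i]
  rfl

end

/-! ### Five-dimensional Lie algebras with an abelian ideal of codimension two -/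

section

variable {L : Type*} [LieRing L] [LieAlgebra ℝ L]

/-- The bracket relations shared by the three symmetry algebras: `X 2, X 3, X 4` commute and
span a subspace stable under `X 0` and `X 1`, and `[X 0, X 1]` is a multiple of `X 1`. -/
structure BracketTable (X : Fin 5 → L) (c : ℝ) : Prop where
  zero_one : ⁅X 0, X 1⁆ = c • X 1
  zero_mem : ∀ j ∈ ({2, 3, 4} : Set (Fin 5)), ⁅X 0, X j⁆ ∈ Submodule.span ℝ {X 2, X 3, X 4}
  one_mem : ∀ j ∈ ({2, 3, 4} : Set (Fin 5)), ⁅X 1, X j⁆ ∈ Submodule.span ℝ {X 2, X 3, X 4}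
  two_three : ⁅X 2, X 3⁆ = 0
  two_four : ⁅X 2, X 4⁆ = 0
  three_four : ⁅X 3, X 4⁆ = 0

variable {X : Fin 5 → L} {c : ℝ}

theorem BracketTable.lie_eq_zero (h : BracketTable X c) {x y : L}
    (hx : x ∈ Submodule.span ℝ {X 2, X 3, X 4}) (hy : y ∈ Submodule.span ℝ {X 2, X 3, X 4}) :
    ⁅x, y⁆ = 0 := by
  have h32 : ⁅X 3, X 2⁆ = 0 := by rw [← lie_skew, h.two_three, neg_zero]
  have h42 : ⁅X 4, X 2⁆ = 0 := by rw [← lie_skew, h.two_four, neg_zero]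
  have h43 : ⁅X 4, X 3⁆ = 0 := by rw [← lie_skew, h.three_four, neg_zero]
  obtain ⟨a, b, d, rfl⟩ := Submodule.mem_span_triple.1 hx
  obtain ⟨a', b', d', rfl⟩ := Submodule.mem_span_triple.1 hy
  simp [h.two_three, h.two_four, h.three_four, h32, h42, h43]

theorem BracketTable.lie_mem (h : BracketTable X c) (i : Fin 5) {y : L}
    (hy : y ∈ Submodule.span ℝ {X 2, X 3, X 4}) :
    ⁅X i, y⁆ ∈ Submodule.span ℝ {X 2, X 3, X 4} := by
  obtain ⟨a, b, d, rfl⟩ := Submodule.mem_span_triple.1 hy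
  have key : ∀ j ∈ ({2, 3, 4} : Set (Fin 5)), ⁅X i, X j⁆ ∈ Submodule.span ℝ {X 2, X 3, X 4} := by
    have hX : ∀ j ∈ ({2, 3, 4} : Set (Fin 5)), X j ∈ Submodule.span ℝ {X 2, X 3, X 4} := by
      rintro j (rfl | rfl | rfl) <;> exact Submodule.subset_span (by simp)
    intro j hj
    fin_cases i
    · exact h.zero_mem j hj
    · exact h.one_mem j hj
    all_goals
      rw [h.lie_eq_zero (hX _ (by simp)) (hX j hj)]
      exact Submodule.zero_mem _
  simp only [lie_add, lie_smul]
  exact add_mem (add_mem (Submodule.smul_mem _ _ (key 2 (by simp)))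
    (Submodule.smul_mem _ _ (key 3 (by simp)))) (Submodule.smul_mem _ _ (key 4 (by simp)))

/-- Every bracket of two of the fields lies in `span {X 1} + span {X 2, X 3, X 4}`. -/
theorem BracketTable.lie_mem_sup (h : BracketTable X c) (i j : Fin 5) :
    ⁅X i, X j⁆ ∈ Submodule.span ℝ {X 1} ⊔ Submodule.span ℝ {X 2, X 3, X 4} := by
  have hX : ∀ j ∈ ({2, 3, 4} : Set (Fin 5)), X j ∈ Submodule.span ℝ {X 2, X 3, X 4} := by
    rintro j (rfl | rfl | rfl) <;> exact Submodule.subset_span (by simp)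
  have hr (i j : Fin 5) (hj : j ∈ ({2, 3, 4} : Set (Fin 5))) :
      ⁅X i, X j⁆ ∈ Submodule.span ℝ {X 1} ⊔ Submodule.span ℝ {X 2, X 3, X 4} :=
    Submodule.mem_sup_right (h.lie_mem i (hX j hj))
  have h1 : X 1 ∈ Submodule.span ℝ {X 1} ⊔ Submodule.span ℝ {X 2, X 3, X 4} :=
    Submodule.mem_sup_left (Submodule.mem_span_singleton_self _)
  have hcase (i : Fin 5) : i = 0 ∨ i = 1 ∨ i ∈ ({2, 3, 4} : Set (Fin 5)) := by
    fin_cases i <;> simp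
  rcases hcase j with rfl | rfl | hj
  · rcases hcase i with rfl | rfl | hi
    · simp
    · rw [← lie_skew, h.zero_one]
      exact neg_mem (Submodule.smul_mem _ _ h1)
    · rw [← lie_skew]
      exact neg_mem (hr 0 i hi)
  · rcases hcase i with rfl | rfl | hi
    · rw [h.zero_one]
      exact Submodule.smul_mem _ _ h1
    · simp
    · rw [← lie_skew]
      exact neg_mem (hr 1 i hi)
  · exact hr i j hj

theorem lie_mem_of_mem_span {s : Set L} {N : Submodule ℝ L} (h : ∀ x ∈ s, ∀ y ∈ s, ⁅x, y⁆ ∈ N)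
    {x y : L} (hx : x ∈ Submodule.span ℝ s) (hy : y ∈ Submodule.span ℝ s) : ⁅x, y⁆ ∈ N := by
  induction hx using Submodule.span_induction with
  | mem x hx =>
    induction hy using Submodule.span_induction with
    | mem y hy => exact h x hx y hy
    | zero => simp
    | add y z _ _ hy hz => rw [lie_add]; exact add_mem hy hz
    | smul a y _ hy => rw [lie_smul]; exact N.smul_mem a hy
  | zero => simp
  | add x z _ _ hx hz => rw [add_lie]; exact add_mem hx hz
  | smul a x _ hx => rw [smul_lie]; exact N.smul_mem a hx

theorem BracketTable.lie_mem_span_range (h : BracketTable X c) {x y : L}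
    (hx : x ∈ Submodule.span ℝ (Set.range X)) (hy : y ∈ Submodule.span ℝ (Set.range X)) :
    ⁅x, y⁆ ∈ Submodule.span ℝ (Set.range X) := by
  refine lie_mem_of_mem_span ?_ hx hy
  rintro _ ⟨i, rfl⟩ _ ⟨j, rfl⟩
  refine (sup_le ?_ ?_ : Submodule.span ℝ {X 1} ⊔ Submodule.span ℝ {X 2, X 3, X 4} ≤ _)
    (h.lie_mem_sup i j)
  · exact Submodule.span_mono (by simp)
  · refine Submodule.span_mono ?_
    rintro _ (rfl | rfl | rfl) <;> exact Set.mem_range_self _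

/-- Put A = span {X 2, X 3, X 4}. No bracket has an `X 0` component, so the first derived algebra
lies in ⟨X 1⟩ + A. Multiples of `X 1` commute and A is stable, so the second lies in A. A is
abelian, so the third is zero. -/
theorem BracketTable.isSolvable (h : BracketTable X c)
    (hX : ⊤ ≤ Submodule.span ℝ (Set.range X)) : LieAlgebra.IsSolvable L := by
  set A : Submodule ℝ L := Submodule.span ℝ {X 2, X 3, X 4} with hA
  have h1 : (LieAlgebra.derivedSeries ℝ L 1).toSubmodule ≤ Submodule.span ℝ {X 1} ⊔ A := by
    have e : (LieAlgebra.derivedSeries ℝ L 1).toSubmodule =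
        Submodule.span ℝ {⁅x, y⁆ | (x : L) (y : L)} := LieAlgebra.coe_derivedSeries_one_eq ..
    rw [e, Submodule.span_le]
    rintro _ ⟨x, y, rfl⟩
    refine lie_mem_of_mem_span ?_ (hX (Submodule.mem_top (x := x)))
      (hX (Submodule.mem_top (x := y)))
    rintro _ ⟨i, rfl⟩ _ ⟨j, rfl⟩
    exact h.lie_mem_sup i j
  have h2 : (LieAlgebra.derivedSeries ℝ L 2).toSubmodule ≤ A := by
    rw [LieAlgebra.derivedSeries_def, LieAlgebra.derivedSeriesOfIdeal_succ,
      LieSubmodule.lieIdeal_oper_eq_linear_span', Submodule.span_le]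
    rintro _ ⟨x, hx, y, hy, rfl⟩
    obtain ⟨x₁, hx₁, x₂, hx₂, rfl⟩ := Submodule.mem_sup.1 (h1 hx)
    obtain ⟨y₁, hy₁, y₂, hy₂, rfl⟩ := Submodule.mem_sup.1 (h1 hy)
    obtain ⟨a, rfl⟩ := Submodule.mem_span_singleton.1 hx₁
    obtain ⟨a', rfl⟩ := Submodule.mem_span_singleton.1 hy₁
    have e : ⁅a • X 1 + x₂, a' • X 1 + y₂⁆ = a • ⁅X 1, y₂⁆ - a' • ⁅X 1, x₂⁆ := by
      rw [add_lie, lie_add, lie_add, h.lie_eq_zero hx₂ hy₂, ← lie_skew x₂ (a' • X 1)]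
      simp [sub_eq_add_neg]
    rw [e]
    exact sub_mem (A.smul_mem _ (h.lie_mem 1 hy₂)) (A.smul_mem _ (h.lie_mem 1 hx₂))
  refine (LieAlgebra.isSolvable_iff ℝ L).2 ⟨3, ?_⟩
  rw [LieAlgebra.derivedSeries_def, LieAlgebra.derivedSeriesOfIdeal_succ, eq_bot_iff,
    LieSubmodule.lie_le_iff]
  intro x hx y hy
  rw [LieSubmodule.mem_bot]
  exact h.lie_eq_zero (h2 hx) (h2 hy)

/-- The abelian ideal spanned by `X 2, X 3, X 4`. -/
def BracketTable.ideal (h : BracketTable X c) (hX : ⊤ ≤ Submodule.span ℝ (Set.range X)) :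
    LieIdeal ℝ L where
  __ := Submodule.span ℝ {X 2, X 3, X 4}
  lie_mem := by
    intro x y hy
    have hx := hX (Submodule.mem_top (x := x))
    induction hx using Submodule.span_induction with
    | mem x hx =>
      obtain ⟨i, rfl⟩ := hx
      exact h.lie_mem i hy
    | zero => rw [zero_lie]; exact Submodule.zero_mem _
    | add x z _ _ hx hz => rw [add_lie]; exact Submodule.add_mem _ hx hz
    | smul a x _ hx => rw [smul_lie]; exact Submodule.smul_mem _ a hx

theorem BracketTable.exists_abelian_ideal (h : BracketTable X c)
    (hX : ⊤ ≤ Submodule.span ℝ (Set.range X)) (hli : LinearIndependent ℝ X) :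
    ∃ A : LieIdeal ℝ L, A.toSubmodule = Submodule.span ℝ {X 2, X 3, X 4} ∧
      Module.finrank ℝ A = 3 ∧ IsLieAbelian A := by
  refine ⟨h.ideal hX, rfl, ?_, ⟨fun x y => Subtype.ext (h.lie_eq_zero x.2 y.2)⟩⟩
  have hli' : LinearIndependent ℝ (X ∘ ![2, 3, 4]) := hli.comp _ (by decide)
  have := finrank_span_eq_card hli'
  rw [Fintype.card_fin, show Set.range (X ∘ ![2, 3, 4]) = {X 2, X 3, X 4} by
    ext; simp [Fin.exists_fin_succ, eq_comm]] at this
  exact this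

end

/-- A linearly independent family of vector fields with the bracket relations of a
`BracketTable`, spanning the point symmetries, is a basis of the symmetry algebra. -/
theorem exists_symmetryAlgebra {F H : Jet → ℝ} {U : TopologicalSpace.Opens Jet}
    {X : Fin 5 → VF U} {c : ℝ} (hli : LinearIndependent ℝ X) (h : BracketTable X c)
    (hsym : ∀ V : VF U, V ∈ Submodule.span ℝ (Set.range X) ↔ IsPointSymmetry F H U V.1) :
    ∃ L : LieSubalgebra ℝ (VF U), IsPointSymmetryAlgebra F H U L ∧
      Module.finrank ℝ L = 5 ∧ LieAlgebra.IsSolvable L ∧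
      ∃ B : Module.Basis (Fin 5) ℝ L, (∀ i, (B i : VF U) = X i) ∧
        ∃ A : LieIdeal ℝ L, A.toSubmodule = Submodule.span ℝ {B 2, B 3, B 4} ∧
          Module.finrank ℝ A = 3 ∧ IsLieAbelian A := by
  -- Closure under the bracket comes from the bracket table; no commutation identity for Lie
  -- derivatives is needed.
  let L : LieSubalgebra ℝ (VF U) :=
    { Submodule.span ℝ (Set.range X) with lie_mem' := fun hx hy => h.lie_mem_span_range hx hy }
  let B : Module.Basis (Fin 5) ℝ L := Module.Basis.span hli
  have hB (i : Fin 5) : (B i : VF U) = X i :=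
    congrArg Subtype.val (Module.Basis.span_apply hli i)
  have hmem (x : L) (hx : (x : VF U) ∈ Submodule.span ℝ {X 2, X 3, X 4}) :
      x ∈ Submodule.span ℝ {B 2, B 3, B 4} := by
    obtain ⟨a, b, d, hx⟩ := Submodule.mem_span_triple.1 hx
    refine Submodule.mem_span_triple.2 ⟨a, b, d, Subtype.ext ?_⟩
    rw [← hx, ← hB 2, ← hB 3, ← hB 4]
    rfl
  have hlie (i j : Fin 5) : ((⁅B i, B j⁆ : L) : VF U) = ⁅X i, X j⁆ := by
    rw [LieSubalgebra.coe_bracket, hB, hB]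
  have hT : BracketTable B c := by
    refine ⟨Subtype.ext ?_, fun j hj => hmem _ ?_, fun j hj => hmem _ ?_, Subtype.ext ?_,
      Subtype.ext ?_, Subtype.ext ?_⟩
    · rw [hlie, h.zero_one, ← hB 1]
      rfl
    · rw [hlie]
      exact h.zero_mem j hj
    · rw [hlie]
      exact h.one_mem j hj
    · rw [hlie, h.two_three]
      rfl
    · rw [hlie, h.two_four]
      rfl
    · rw [hlie, h.three_four]
      rfl
  refine ⟨L, hsym, ?_, hT.isSolvable B.span_eq.ge, B, hB,
    hT.exists_abelian_ideal B.span_eq.ge B.linearIndependent⟩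
  rw [Module.finrank_eq_card_basis B, Fintype.card_fin]

/-! ### Models `z_y = f(z_x)`, `z_xxx = k(z_x) z_xx ^ n` -/

/-- The functions `f₁, f₂, f₃` are the successive derivatives of `f`, and `k₁` is the derivative
of `k`, on the open set `I`. -/
structure ModelData (I : Set ℝ) (f f₁ f₂ f₃ k k₁ : ℝ → ℝ) : Prop where
  isOpen : IsOpen I
  f_deriv : ∀ p ∈ I, HasDerivAt f (f₁ p) p
  f₁_deriv : ∀ p ∈ I, HasDerivAt f₁ (f₂ p) p
  f₂_deriv : ∀ p ∈ I, HasDerivAt f₂ (f₃ p) p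
  k_deriv : ∀ p ∈ I, HasDerivAt k (k₁ p) p

theorem hasFDerivAt_mul_pow {φ : ℝ → ℝ} {φ' : ℝ} {m : Jet} (h : HasDerivAt φ φ' (m 3)) (n : ℕ) :
    HasFDerivAt (fun m : Jet => φ (m 3) * m 4 ^ n)
      (φ (m 3) • (n * m 4 ^ (n - 1)) • dCoord 4 + m 4 ^ n • φ' • dCoord 3) m := by
  have h3 : HasFDerivAt (fun m : Jet => φ (m 3)) (φ' • dCoord 3) m :=
    h.comp_hasFDerivAt m (dCoord 3).hasFDerivAt
  have h4 : HasFDerivAt (fun m : Jet => m 4 ^ n) ((n * m 4 ^ (n - 1)) • dCoord 4) m :=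
    (hasDerivAt_pow n (m 4)).comp_hasFDerivAt m (dCoord 4).hasFDerivAt
  exact h3.fun_mul h4

namespace ModelData

variable {I : Set ℝ} {f f₁ f₂ f₃ k k₁ : ℝ → ℝ}

theorem eventually_mem (h : ModelData I f f₁ f₂ f₃ k k₁) {m : Jet} (hm : m 3 ∈ I) :
    ∀ᶠ m in nhds m, m 3 ∈ I :=
  (continuous_apply (3 : Fin 5)).continuousAt.eventually_mem (h.isOpen.mem_nhds hm)

theorem hasFDerivAt_F (h : ModelData I f f₁ f₂ f₃ k k₁) {m : Jet} (hm : m 3 ∈ I) :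
    HasFDerivAt (fun m : Jet => f (m 3)) (f₁ (m 3) • dCoord 3) m :=
  (h.f_deriv _ hm).comp_hasFDerivAt m (dCoord 3).hasFDerivAt

theorem totalD_F (h : ModelData I f f₁ f₂ f₃ k k₁) (H : Jet → ℝ) {m : Jet} (hm : m 3 ∈ I) :
    totalD H (fun m => f (m 3)) m = f₁ (m 3) * m 4 := by
  rw [totalD, (h.hasFDerivAt_F hm).fderiv]
  simp [dCoord]

theorem hasFDerivAt_totalD_F (h : ModelData I f f₁ f₂ f₃ k k₁) (H : Jet → ℝ) {m : Jet}
    (hm : m 3 ∈ I) :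
    HasFDerivAt (totalD H (fun m => f (m 3)))
      (f₁ (m 3) • dCoord 4 + (f₂ (m 3) * m 4) • dCoord 3) m := by
  have := hasFDerivAt_mul_pow (h.f₁_deriv _ hm) 1
  have e : totalD H (fun m => f (m 3)) =ᶠ[nhds m] fun m => f₁ (m 3) * m 4 ^ 1 := by
    filter_upwards [h.eventually_mem hm] with m hm
    rw [h.totalD_F H hm, pow_one]
  refine (this.congr_of_eventuallyEq e).congr_fderiv ?_
  ext v
  simp
  ring

theorem totalD_totalD_F (h : ModelData I f f₁ f₂ f₃ k k₁) (H : Jet → ℝ) {m : Jet}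
    (hm : m 3 ∈ I) :
    totalD H (totalD H (fun m => f (m 3))) m = f₂ (m 3) * m 4 ^ 2 + f₁ (m 3) * H m := by
  rw [totalD, (h.hasFDerivAt_totalD_F H hm).fderiv]
  simp [dCoord]
  ring

theorem hasFDerivAt_totalD_totalD_F (h : ModelData I f f₁ f₂ f₃ k k₁) (n : ℕ) {m : Jet}
    (hm : m 3 ∈ I) :
    HasFDerivAt (totalD (fun m => k (m 3) * m 4 ^ n)
        (totalD (fun m => k (m 3) * m 4 ^ n) (fun m => f (m 3))))
      ((2 * f₂ (m 3) * m 4 + f₁ (m 3) * k (m 3) * (n * m 4 ^ (n - 1))) • dCoord 4 +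
        (f₃ (m 3) * m 4 ^ 2 + (f₂ (m 3) * k (m 3) + f₁ (m 3) * k₁ (m 3)) * m 4 ^ n) •
          dCoord 3) m := by
  have h2 := hasFDerivAt_mul_pow (h.f₂_deriv _ hm) 2
  have hn := hasFDerivAt_mul_pow ((h.f₁_deriv _ hm).fun_mul (h.k_deriv _ hm)) n
  have e : totalD (fun m => k (m 3) * m 4 ^ n)
      (totalD (fun m => k (m 3) * m 4 ^ n) (fun m => f (m 3))) =ᶠ[nhds m]
      fun m => f₂ (m 3) * m 4 ^ 2 + f₁ (m 3) * k (m 3) * m 4 ^ n := by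
    filter_upwards [h.eventually_mem hm] with m hm
    rw [h.totalD_totalD_F _ hm]
    ring
  refine ((h2.fun_add hn).congr_of_eventuallyEq e).congr_fderiv ?_
  ext v
  simp
  ring

theorem isPointSymmetry_iff (h : ModelData I f f₁ f₂ f₃ k k₁) (n : ℕ) {U : Set Jet}
    (hU : ∀ m ∈ U, m 3 ∈ I) (X : Jet → Jet) :
    IsPointSymmetry (fun m => f (m 3)) (fun m => k (m 3) * m 4 ^ n) U X ↔
      ∀ m ∈ U, SymmetryEquations (fun m => f (m 3)) (fun m => k (m 3) * m 4 ^ n) X m :=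
  ParaCR.isPointSymmetry_iff (fun m hm => (h.hasFDerivAt_F (hU m hm)).differentiableAt)
    (fun m hm => (hasFDerivAt_mul_pow (h.k_deriv _ (hU m hm)) n).differentiableAt)
    (fun m hm => (h.hasFDerivAt_totalD_F _ (hU m hm)).differentiableAt)
    (fun m hm => (h.hasFDerivAt_totalD_totalD_F n (hU m hm)).differentiableAt) X

end ModelData

/-- The equations at m only involve the germ of the field, so a field extended by zero outside U may
be replaced by its global formula. -/
theorem SymmetryEquations.congr {F H : Jet → ℝ} {X Y : Jet → Jet} {m : Jet}
    (h : SymmetryEquations F H X m) (e : Y =ᶠ[nhds m] X) : SymmetryEquations F H Y m := by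
  have e1 := e.fderiv_eq (𝕜 := ℝ)
  have e2 := e.self_of_nhds
  constructor
  · rw [e1, e2]; exact h.contact
  · rw [e1, e2]; exact h.second
  · rw [e1, e2]; exact h.third
  · rw [e1]; exact h.fst
  · rw [e1]; exact h.snd

/-! ### Prolonged affine fields -/

/-- The field whose `x, y, z` components are affine functions of `x, y, z`, with
`p` component `π(p)` and `r` component `σ(p) r`. -/
def affineField (M : Matrix (Fin 3) (Fin 3) ℝ) (a : Fin 3 → ℝ) (π σ : ℝ → ℝ) (m : Jet) : Jet :=
  ![M 0 0 * m 0 + M 0 1 * m 1 + M 0 2 * m 2 + a 0,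
    M 1 0 * m 0 + M 1 1 * m 1 + M 1 2 * m 2 + a 1,
    M 2 0 * m 0 + M 2 1 * m 1 + M 2 2 * m 2 + a 2,
    π (m 3), σ (m 3) * m 4]

theorem fderiv_affineField (M : Matrix (Fin 3) (Fin 3) ℝ) (a : Fin 3 → ℝ) {π σ : ℝ → ℝ}
    {π' σ' : ℝ} {m : Jet} (hπ : HasDerivAt π π' (m 3)) (hσ : HasDerivAt σ σ' (m 3)) (v : Jet) :
    fderiv ℝ (affineField M a π σ) m v =
      ![M 0 0 * v 0 + M 0 1 * v 1 + M 0 2 * v 2, M 1 0 * v 0 + M 1 1 * v 1 + M 1 2 * v 2,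
        M 2 0 * v 0 + M 2 1 * v 1 + M 2 2 * v 2, π' * v 3, σ' * m 4 * v 3 + σ (m 3) * v 4] := by
  have hlin (i : Fin 3) : HasFDerivAt
      (fun m : Jet => M i 0 * m 0 + M i 1 * m 1 + M i 2 * m 2 + a i)
      (M i 0 • dCoord 0 + M i 1 • dCoord 1 + M i 2 • dCoord 2) m :=
    ((((dCoord 0).hasFDerivAt.const_mul (M i 0)).fun_add
      ((dCoord 1).hasFDerivAt.const_mul (M i 1))).fun_add
      ((dCoord 2).hasFDerivAt.const_mul (M i 2))).add_const (a i)
  have h3 : HasFDerivAt (fun m : Jet => π (m 3)) (π' • dCoord 3) m :=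
    hπ.comp_hasFDerivAt m (dCoord 3).hasFDerivAt
  have h4 : HasFDerivAt (fun m : Jet => σ (m 3) * m 4)
      (σ (m 3) • dCoord 4 + m 4 • σ' • dCoord 3) m :=
    (hσ.comp_hasFDerivAt m (dCoord 3).hasFDerivAt).fun_mul (dCoord 4).hasFDerivAt
  have key : HasFDerivAt (affineField M a π σ) (ContinuousLinearMap.pi
      ![M 0 0 • dCoord 0 + M 0 1 • dCoord 1 + M 0 2 • dCoord 2,
        M 1 0 • dCoord 0 + M 1 1 • dCoord 1 + M 1 2 • dCoord 2,
        M 2 0 • dCoord 0 + M 2 1 • dCoord 1 + M 2 2 • dCoord 2,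
        π' • dCoord 3, σ (m 3) • dCoord 4 + m 4 • σ' • dCoord 3]) m := by
    refine hasFDerivAt_pi.2 fun i => ?_
    fin_cases i
    exacts [hlin 0, hlin 1, hlin 2, h3, h4]
  rw [key.fderiv]
  funext i
  fin_cases i <;> simp [dCoord]
  ring

theorem contDiffOn_affineField {U : TopologicalSpace.Opens Jet} {I : Set ℝ}
    (hU : ∀ m ∈ U, m 3 ∈ I) (M : Matrix (Fin 3) (Fin 3) ℝ) (a : Fin 3 → ℝ) {π σ : ℝ → ℝ}
    (hπ : ContDiffOn ℝ ∞ π I) (hσ : ContDiffOn ℝ ∞ σ I) :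
    ContDiffOn ℝ ∞ (affineField M a π σ) (U : Set Jet) := by
  have hc (i : Fin 5) : ContDiffOn ℝ ∞ (fun m : Jet => m i) (U : Set Jet) :=
    (dCoord i).contDiff.contDiffOn
  have hlin (i : Fin 3) : ContDiffOn ℝ ∞
      (fun m : Jet => M i 0 * m 0 + M i 1 * m 1 + M i 2 * m 2 + a i) (U : Set Jet) :=
    (((contDiffOn_const.mul (hc 0)).add (contDiffOn_const.mul (hc 1))).add
      (contDiffOn_const.mul (hc 2))).add contDiffOn_const
  refine contDiffOn_pi.2 fun i => ?_
  fin_cases i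
  exacts [hlin 0, hlin 1, hlin 2, hπ.comp (hc 3) hU, (hσ.comp (hc 3) hU).mul (hc 4)]

open Classical in
/-- The restriction to `U` of a smooth field. -/
noncomputable def VF.ofContDiffOn {U : TopologicalSpace.Opens Jet} (V : Jet → Jet)
    (hV : ContDiffOn ℝ ∞ V (U : Set Jet)) : VF U :=
  ⟨fun m => if m ∈ U then V m else 0, hV.congr fun _ hm => if_pos hm, fun _ hm => if_neg hm⟩

theorem VF.ofContDiffOn_apply {U : TopologicalSpace.Opens Jet} {V : Jet → Jet}
    (hV : ContDiffOn ℝ ∞ V (U : Set Jet)) {m : Jet} (hm : m ∈ U) :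
    (VF.ofContDiffOn V hV).1 m = V m := if_pos hm

theorem VF.ofContDiffOn_eventuallyEq {U : TopologicalSpace.Opens Jet} {V : Jet → Jet}
    (hV : ContDiffOn ℝ ∞ V (U : Set Jet)) {m : Jet} (hm : m ∈ U) :
    (VF.ofContDiffOn V hV).1 =ᶠ[nhds m] V := by
  filter_upwards [U.isOpen.mem_nhds hm] with n hn using VF.ofContDiffOn_apply hV hn

theorem VF.bracket_ofContDiffOn {U : TopologicalSpace.Opens Jet} {V W : Jet → Jet}
    (hV : ContDiffOn ℝ ∞ V (U : Set Jet)) (hW : ContDiffOn ℝ ∞ W (U : Set Jet)) {m : Jet}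
    (hm : m ∈ U) :
    (⁅VF.ofContDiffOn V hV, VF.ofContDiffOn W hW⁆ : VF U).1 m =
      fderiv ℝ W m (V m) - fderiv ℝ V m (W m) := by
  rw [VF.bracket_apply _ _ hm, VectorField.lieBracket,
    (VF.ofContDiffOn_eventuallyEq hV hm).fderiv_eq, (VF.ofContDiffOn_eventuallyEq hW hm).fderiv_eq,
    VF.ofContDiffOn_apply hV hm, VF.ofContDiffOn_apply hW hm]

/-- The algebraic conditions, at a point with coordinates `p` and `r`, for an affine field to be
a point symmetry. -/
structure AffineConditions (f f₁ f₂ f₃ k k₁ : ℝ) (n : ℕ) (M : Matrix (Fin 3) (Fin 3) ℝ)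
    (π π' σ σ' p r : ℝ) : Prop where
  contact_x : M 2 0 + p * M 2 2 - p * (M 0 0 + p * M 0 2) - f * (M 1 0 + p * M 1 2) - π = 0
  contact_y : M 2 1 + f * M 2 2 - p * (M 0 1 + f * M 0 2) - f * (M 1 1 + f * M 1 2)
    - f₁ * π = 0
  second_x : π' * r - r * (M 0 0 + p * M 0 2) - f₁ * r * (M 1 0 + p * M 1 2) - σ * r = 0
  second_y : π' * (f₁ * r) - r * (M 0 1 + f * M 0 2) - f₁ * r * (M 1 1 + f * M 1 2)
    - (f₂ * r * π + f₁ * (σ * r)) = 0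
  third_x : σ' * r * r + σ * (k * r ^ n) - k * r ^ n * (M 0 0 + p * M 0 2)
    - (f₂ * r ^ 2 + f₁ * (k * r ^ n)) * (M 1 0 + p * M 1 2)
    - (k₁ * r ^ n * π + k * (n * r ^ (n - 1)) * (σ * r)) = 0
  third_y : σ' * r * (f₁ * r) + σ * (f₂ * r ^ 2 + f₁ * (k * r ^ n))
    - k * r ^ n * (M 0 1 + f * M 0 2)
    - (f₂ * r ^ 2 + f₁ * (k * r ^ n)) * (M 1 1 + f * M 1 2)
    - ((f₃ * r ^ 2 + (f₂ * k + f₁ * k₁) * r ^ n) * π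
      + (2 * f₂ * r + f₁ * k * (n * r ^ (n - 1))) * (σ * r)) = 0

/-- On the relevant kernels each of the contact, second and third equations is linear in (v 0, v 1),
so it reduces to its values at (1, 0) and (0, 1), the `_x` and `_y` conditions. The base components
are independent of p and r, which settles the remaining two equations. -/
theorem ModelData.symmetryEquations_affineField {I : Set ℝ} {f f₁ f₂ f₃ k k₁ : ℝ → ℝ}
    (h : ModelData I f f₁ f₂ f₃ k k₁) {n : ℕ} {M : Matrix (Fin 3) (Fin 3) ℝ} (a : Fin 3 → ℝ)
    {π σ : ℝ → ℝ} {π' σ' : ℝ} {m : Jet} (hm : m 3 ∈ I) (hπ : HasDerivAt π π' (m 3))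
    (hσ : HasDerivAt σ σ' (m 3))
    (hA : AffineConditions (f (m 3)) (f₁ (m 3)) (f₂ (m 3)) (f₃ (m 3)) (k (m 3)) (k₁ (m 3)) n M
      (π (m 3)) π' (σ (m 3)) σ' (m 3) (m 4)) :
    SymmetryEquations (fun m => f (m 3)) (fun m => k (m 3) * m 4 ^ n) (affineField M a π σ) m := by
  have e3 : affineField M a π σ m 3 = π (m 3) := rfl
  have e4 : affineField M a π σ m 4 = σ (m 3) * m 4 := rfl
  have hd := fderiv_affineField M a hπ hσ
  constructor
  · intro v h2
    rw [(h.hasFDerivAt_F hm).fderiv]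
    simp only [hd, Matrix.cons_val, h2, e3, dCoord, ContinuousLinearMap.proj_apply, _root_.smul_apply,
      smul_eq_mul]
    linear_combination v 0 * hA.contact_x + v 1 * hA.contact_y
  · intro v h2 h3 h4
    rw [h.totalD_F _ hm] at h3
    rw [h.totalD_totalD_F _ hm] at h4
    rw [(h.hasFDerivAt_totalD_F _ hm).fderiv, h.totalD_F _ hm]
    simp only [hd, Matrix.cons_val, h2, h3, h4, e3, e4, dCoord, ContinuousLinearMap.proj_apply,
      _root_.smul_apply, _root_.add_apply, smul_eq_mul]
    linear_combination v 0 * hA.second_x + v 1 * hA.second_y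
  · intro v h2 h3 h4
    rw [h.totalD_F _ hm] at h3
    rw [h.totalD_totalD_F _ hm] at h4
    rw [(h.hasFDerivAt_totalD_totalD_F n hm).fderiv, h.totalD_totalD_F _ hm,
      (hasFDerivAt_mul_pow (h.k_deriv _ hm) n).fderiv]
    simp only [hd, Matrix.cons_val, h2, h3, h4, e3, e4, dCoord, ContinuousLinearMap.proj_apply,
      _root_.smul_apply, _root_.add_apply, smul_eq_mul]
    linear_combination v 0 * hA.third_x + v 1 * hA.third_y
  · intro v h0 h1 h2
    simp [hd, h0, h1, h2]
  · intro v h0 h1 h2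
    simp [hd, h0, h1, h2]

/-! ### Symmetry algebras generated by two linear fields and the translations -/

/-- The restriction to `U` of the constant field `a 0 ∂_x + a 1 ∂_y + a 2 ∂_z`. -/
noncomputable def translationVF (U : TopologicalSpace.Opens Jet) (a : Fin 3 → ℝ) : VF U :=
  VF.ofContDiffOn (affineField 0 a (fun _ => 0) (fun _ => 0))
    (contDiffOn_affineField (I := Set.univ) (fun _ _ => Set.mem_univ _) 0 a contDiffOn_const
      contDiffOn_const)

theorem affineField_zero_apply (a : Fin 3 → ℝ) (m : Jet) :
    affineField 0 a (fun _ => 0) (fun _ => 0) m = ![a 0, a 1, a 2, 0, 0] := by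
  simp [affineField]

theorem translationVF_apply {U : TopologicalSpace.Opens Jet} (a : Fin 3 → ℝ) {m : Jet}
    (hm : m ∈ U) : (translationVF U a).1 m = ![a 0, a 1, a 2, 0, 0] := by
  rw [translationVF, VF.ofContDiffOn_apply _ hm, affineField_zero_apply]

/-- A linear field on `U`, together with the data needed to differentiate it. -/
structure LinearData (I : Set ℝ) where
  M : Matrix (Fin 3) (Fin 3) ℝ
  π : ℝ → ℝ
  π' : ℝ → ℝ
  σ : ℝ → ℝ
  σ' : ℝ → ℝ
  π_smooth : ContDiffOn ℝ ∞ π I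
  σ_smooth : ContDiffOn ℝ ∞ σ I
  π_deriv : ∀ p ∈ I, HasDerivAt π (π' p) p
  σ_deriv : ∀ p ∈ I, HasDerivAt σ (σ' p) p

namespace LinearData

variable {I : Set ℝ} {U : TopologicalSpace.Opens Jet}

/-- The linear field on all of `ℝ⁵`. -/
def field (D : LinearData I) : Jet → Jet := affineField D.M 0 D.π D.σ

theorem fderiv_field (D : LinearData I) {m : Jet} (hm : m 3 ∈ I) (v : Jet) :
    fderiv ℝ D.field m v =
      ![D.M 0 0 * v 0 + D.M 0 1 * v 1 + D.M 0 2 * v 2,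
        D.M 1 0 * v 0 + D.M 1 1 * v 1 + D.M 1 2 * v 2,
        D.M 2 0 * v 0 + D.M 2 1 * v 1 + D.M 2 2 * v 2,
        D.π' (m 3) * v 3, D.σ' (m 3) * m 4 * v 3 + D.σ (m 3) * v 4] :=
  fderiv_affineField D.M 0 (D.π_deriv _ hm) (D.σ_deriv _ hm) v

theorem contDiffOn_field (D : LinearData I) (hU : ∀ m ∈ U, m 3 ∈ I) :
    ContDiffOn ℝ ∞ D.field (U : Set Jet) :=
  contDiffOn_affineField hU D.M 0 D.π_smooth D.σ_smooth

/-- The restriction of the linear field to `U`. -/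
noncomputable def toVF (D : LinearData I) (hU : ∀ m ∈ U, m 3 ∈ I) : VF U :=
  VF.ofContDiffOn D.field (D.contDiffOn_field hU)

theorem toVF_apply (D : LinearData I) (hU : ∀ m ∈ U, m 3 ∈ I) {m : Jet} (hm : m ∈ U) :
    (D.toVF hU).1 m = affineField D.M 0 D.π D.σ m :=
  VF.ofContDiffOn_apply _ hm

theorem bracket_translationVF (D : LinearData I) (hU : ∀ m ∈ U, m 3 ∈ I) (a : Fin 3 → ℝ) :
    ⁅D.toVF hU, translationVF U a⁆ = translationVF U (-(D.M.mulVec a)) := by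
  refine VF.ext_on fun m hm => ?_
  rw [toVF, translationVF, VF.bracket_ofContDiffOn _ _ hm, translationVF_apply _ hm,
    fderiv_affineField 0 a (hasDerivAt_const _ 0) (hasDerivAt_const _ 0),
    D.fderiv_field (hU m hm), affineField_zero_apply]
  funext i
  fin_cases i <;> simp [Matrix.mulVec, dotProduct, Fin.sum_univ_three]

/-- The commutator of two linear fields has the matrix E.M * D.M - D.M * E.M on the base. In the r
component the products of `D.σ` and `E.σ` cancel, so `hσ` only contains derivatives of these
functions. -/
theorem bracket_toVF (D E : LinearData I) (hU : ∀ m ∈ U, m 3 ∈ I) {c : ℝ}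
    (hM : E.M * D.M - D.M * E.M = c • E.M)
    (hπ : ∀ p ∈ I, E.π' p * D.π p - D.π' p * E.π p = c * E.π p)
    (hσ : ∀ p ∈ I, E.σ' p * D.π p - D.σ' p * E.π p = c * E.σ p) :
    ⁅D.toVF hU, E.toVF hU⁆ = c • E.toVF hU := by
  refine VF.ext_on fun m hm => ?_
  have hI := hU m hm
  have e : (c • E.toVF hU).1 m = c • affineField E.M 0 E.π E.σ m := by
    rw [← toVF_apply E hU hm]
    rfl
  have hM' (i j : Fin 3) := congrFun (congrFun hM i) j
  simp only [Matrix.sub_apply, Matrix.mul_apply, Fin.sum_univ_three, Matrix.smul_apply,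
    smul_eq_mul] at hM'
  rw [e, toVF, toVF, VF.bracket_ofContDiffOn _ _ hm, D.fderiv_field hI, E.fderiv_field hI]
  funext i
  fin_cases i
  · simp [field, affineField]
    linear_combination m 0 * hM' 0 0 + m 1 * hM' 0 1 + m 2 * hM' 0 2
  · simp [field, affineField]
    linear_combination m 0 * hM' 1 0 + m 1 * hM' 1 1 + m 2 * hM' 1 2
  · simp [field, affineField]
    linear_combination m 0 * hM' 2 0 + m 1 * hM' 2 1 + m 2 * hM' 2 2
  · simp [field, affineField]
    linear_combination hπ _ hI
  · simp [field, affineField]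
    linear_combination m 4 * hσ _ hI

end LinearData

theorem bracket_translationVF_translationVF {U : TopologicalSpace.Opens Jet}
    (a a' : Fin 3 → ℝ) : ⁅translationVF U a, translationVF U a'⁆ = 0 := by
  refine VF.ext_on fun m hm => ?_
  rw [translationVF, translationVF, VF.bracket_ofContDiffOn _ _ hm,
    fderiv_affineField 0 a (hasDerivAt_const _ 0) (hasDerivAt_const _ 0),
    fderiv_affineField 0 a' (hasDerivAt_const _ 0) (hasDerivAt_const _ 0)]
  funext i
  fin_cases i <;> simp

theorem translationVF_eq {U : TopologicalSpace.Opens Jet} (a : Fin 3 → ℝ) :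
    translationVF U a = a 0 • translationVF U ![1, 0, 0] + a 1 • translationVF U ![0, 1, 0]
      + a 2 • translationVF U ![0, 0, 1] := by
  refine VF.ext_on fun m hm => ?_
  change _ = a 0 • (translationVF U ![1, 0, 0]).1 m + a 1 • (translationVF U ![0, 1, 0]).1 m
      + a 2 • (translationVF U ![0, 0, 1]).1 m
  simp only [translationVF_apply _ hm]
  funext i
  fin_cases i <;> simp

/-- Two linear fields and the three translations. -/
noncomputable def generators {I : Set ℝ} {U : TopologicalSpace.Opens Jet} (D E : LinearData I)
    (hU : ∀ m ∈ U, m 3 ∈ I) : Fin 5 → VF U :=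
  ![D.toVF hU, E.toVF hU, translationVF U ![1, 0, 0], translationVF U ![0, 1, 0],
    translationVF U ![0, 0, 1]]

section

variable {I : Set ℝ} {U : TopologicalSpace.Opens Jet} {D E : LinearData I}
  {hU : ∀ m ∈ U, m 3 ∈ I}

theorem generators_bracketTable {c : ℝ} (hc : ⁅D.toVF hU, E.toVF hU⁆ = c • E.toVF hU) :
    BracketTable (generators D E hU) c := by
  have hmem (a : Fin 3 → ℝ) : translationVF U a ∈ Submodule.span ℝ
      {generators D E hU 2, generators D E hU 3, generators D E hU 4} := by
    rw [translationVF_eq]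
    exact Submodule.mem_span_triple.2 ⟨_, _, _, rfl⟩
  refine ⟨hc, ?_, ?_, bracket_translationVF_translationVF _ _,
    bracket_translationVF_translationVF _ _, bracket_translationVF_translationVF _ _⟩
  · rintro j (rfl | rfl | rfl) <;>
      exact (D.bracket_translationVF hU _).symm ▸ hmem _
  · rintro j (rfl | rfl | rfl) <;>
      exact (E.bracket_translationVF hU _).symm ▸ hmem _

theorem generators_linearIndependent (hne : (U : Set Jet).Nonempty)
    (hM : ∀ a b : ℝ, a • D.M + b • E.M = 0 → a = 0 ∧ b = 0) :
    LinearIndependent ℝ (generators D E hU) := by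
  obtain ⟨m, hm⟩ := hne
  have hzero {a : Fin 3 → ℝ} (h : translationVF U a = 0) : a = 0 := by
    have h1 : (translationVF U a).1 m = 0 := by rw [h]; rfl
    rw [translationVF_apply _ hm] at h1
    funext i
    fin_cases i
    exacts [congrFun h1 0, congrFun h1 1, congrFun h1 2]
  rw [Fintype.linearIndependent_iff]
  intro g hg
  have hg' : g 0 • D.toVF hU + g 1 • E.toVF hU + translationVF U ![g 2, g 3, g 4] = 0 := by
    rw [translationVF_eq, ← hg, Fin.sum_univ_five]
    simp [generators, add_assoc]
  -- Bracketing with the translation by a extracts the matrix part as -(M a). A vanishing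
  -- combination of generators therefore has zero matrix, and the translation left over is tested at
  -- a single point.
  have hMa (a : Fin 3 → ℝ) : (g 0 • D.M + g 1 • E.M).mulVec a = 0 := by
    have h1 : ⁅g 0 • D.toVF hU + g 1 • E.toVF hU + translationVF U ![g 2, g 3, g 4],
        translationVF U a⁆ = 0 := by rw [hg', zero_lie]
    rw [add_lie, add_lie, smul_lie, smul_lie, D.bracket_translationVF, E.bracket_translationVF,
      bracket_translationVF_translationVF, add_zero] at h1
    have h2 : (g 0 • translationVF U (-(D.M.mulVec a)) + g 1 • translationVF U (-(E.M.mulVec a))) =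
        translationVF U (-((g 0 • D.M + g 1 • E.M).mulVec a)) := by
      refine VF.ext_on fun m hm => ?_
      change g 0 • (translationVF U _).1 m + g 1 • (translationVF U _).1 m = _
      simp only [translationVF_apply _ hm, Matrix.add_mulVec, Matrix.smul_mulVec]
      funext i
      fin_cases i <;> simp <;> ring
    rw [h2] at h1
    exact neg_eq_zero.1 (hzero h1)
  have hM0 : g 0 • D.M + g 1 • E.M = 0 := Matrix.ext_of_mulVec_single fun i => by
    rw [hMa, Matrix.zero_mulVec]
  obtain ⟨h0, h1⟩ := hM _ _ hM0
  rw [h0, h1, zero_smul, zero_smul, zero_add, zero_add] at hg'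
  have h2 := hzero hg'
  intro i
  fin_cases i
  exacts [h0, h1, congrFun h2 0, congrFun h2 1, congrFun h2 2]

/-- If two linear fields satisfy the symmetry conditions, and the base components of every
symmetry agree with those of a combination of these fields and translations, then the five
generators span the point symmetries. -/
theorem mem_span_generators_iff {f f₁ f₂ f₃ k k₁ : ℝ → ℝ} (h : ModelData I f f₁ f₂ f₃ k k₁)
    (n : ℕ)
    (hD : ∀ p ∈ I, ∀ r, AffineConditions (f p) (f₁ p) (f₂ p) (f₃ p) (k p) (k₁ p) n D.M
      (D.π p) (D.π' p) (D.σ p) (D.σ' p) p r)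
    (hE : ∀ p ∈ I, ∀ r, AffineConditions (f p) (f₁ p) (f₂ p) (f₃ p) (k p) (k₁ p) n E.M
      (E.π p) (E.π' p) (E.σ p) (E.σ' p) p r)
    (hclass : ∀ V : VF U,
      (∀ m ∈ U, SymmetryEquations (fun m => f (m 3)) (fun m => k (m 3) * m 4 ^ n) V.1 m) →
      ∃ (a b : ℝ) (d : Fin 3 → ℝ), ∀ m ∈ U,
        V.1 m 0 = affineField (a • D.M + b • E.M) d D.π D.σ m 0 ∧
        V.1 m 1 = affineField (a • D.M + b • E.M) d D.π D.σ m 1 ∧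
        V.1 m 2 = affineField (a • D.M + b • E.M) d D.π D.σ m 2) (V : VF U) :
    V ∈ Submodule.span ℝ (Set.range (generators D E hU)) ↔
      IsPointSymmetry (fun m => f (m 3)) (fun m => k (m 3) * m 4 ^ n) U V.1 := by
  rw [h.isPointSymmetry_iff n (fun m hm => hU m hm)]
  -- The symmetries form a linear space, so it is enough to test the generators, and differences of
  -- symmetries are symmetries.
  set S : Submodule ℝ (VF U) :=
    { carrier := {V | ∀ m ∈ U,
        SymmetryEquations (fun m => f (m 3)) (fun m => k (m 3) * m 4 ^ n) V.1 m}
      add_mem' := fun {V W} hV hW m hm =>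
        (hV m hm).add (VF.differentiableAt V hm) (VF.differentiableAt W hm) (hW m hm)
      zero_mem' := fun m hm => by
        constructor <;> intros <;> simp
      smul_mem' := fun c V hV m hm => (hV m hm).smul (VF.differentiableAt V hm) c } with hS
  change _ ↔ V ∈ S
  have htr (a : Fin 3 → ℝ) : translationVF U a ∈ S := fun m hm =>
    (h.symmetryEquations_affineField a (hU m hm) (hasDerivAt_const _ 0) (hasDerivAt_const _ 0)
      (by constructor <;> simp)).congr (VF.ofContDiffOn_eventuallyEq _ hm)
  have hDS : D.toVF hU ∈ S := fun m hm =>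
    (h.symmetryEquations_affineField 0 (hU m hm) (D.π_deriv _ (hU m hm)) (D.σ_deriv _ (hU m hm))
      (hD _ (hU m hm) _)).congr (VF.ofContDiffOn_eventuallyEq _ hm)
  have hES : E.toVF hU ∈ S := fun m hm =>
    (h.symmetryEquations_affineField 0 (hU m hm) (E.π_deriv _ (hU m hm)) (E.σ_deriv _ (hU m hm))
      (hE _ (hU m hm) _)).congr (VF.ofContDiffOn_eventuallyEq _ hm)
  constructor
  · intro hV
    refine (Submodule.span_le.2 ?_ : _ ≤ S) hV
    rintro _ ⟨i, rfl⟩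
    fin_cases i
    exacts [hDS, hES, htr _, htr _, htr _]
  · intro hV
    -- Only the base components of `affineField` are compared in `hclass`, so `D.π` and `D.σ` merely
    -- fill its fibre slots. After subtracting the matching generator the base components vanish,
    -- and the symmetry is zero.
    obtain ⟨a, b, d, hd⟩ := hclass V hV
    have hW : V - (a • D.toVF hU + b • E.toVF hU + translationVF U d) ∈ S :=
      S.sub_mem hV (S.add_mem (S.add_mem (S.smul_mem _ hDS) (S.smul_mem _ hES)) (htr d))
    have e (m : Jet) (hm : m ∈ U) : (V - (a • D.toVF hU + b • E.toVF hU + translationVF U d)).1 m =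
        V.1 m - (a • affineField D.M 0 D.π D.σ m + b • affineField E.M 0 E.π E.σ m
          + ![d 0, d 1, d 2, 0, 0]) := by
      rw [← translationVF_apply d hm, ← D.toVF_apply hU hm, ← E.toVF_apply hU hm]
      rfl
    have hzero := SymmetryEquations.eq_zero hW
      (fun m hm => by rw [e m hm]; simp [(hd m hm).1, affineField]; ring)
      (fun m hm => by rw [e m hm]; simp [(hd m hm).2.1, affineField]; ring)
      (fun m hm => by rw [e m hm]; simp [(hd m hm).2.2, affineField]; ring)
    rw [sub_eq_zero.1 hzero, translationVF_eq]
    have hg (i : Fin 5) : generators D E hU i ∈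
        Submodule.span ℝ (Set.range (generators D E hU)) :=
      Submodule.subset_span (Set.mem_range_self i)
    exact add_mem (add_mem (Submodule.smul_mem _ _ (hg 0)) (Submodule.smul_mem _ _ (hg 1)))
      (add_mem (add_mem (Submodule.smul_mem _ _ (hg 2)) (Submodule.smul_mem _ _ (hg 3)))
        (Submodule.smul_mem _ _ (hg 4)))

/-- The symmetry algebra spanned by the generators, with its bracket relations. -/
theorem exists_symmetryAlgebra_generators {F H : Jet → ℝ} {c : ℝ}
    (hne : (U : Set Jet).Nonempty)
    (hM : ∀ a b : ℝ, a • D.M + b • E.M = 0 → a = 0 ∧ b = 0)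
    (hc : ⁅D.toVF hU, E.toVF hU⁆ = c • E.toVF hU)
    (hsym : ∀ V : VF U, V ∈ Submodule.span ℝ (Set.range (generators D E hU)) ↔
      IsPointSymmetry F H U V.1) :
    ∃ L : LieSubalgebra ℝ (VF U), IsPointSymmetryAlgebra F H U L ∧
      Module.finrank ℝ L = 5 ∧ LieAlgebra.IsSolvable L ∧
      ∃ X : Module.Basis (Fin 5) ℝ L,
        (∀ m ∈ U,
          (X 0 : VF U).1 m = affineField D.M 0 D.π D.σ m ∧
          (X 1 : VF U).1 m = affineField E.M 0 E.π E.σ m ∧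
          (X 2 : VF U).1 m = ![1, 0, 0, 0, 0] ∧
          (X 3 : VF U).1 m = ![0, 1, 0, 0, 0] ∧
          (X 4 : VF U).1 m = ![0, 0, 1, 0, 0]) ∧
        ⁅X 0, X 1⁆ = c • X 1 ∧
        ⁅X 0, X 2⁆ = (-D.M 0 0) • X 2 + (-D.M 1 0) • X 3 + (-D.M 2 0) • X 4 ∧
        ⁅X 0, X 3⁆ = (-D.M 0 1) • X 2 + (-D.M 1 1) • X 3 + (-D.M 2 1) • X 4 ∧
        ⁅X 0, X 4⁆ = (-D.M 0 2) • X 2 + (-D.M 1 2) • X 3 + (-D.M 2 2) • X 4 ∧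
        ⁅X 1, X 2⁆ = (-E.M 0 0) • X 2 + (-E.M 1 0) • X 3 + (-E.M 2 0) • X 4 ∧
        ⁅X 1, X 3⁆ = (-E.M 0 1) • X 2 + (-E.M 1 1) • X 3 + (-E.M 2 1) • X 4 ∧
        ⁅X 1, X 4⁆ = (-E.M 0 2) • X 2 + (-E.M 1 2) • X 3 + (-E.M 2 2) • X 4 ∧
        ⁅X 2, X 3⁆ = 0 ∧
        ⁅X 2, X 4⁆ = 0 ∧
        ⁅X 3, X 4⁆ = 0 ∧
        ∃ A : LieIdeal ℝ L, A.toSubmodule = Submodule.span ℝ {X 2, X 3, X 4} ∧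
          Module.finrank ℝ A = 3 ∧ IsLieAbelian A := by
  obtain ⟨L, hL, hfin, hsol, X, hX, hA⟩ := exists_symmetryAlgebra
    (generators_linearIndependent hne hM) (generators_bracketTable hc) hsym
  have hX0 : (X 0 : VF U) = D.toVF hU := hX 0
  have hX1 : (X 1 : VF U) = E.toVF hU := hX 1
  have hX2 : (X 2 : VF U) = translationVF U ![1, 0, 0] := hX 2
  have hX3 : (X 3 : VF U) = translationVF U ![0, 1, 0] := hX 3
  have hX4 : (X 4 : VF U) = translationVF U ![0, 0, 1] := hX 4
  refine ⟨L, hL, hfin, hsol, X, fun m hm => ⟨?_, ?_, ?_, ?_, ?_⟩, Subtype.ext ?_,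
    Subtype.ext ?_, Subtype.ext ?_, Subtype.ext ?_, Subtype.ext ?_, Subtype.ext ?_,
    Subtype.ext ?_, Subtype.ext ?_, Subtype.ext ?_, Subtype.ext ?_, hA⟩
  · rw [hX0, D.toVF_apply hU hm]
  · rw [hX1, E.toVF_apply hU hm]
  · rw [hX2, translationVF_apply _ hm]; simp
  · rw [hX3, translationVF_apply _ hm]; simp
  · rw [hX4, translationVF_apply _ hm]; simp
  · rw [LieSubalgebra.coe_bracket, hX0, hX1, hc, ← hX1]
    rfl
  · change ⁅(X 0 : VF U), (X 2 : VF U)⁆ = _ • (X 2 : VF U) + _ • (X 3 : VF U) + _ • (X 4 : VF U)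
    rw [hX0, hX2, hX3, hX4, D.bracket_translationVF, translationVF_eq]
    simp [Matrix.mulVec, dotProduct, Fin.sum_univ_three]
  · change ⁅(X 0 : VF U), (X 3 : VF U)⁆ = _ • (X 2 : VF U) + _ • (X 3 : VF U) + _ • (X 4 : VF U)
    rw [hX0, hX2, hX3, hX4, D.bracket_translationVF, translationVF_eq]
    simp [Matrix.mulVec, dotProduct, Fin.sum_univ_three]
  · change ⁅(X 0 : VF U), (X 4 : VF U)⁆ = _ • (X 2 : VF U) + _ • (X 3 : VF U) + _ • (X 4 : VF U)
    rw [hX0, hX2, hX3, hX4, D.bracket_translationVF, translationVF_eq]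
    simp [Matrix.mulVec, dotProduct, Fin.sum_univ_three]
  · change ⁅(X 1 : VF U), (X 2 : VF U)⁆ = _ • (X 2 : VF U) + _ • (X 3 : VF U) + _ • (X 4 : VF U)
    rw [hX1, hX2, hX3, hX4, E.bracket_translationVF, translationVF_eq]
    simp [Matrix.mulVec, dotProduct, Fin.sum_univ_three]
  · change ⁅(X 1 : VF U), (X 3 : VF U)⁆ = _ • (X 2 : VF U) + _ • (X 3 : VF U) + _ • (X 4 : VF U)
    rw [hX1, hX2, hX3, hX4, E.bracket_translationVF, translationVF_eq]
    simp [Matrix.mulVec, dotProduct, Fin.sum_univ_three]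
  · change ⁅(X 1 : VF U), (X 4 : VF U)⁆ = _ • (X 2 : VF U) + _ • (X 3 : VF U) + _ • (X 4 : VF U)
    rw [hX1, hX2, hX3, hX4, E.bracket_translationVF, translationVF_eq]
    simp [Matrix.mulVec, dotProduct, Fin.sum_univ_three]
  · rw [LieSubalgebra.coe_bracket, hX2, hX3, bracket_translationVF_translationVF]
    rfl
  · rw [LieSubalgebra.coe_bracket, hX2, hX4, bracket_translationVF_translationVF]
    rfl
  · rw [LieSubalgebra.coe_bracket, hX3, hX4, bracket_translationVF_translationVF]
    rfl

end

/-! ### Determining equations of the point symmetries -/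

section

variable {U : TopologicalSpace.Opens Jet}

/-- The entry `∂_j V_i` of the Jacobian matrix of a vector field. -/
noncomputable def VF.jac (V : VF U) (i j : Fin 5) (m : Jet) : ℝ := pd j (fun m => V.1 m i) m

theorem VF.contDiffOn_jac (V : VF U) (i j : Fin 5) : ContDiffOn ℝ ∞ (VF.jac V i j) U :=
  contDiffOn_pd (VF.contDiffOn_comp V i) j

theorem VF.differentiableAt_jac (V : VF U) (i j : Fin 5) {m : Jet} (hm : m ∈ U) :
    DifferentiableAt ℝ (VF.jac V i j) m :=
  differentiableAt_of_smooth (VF.contDiffOn_jac V i j) hm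

/-- The integrability condition on Jacobian entries: it turns linear relations among them into the
vanishing of second derivatives. -/
theorem VF.pd_jac (V : VF U) (i j k : Fin 5) {m : Jet} (hm : m ∈ U) :
    pd k (VF.jac V i j) m = pd j (VF.jac V i k) m :=
  pd_comm (VF.contDiffOn_comp V i) hm k j

theorem VF.pd_jac_eq_zero (V : VF U) {i k : Fin 5} (h : ∀ m ∈ U, VF.jac V i k m = 0) (j : Fin 5)
    {m : Jet} (hm : m ∈ U) : pd k (VF.jac V i j) m = 0 :=
  pd_pd_eq_zero (VF.contDiffOn_comp V i) h j m hm

theorem VF.fderiv_eq_jac (V : VF U) {m : Jet} (hm : m ∈ U) (v : Jet) (i : Fin 5) :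
    fderiv ℝ V.1 m v i = v 0 * VF.jac V i 0 m + v 1 * VF.jac V i 1 m + v 2 * VF.jac V i 2 m
      + v 3 * VF.jac V i 3 m + v 4 * VF.jac V i 4 m :=
  VF.fderiv_comp V hm v i

/-- The base components of a symmetry do not depend on `p` and `r`. -/
theorem SymmetryEquations.jac_fiber {F H : Jet → ℝ} {V : VF U}
    (hV : ∀ m ∈ U, SymmetryEquations F H V.1 m) :
    ∀ i ∈ ({0, 1, 2} : Set (Fin 5)), ∀ m ∈ U, VF.jac V i 3 m = 0 ∧ VF.jac V i 4 m = 0 := by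
  have h0 : ∀ m ∈ U, VF.jac V 0 3 m = 0 ∧ VF.jac V 0 4 m = 0 := fun m hm =>
    ⟨by simpa [VF.fderiv_eq_jac V hm] using
          (hV m hm).fst (Pi.single 3 1) (by simp) (by simp) (by simp),
      by simpa [VF.fderiv_eq_jac V hm] using
          (hV m hm).fst (Pi.single 4 1) (by simp) (by simp) (by simp)⟩
  have h1 : ∀ m ∈ U, VF.jac V 1 3 m = 0 ∧ VF.jac V 1 4 m = 0 := fun m hm =>
    ⟨by simpa [VF.fderiv_eq_jac V hm] using
          (hV m hm).snd (Pi.single 3 1) (by simp) (by simp) (by simp),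
      by simpa [VF.fderiv_eq_jac V hm] using
          (hV m hm).snd (Pi.single 4 1) (by simp) (by simp) (by simp)⟩
  -- ∂_p and ∂_r lie in the kernel of ω¹; since the x and y components do not depend on p and r,
  -- only the derivative of the z component survives.
  have h2 : ∀ m ∈ U, VF.jac V 2 3 m = 0 ∧ VF.jac V 2 4 m = 0 := fun m hm =>
    ⟨by simpa [VF.fderiv_eq_jac V hm, h0 m hm, h1 m hm] using
        (hV m hm).contact (Pi.single 3 1) (by simp),
      by simpa [VF.fderiv_eq_jac V hm, h0 m hm, h1 m hm] using
        (hV m hm).contact (Pi.single 4 1) (by simp)⟩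
  rintro i (rfl | rfl | rfl)
  exacts [h0, h1, h2]

/-- The first prolongation formula, obtained on the kernel vector ∂_x + p ∂_z. -/
theorem SymmetryEquations.contact_x {F H : Jet → ℝ} {V : VF U} {m : Jet} (hm : m ∈ U)
    (hV : ∀ m ∈ U, SymmetryEquations F H V.1 m) :
    V.1 m 3 = VF.jac V 2 0 m + m 3 * VF.jac V 2 2 m - m 3 * (VF.jac V 0 0 m + m 3 * VF.jac V 0 2 m)
      - F m * (VF.jac V 1 0 m + m 3 * VF.jac V 1 2 m) := by
  have := (hV m hm).contact ![1, 0, m 3, 0, 0] (by simp)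
  simp only [VF.fderiv_eq_jac V hm, Matrix.cons_val] at this
  linarith

/-- The same on ∂_y + F ∂_z. For F = f(p) the left side is f'(p) times the p component, so
comparison with `contact_x` yields the tangency condition. -/
theorem SymmetryEquations.contact_y {F H : Jet → ℝ} {V : VF U} {m : Jet} (hm : m ∈ U)
    (hV : ∀ m ∈ U, SymmetryEquations F H V.1 m) :
    fderiv ℝ F m (V.1 m) = VF.jac V 2 1 m + F m * VF.jac V 2 2 m
      - m 3 * (VF.jac V 0 1 m + F m * VF.jac V 0 2 m) - F m * (VF.jac V 1 1 m + F m * VF.jac V 1 2 m) := by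
  have := (hV m hm).contact ![0, 1, F m, 0, 0] (by simp)
  simp only [VF.fderiv_eq_jac V hm, Matrix.cons_val] at this
  linarith

/-- The Jacobian matrix of the base components of a symmetry is tangent to the symmetries of the
curve `p ↦ (p, f(p))`. -/
theorem ModelData.eventually_tangency {I : Set ℝ} {f f₁ f₂ f₃ k k₁ : ℝ → ℝ}
    (h : ModelData I f f₁ f₂ f₃ k k₁) (hU : ∀ m ∈ U, m 3 ∈ I) {H : Jet → ℝ} {V : VF U}
    (hV : ∀ m ∈ U, SymmetryEquations (fun m => f (m 3)) H V.1 m) {m : Jet} (hm : m ∈ U) :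
    ∀ᶠ p in nhds (m 3), p ∈ I ∧
      f₁ p * (VF.jac V 2 0 m + p * VF.jac V 2 2 m - p * (VF.jac V 0 0 m + p * VF.jac V 0 2 m)
        - f p * (VF.jac V 1 0 m + p * VF.jac V 1 2 m)) =
      VF.jac V 2 1 m + f p * VF.jac V 2 2 m - p * (VF.jac V 0 1 m + f p * VF.jac V 0 2 m)
        - f p * (VF.jac V 1 1 m + f p * VF.jac V 1 2 m) := by
  have hf := SymmetryEquations.jac_fiber hV
  -- Only the p coordinate moves, so the base Jacobian keeps its values at m.
  filter_upwards [eventually_update_mem hm 3,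
    eventually_pd_update_eq (VF.contDiffOn_comp V 0) (fun m hm => (hf 0 (by simp) m hm).1) hm,
    eventually_pd_update_eq (VF.contDiffOn_comp V 1) (fun m hm => (hf 1 (by simp) m hm).1) hm,
    eventually_pd_update_eq (VF.contDiffOn_comp V 2) (fun m hm => (hf 2 (by simp) m hm).1) hm]
    with p hp h0 h1 h2
  have e3 : Function.update m 3 p 3 = p := by simp
  have hI := hU _ hp
  have hx := SymmetryEquations.contact_x hp hV
  have hy := SymmetryEquations.contact_y hp hV
  rw [(h.hasFDerivAt_F hI).fderiv] at hy
  simp only [_root_.smul_apply, smul_eq_mul, dCoord, ContinuousLinearMap.proj_apply, VF.jac,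
    h0, h1, h2, e3] at hx hy
  rw [e3] at hI
  refine ⟨hI, ?_⟩
  rw [hx] at hy
  exact hy

end

/-! ### The base components of the symmetries of the three models -/

section

variable {U : TopologicalSpace.Opens Jet}

/-- Classification for the curves `f(p)` with `p f'(p) = b f(p)`. -/
theorem ModelData.exists_diagonal {I : Set ℝ} {f f₁ f₂ f₃ k k₁ : ℝ → ℝ}
    (h : ModelData I f f₁ f₂ f₃ k k₁) (hconn : IsConnected (U : Set Jet))
    (hU : ∀ m ∈ U, m 3 ∈ I) {H : Jet → ℝ} {b : ℝ} (hb1 : 1 < b) (hb2 : b < 2)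
    (hpos : ∀ p ∈ I, p ≠ 0) (hf0 : ∀ p ∈ I, f p ≠ 0) (hf : ∀ p ∈ I, p * f₁ p = b * f p)
    {V : VF U} (hV : ∀ m ∈ U, SymmetryEquations (fun m => f (m 3)) H V.1 m) :
    ∃ (α β : ℝ) (d : Fin 3 → ℝ), ∀ m ∈ U,
      V.1 m 0 = α * m 0 + d 0 ∧ V.1 m 1 = β * m 1 + d 1 ∧
      V.1 m 2 = (b * α - β) / (b - 1) * m 2 + d 2 := by
  have hfib := SymmetryEquations.jac_fiber hV
  have hJ : ∀ m ∈ U, VF.jac V 2 1 m = 0 ∧ VF.jac V 2 0 m = 0 ∧ VF.jac V 0 1 m = 0 ∧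
      b * (VF.jac V 2 2 m - VF.jac V 0 0 m) - (VF.jac V 2 2 m - VF.jac V 1 1 m) = 0 ∧
      VF.jac V 1 0 m = 0 ∧ VF.jac V 0 2 m = 0 ∧ VF.jac V 1 2 m = 0 := by
    intro m hm
    have hI : ∀ᶠ p in nhds (m 3), p ∈ I := h.isOpen.mem_nhds (hU m hm)
    -- Multiplied by p and rewritten with p f' = b f, the tangency condition is a combination of the
    -- seven monomials in p and f. For 1 < b < 2 their eigenvalues are distinct: 1 < b < 2 < 1 + b <
    -- 2b < 2 + b < 1 + 2b.
    have key := eq_zero_of_monomials (𝕜 := ℝ) (p₀ := m 3) (u := fun p => p) (v := f)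
      (w := fun p => p⁻¹) (l₁ := 1) (l₂ := b)
      (c := ![-VF.jac V 2 1 m, b * VF.jac V 2 0 m, VF.jac V 0 1 m,
        b * (VF.jac V 2 2 m - VF.jac V 0 0 m) - (VF.jac V 2 2 m - VF.jac V 1 1 m), -b * VF.jac V 1 0 m,
        (1 - b) * VF.jac V 0 2 m, (1 - b) * VF.jac V 1 2 m])
      (by
        intro i j hij
        fin_cases i <;> fin_cases j <;> first | rfl | (exfalso; simp at hij; done) |
          (exfalso; simp at hij; linarith))
      (by filter_upwards [hI] with p hp using inv_ne_zero (hpos p hp))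
      (by
        filter_upwards [hI] with p hp
        refine (hasDerivAt_id p).congr_deriv ?_
        rw [one_mul, mul_inv_cancel₀ (hpos p hp)])
      (by
        filter_upwards [hI] with p hp
        refine (h.f_deriv p hp).congr_deriv ?_
        rw [← hf p hp, mul_comm p, mul_assoc, mul_inv_cancel₀ (hpos p hp), mul_one])
      (hpos _ (hU m hm)) (hf0 _ (hU m hm))
      (by
        filter_upwards [h.eventually_tangency hU hV hm] with p hp
        have e := hf p hp.1
        simp only [Matrix.cons_val]
        linear_combination p * hp.2 - (VF.jac V 2 0 m + p * VF.jac V 2 2 m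
          - p * (VF.jac V 0 0 m + p * VF.jac V 0 2 m) - f p * (VF.jac V 1 0 m + p * VF.jac V 1 2 m)) * e)
    have hb0 : b ≠ 0 := by linarith
    have hb1' : 1 - b ≠ 0 := by linarith
    have k0 := key 0
    have k1 := key 1
    have k2 := key 2
    have k3 := key 3
    have k4 := key 4
    have k5 := key 5
    have k6 := key 6
    simp only [Matrix.cons_val, mul_eq_zero, neg_eq_zero, hb0, hb1', false_or]
      at k0 k1 k2 k3 k4 k5 k6
    exact ⟨k0, k1, k2, k3, k4, k5, k6⟩
  -- The surviving relation (b - 1) J₂₂ = b J₀₀ - J₁₁ is differentiated. Along x, ∂₀J₂₂ = ∂₂J₂₀ = 0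
  -- and ∂₀J₁₁ = ∂₁J₁₀ = 0, so ∂₀J₀₀ = 0; likewise ∂₁J₁₁ = 0 along y.
  have hR (i : Fin 5) (m : Jet) (hm : m ∈ U) :
      b * (pd i (VF.jac V 2 2) m - pd i (VF.jac V 0 0) m)
        - (pd i (VF.jac V 2 2) m - pd i (VF.jac V 1 1) m) = 0 := by
    have d0 := VF.differentiableAt_jac V 0 0 hm
    have d1 := VF.differentiableAt_jac V 1 1 hm
    have d2 := VF.differentiableAt_jac V 2 2 hm
    have := pd_eq_zero_of_eq_const (fun m hm => (hJ m hm).2.2.2.1) hm i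
    rwa [pd_sub ((d2.fun_sub d0).const_mul b) (d2.fun_sub d1), pd_const_mul (d2.fun_sub d0),
      pd_sub d2 d0, pd_sub d2 d1] at this
  have hb0 : b ≠ 0 := by linarith
  obtain ⟨α, hα⟩ := exists_eq_const hconn (VF.contDiffOn_jac V 0 0)
    (fun m hm => by
      have := hR 0 m hm
      rw [VF.pd_jac V 2 2 0 hm, VF.pd_jac V 1 1 0 hm,
        pd_eq_zero_of_eq_const (fun m hm => (hJ m hm).2.1) hm,
        pd_eq_zero_of_eq_const (fun m hm => (hJ m hm).2.2.2.2.1) hm] at this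
      simpa [hb0] using this)
    (fun m hm => VF.pd_jac_eq_zero V (fun m hm => (hJ m hm).2.2.1) 0 hm)
    (fun m hm => VF.pd_jac_eq_zero V (fun m hm => (hJ m hm).2.2.2.2.2.1) 0 hm)
    (fun m hm => VF.pd_jac_eq_zero V (fun m hm => (hfib 0 (by simp) m hm).1) 0 hm)
    (fun m hm => VF.pd_jac_eq_zero V (fun m hm => (hfib 0 (by simp) m hm).2) 0 hm)
  obtain ⟨β, hβ⟩ := exists_eq_const hconn (VF.contDiffOn_jac V 1 1)
    (fun m hm => VF.pd_jac_eq_zero V (fun m hm => (hJ m hm).2.2.2.2.1) 1 hm)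
    (fun m hm => by
      have := hR 1 m hm
      rw [VF.pd_jac V 2 2 1 hm, VF.pd_jac V 0 0 1 hm,
        pd_eq_zero_of_eq_const (fun m hm => (hJ m hm).1) hm,
        pd_eq_zero_of_eq_const (fun m hm => (hJ m hm).2.2.1) hm] at this
      simpa using this)
    (fun m hm => VF.pd_jac_eq_zero V (fun m hm => (hJ m hm).2.2.2.2.2.2) 1 hm)
    (fun m hm => VF.pd_jac_eq_zero V (fun m hm => (hfib 1 (by simp) m hm).1) 1 hm)
    (fun m hm => VF.pd_jac_eq_zero V (fun m hm => (hfib 1 (by simp) m hm).2) 1 hm)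
  obtain ⟨d₀, h0⟩ := exists_eq_affine hconn (VF.contDiffOn_comp V 0) hα
    (fun m hm => (hJ m hm).2.2.1) (fun m hm => (hJ m hm).2.2.2.2.2.1)
    (fun m hm => (hfib 0 (by simp) m hm).1) (fun m hm => (hfib 0 (by simp) m hm).2)
  obtain ⟨d₁, h1⟩ := exists_eq_affine hconn (VF.contDiffOn_comp V 1)
    (fun m hm => (hJ m hm).2.2.2.2.1) hβ (fun m hm => (hJ m hm).2.2.2.2.2.2)
    (fun m hm => (hfib 1 (by simp) m hm).1) (fun m hm => (hfib 1 (by simp) m hm).2)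
  obtain ⟨d₂, h2⟩ := exists_eq_affine hconn (VF.contDiffOn_comp V 2) (a₂ := (b * α - β) / (b - 1))
    (fun m hm => (hJ m hm).2.1) (fun m hm => (hJ m hm).1)
    (fun m hm => by
      have := (hJ m hm).2.2.2.1
      rw [hα m hm, hβ m hm] at this
      rw [eq_div_iff (by linarith)]
      change VF.jac V 2 2 m * (b - 1) = _
      linarith)
    (fun m hm => (hfib 2 (by simp) m hm).1) (fun m hm => (hfib 2 (by simp) m hm).2)
  refine ⟨α, β, ![d₀, d₁, d₂], fun m hm => ⟨?_, ?_, ?_⟩⟩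
  · simpa using h0 m hm
  · simpa using h1 m hm
  · simpa using h2 m hm

/-- Classification for the logarithmic spirals. -/
theorem ModelData.exists_spiral {I : Set ℝ} {f f₁ f₂ f₃ k k₁ : ℝ → ℝ}
    (h : ModelData I f f₁ f₂ f₃ k k₁) (hconn : IsConnected (U : Set Jet))
    (hU : ∀ m ∈ U, m 3 ∈ I) {H : Jet → ℝ} {b : ℝ} (hb : 0 < b)
    (hn : ∀ p ∈ I, b * p - f p ≠ 0) (hf : ∀ p ∈ I, f₁ p = (p + b * f p) / (b * p - f p))
    {V : VF U} (hV : ∀ m ∈ U, SymmetryEquations (fun m => f (m 3)) H V.1 m) :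
    ∃ (α β : ℝ) (d : Fin 3 → ℝ), ∀ m ∈ U,
      V.1 m 0 = α * m 0 - β * m 1 + d 0 ∧ V.1 m 1 = β * m 0 + α * m 1 + d 1 ∧
      V.1 m 2 = (α + b * β) * m 2 + d 2 := by
  have hfib := SymmetryEquations.jac_fiber hV
  have hJ : ∀ m ∈ U, VF.jac V 2 0 m = 0 ∧ VF.jac V 2 1 m = 0 ∧ VF.jac V 0 2 m = 0 ∧ VF.jac V 1 2 m = 0 ∧
      VF.jac V 1 1 m = VF.jac V 0 0 m ∧ VF.jac V 0 1 m = -1 * VF.jac V 1 0 m ∧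
      VF.jac V 2 2 m = VF.jac V 0 0 m + b * VF.jac V 1 0 m := by
    intro m hm
    have hI : ∀ᶠ p in nhds (m 3), p ∈ I := h.isOpen.mem_nhds (hU m hm)
    -- These are the coefficients of the tangency condition after multiplication by bp - f.
    have key := eq_zero_of_spiral (p₀ := m 3) hb (f := f)
      (c := ![VF.jac V 2 0 m - b * VF.jac V 2 1 m, b * VF.jac V 2 0 m + VF.jac V 2 1 m,
        VF.jac V 2 2 m - VF.jac V 0 0 m + b * VF.jac V 0 1 m,
        -VF.jac V 1 0 m + b * (VF.jac V 1 1 m - VF.jac V 0 0 m) - VF.jac V 0 1 m,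
        -b * VF.jac V 1 0 m + VF.jac V 2 2 m - VF.jac V 1 1 m, -VF.jac V 0 2 m, -VF.jac V 1 2 m])
      (by filter_upwards [hI] with p hp using hf p hp ▸ h.f_deriv p hp)
      (by filter_upwards [hI] with p hp using hn p hp)
      (by
        filter_upwards [h.eventually_tangency hU hV hm] with p hp
        have e : f₁ p * (b * p - f p) = p + b * f p := by
          rw [hf p hp.1, div_mul_cancel₀ _ (hn p hp.1)]
        simp only [Matrix.cons_val]
        linear_combination (b * p - f p) * hp.2 - (VF.jac V 2 0 m + p * VF.jac V 2 2 m
          - p * (VF.jac V 0 0 m + p * VF.jac V 0 2 m) - f p * (VF.jac V 1 0 m + p * VF.jac V 1 2 m)) * e)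
    have k0 := key 0
    have k1 := key 1
    have k2 := key 2
    have k3 := key 3
    have k4 := key 4
    have k5 := key 5
    have k6 := key 6
    simp only [Matrix.cons_val, neg_eq_zero] at k0 k1 k2 k3 k4 k5 k6
    have hb2 : (1 + b ^ 2 : ℝ) ≠ 0 := by positivity
    -- The relations form real linear systems whose determinant is 1 + b², up to sign.
    have h20 : VF.jac V 2 0 m = 0 := (mul_eq_zero.1
      (show (1 + b ^ 2) * VF.jac V 2 0 m = 0 by linear_combination k0 + b * k1)).resolve_left hb2
    have hs : VF.jac V 1 0 m + VF.jac V 0 1 m = 0 := (mul_eq_zero.1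
      (show (1 + b ^ 2) * (VF.jac V 1 0 m + VF.jac V 0 1 m) = 0 by
        linear_combination -k3 + b * k2 - b * k4)).resolve_left hb2
    have h11 : VF.jac V 1 1 m = VF.jac V 0 0 m := by linear_combination k2 - k4 - b * hs
    refine ⟨h20, by linear_combination k1 - b * h20, k5, k6, h11, by linear_combination hs, ?_⟩
    linear_combination k4 + h11
  have hR11 (i : Fin 5) (m : Jet) (hm : m ∈ U) : pd i (VF.jac V 1 1) m = pd i (VF.jac V 0 0) m :=
    pd_congr (fun m hm => (hJ m hm).2.2.2.2.1) hm i
  have hR01 (i : Fin 5) (m : Jet) (hm : m ∈ U) : pd i (VF.jac V 0 1) m = -1 * pd i (VF.jac V 1 0) m := by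
    rw [pd_congr (fun m hm => (hJ m hm).2.2.2.2.2.1) hm i,
      pd_const_mul (VF.differentiableAt_jac V 1 0 hm)]
  have hR22 (i : Fin 5) (m : Jet) (hm : m ∈ U) :
      pd i (VF.jac V 2 2) m = pd i (VF.jac V 0 0) m + b * pd i (VF.jac V 1 0) m := by
    rw [pd_congr (fun m hm => (hJ m hm).2.2.2.2.2.2) hm i,
      pd_add (VF.differentiableAt_jac V 0 0 hm) ((VF.differentiableAt_jac V 1 0 hm).const_mul b),
      pd_const_mul (VF.differentiableAt_jac V 1 0 hm)]
  -- The relations J₁₁ = J₀₀ and J₀₁ = -J₁₀ give Cauchy–Riemann equations for J₀₀ and J₁₀, while J₂₂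
  -- = J₀₀ + b J₁₀ has zero derivatives along x and y. Together this is again a system governed by 1
  -- + b².
  have hzero (m : Jet) (hm : m ∈ U) : pd 0 (VF.jac V 0 0) m = 0 ∧ pd 0 (VF.jac V 1 0) m = 0 ∧
      pd 1 (VF.jac V 0 0) m = 0 ∧ pd 1 (VF.jac V 1 0) m = 0 := by
    have r0 := hR22 0 m hm
    have r1 := hR22 1 m hm
    rw [VF.pd_jac V 2 2 0 hm, pd_eq_zero_of_eq_const (fun m hm => (hJ m hm).1) hm] at r0
    rw [VF.pd_jac V 2 2 1 hm, pd_eq_zero_of_eq_const (fun m hm => (hJ m hm).2.1) hm] at r1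
    have s0 : pd 1 (VF.jac V 0 0) m = -1 * pd 0 (VF.jac V 1 0) m := by
      rw [VF.pd_jac V 0 0 1 hm, hR01 0 m hm]
    have s1 : pd 1 (VF.jac V 1 0) m = pd 0 (VF.jac V 0 0) m := by
      rw [VF.pd_jac V 1 0 1 hm, hR11 0 m hm]
    have hb2 : (1 + b ^ 2 : ℝ) ≠ 0 := by positivity
    have h10 : pd 0 (VF.jac V 1 0) m = 0 := (mul_eq_zero.1
      (show (1 + b ^ 2) * pd 0 (VF.jac V 1 0) m = 0 by
        linear_combination r1 + s0 + b * s1 - b * r0)).resolve_left hb2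
    have h00 : pd 0 (VF.jac V 0 0) m = 0 := by linear_combination -r0 - b * h10
    exact ⟨h00, h10, by rw [s0, h10, mul_zero], by rw [s1, h00]⟩
  obtain ⟨α, hα⟩ := exists_eq_const hconn (VF.contDiffOn_jac V 0 0)
    (fun m hm => (hzero m hm).1) (fun m hm => (hzero m hm).2.2.1)
    (fun m hm => VF.pd_jac_eq_zero V (fun m hm => (hJ m hm).2.2.1) 0 hm)
    (fun m hm => VF.pd_jac_eq_zero V (fun m hm => (hfib 0 (by simp) m hm).1) 0 hm)
    (fun m hm => VF.pd_jac_eq_zero V (fun m hm => (hfib 0 (by simp) m hm).2) 0 hm)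
  obtain ⟨β, hβ⟩ := exists_eq_const hconn (VF.contDiffOn_jac V 1 0)
    (fun m hm => (hzero m hm).2.1) (fun m hm => (hzero m hm).2.2.2)
    (fun m hm => VF.pd_jac_eq_zero V (fun m hm => (hJ m hm).2.2.2.1) 0 hm)
    (fun m hm => VF.pd_jac_eq_zero V (fun m hm => (hfib 1 (by simp) m hm).1) 0 hm)
    (fun m hm => VF.pd_jac_eq_zero V (fun m hm => (hfib 1 (by simp) m hm).2) 0 hm)
  obtain ⟨d₀, h0⟩ := exists_eq_affine hconn (VF.contDiffOn_comp V 0) hα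
    (fun m hm => ((hJ m hm).2.2.2.2.2.1).trans (by rw [hβ m hm]))
    (fun m hm => (hJ m hm).2.2.1)
    (fun m hm => (hfib 0 (by simp) m hm).1) (fun m hm => (hfib 0 (by simp) m hm).2)
  obtain ⟨d₁, h1⟩ := exists_eq_affine hconn (VF.contDiffOn_comp V 1) hβ
    (fun m hm => ((hJ m hm).2.2.2.2.1).trans (hα m hm)) (fun m hm => (hJ m hm).2.2.2.1)
    (fun m hm => (hfib 1 (by simp) m hm).1) (fun m hm => (hfib 1 (by simp) m hm).2)
  obtain ⟨d₂, h2⟩ := exists_eq_affine hconn (VF.contDiffOn_comp V 2)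
    (fun m hm => (hJ m hm).1) (fun m hm => (hJ m hm).2.1)
    (fun m hm => ((hJ m hm).2.2.2.2.2.2).trans (by rw [hα m hm, hβ m hm]))
    (fun m hm => (hfib 2 (by simp) m hm).1) (fun m hm => (hfib 2 (by simp) m hm).2)
  refine ⟨α, β, ![d₀, d₁, d₂], fun m hm => ⟨?_, ?_, ?_⟩⟩
  · rw [h0 m hm]; simp; ring
  · rw [h1 m hm]; simp
  · rw [h2 m hm]; simp

end

/-! ### The base components of the symmetries of model (ii) -/

section

variable {U : TopologicalSpace.Opens Jet}

theorem modelData_ii : ModelData Set.univ (fun p => 1 / 4 * p ^ 2) (fun p => 1 / 2 * p)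
    (fun _ => 1 / 2) (fun _ => 0) (fun _ => 1) (fun _ => 0) where
  isOpen := isOpen_univ
  f_deriv p _ := ((hasDerivAt_pow 2 p).const_mul (1 / 4)).congr_deriv (by simp; ring)
  f₁_deriv p _ := ((hasDerivAt_id p).const_mul (1 / 2)).congr_deriv (by simp)
  f₂_deriv p _ := hasDerivAt_const p _
  k_deriv p _ := hasDerivAt_const p _

/-- The first determining equations of model (ii): the base Jacobian is conformal. -/
theorem conformal_of_symmetry {H : Jet → ℝ} {V : VF U}
    (hV : ∀ m ∈ U, SymmetryEquations (fun m => 1 / 4 * m 3 ^ 2) H V.1 m) {m : Jet} (hm : m ∈ U) :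
    VF.jac V 2 1 m = 0 ∧ VF.jac V 0 1 m = (-(1 / 2)) * VF.jac V 2 0 m ∧
      VF.jac V 1 1 m = 2 * VF.jac V 0 0 m - VF.jac V 2 2 m ∧
      VF.jac V 1 0 m = -2 * VF.jac V 0 2 m ∧ VF.jac V 1 2 m = 0 := by
  -- For f = p²/4 the tangency condition is a quartic polynomial in p. Its five coefficients leave
  -- four free entries of the 3×3 Jacobian.
  obtain ⟨h0, h1, h2, h3, h4⟩ := eq_zero_of_quartic (p₀ := m 3) (c₀ := -VF.jac V 2 1 m)
    (c₁ := 1 / 2 * VF.jac V 2 0 m + VF.jac V 0 1 m)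
    (c₂ := 1 / 2 * (VF.jac V 2 2 m - VF.jac V 0 0 m)
      - 1 / 4 * (VF.jac V 2 2 m - VF.jac V 1 1 m))
    (c₃ := -(1 / 4) * VF.jac V 0 2 m - 1 / 8 * VF.jac V 1 0 m)
    (c₄ := -(1 / 16) * VF.jac V 1 2 m) (by
      filter_upwards [modelData_ii.eventually_tangency (fun _ _ => Set.mem_univ _) hV hm] with p hp
      linear_combination hp.2)
  exact ⟨by linarith, by linarith, by linarith, by linarith, by linarith⟩

theorem contDiffOn_coord (i : Fin 5) : ContDiffOn ℝ ∞ (fun m : Jet => m i) (U : Set Jet) :=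
  (dCoord i).contDiff.contDiffOn

/-- The `p` component of a symmetry of model (ii) and its fibre derivatives. -/
theorem p_component_ii {H : Jet → ℝ} {V : VF U}
    (hV : ∀ m ∈ U, SymmetryEquations (fun m => 1 / 4 * m 3 ^ 2) H V.1 m) {m : Jet} (hm : m ∈ U) :
    VF.jac V 3 3 m = VF.jac V 2 2 m - VF.jac V 0 0 m - m 3 * VF.jac V 0 2 m ∧
      VF.jac V 3 4 m = 0 := by
  have hfib := SymmetryEquations.jac_fiber hV
  have e : ∀ m ∈ U, V.1 m 3 = VF.jac V 2 0 m + m 3 * (VF.jac V 2 2 m - VF.jac V 0 0 m)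
      - m 3 * m 3 * (1 / 2 * VF.jac V 0 2 m) := by
    intro m hm
    obtain ⟨-, -, -, h10, h12⟩ := conformal_of_symmetry hV hm
    rw [SymmetryEquations.contact_x hm hV, h10, h12]
    ring
  have hpd (i : Fin 5) : pd i (fun m => V.1 m 3) m = pd i (VF.jac V 2 0) m
      + (m 3 * (pd i (VF.jac V 2 2) m - pd i (VF.jac V 0 0) m)
        + (VF.jac V 2 2 m - VF.jac V 0 0 m) * (if i = 3 then 1 else 0))
      - (m 3 * m 3 * (1 / 2 * pd i (VF.jac V 0 2) m)
        + 1 / 2 * VF.jac V 0 2 m * (2 * m 3 * (if i = 3 then 1 else 0))) := by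
    have d20 := VF.differentiableAt_jac V 2 0 hm
    have d22 := VF.differentiableAt_jac V 2 2 hm
    have d00 := VF.differentiableAt_jac V 0 0 hm
    have d02 := VF.differentiableAt_jac V 0 2 hm
    have d3 := differentiableAt_coord 3 m
    rw [pd_congr e hm, pd_sub (d20.fun_add (d3.fun_mul (d22.fun_sub d00)))
      ((d3.fun_mul d3).fun_mul (d02.const_mul (1 / 2))),
      pd_add d20 (d3.fun_mul (d22.fun_sub d00)), pd_mul d3 (d22.fun_sub d00), pd_sub d22 d00,
      pd_mul (d3.fun_mul d3) (d02.const_mul (1 / 2)), pd_const_mul d02, pd_mul d3 d3, pd_coord]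
    ring
  have z (k : Fin 5) (hk : ∀ i ∈ ({0, 1, 2} : Set (Fin 5)), ∀ m ∈ U, VF.jac V i k m = 0) :
      pd k (VF.jac V 2 0) m = 0 ∧ pd k (VF.jac V 2 2) m = 0 ∧ pd k (VF.jac V 0 0) m = 0 ∧
        pd k (VF.jac V 0 2) m = 0 :=
    ⟨VF.pd_jac_eq_zero V (hk 2 (by simp)) 0 hm, VF.pd_jac_eq_zero V (hk 2 (by simp)) 2 hm,
      VF.pd_jac_eq_zero V (hk 0 (by simp)) 0 hm, VF.pd_jac_eq_zero V (hk 0 (by simp)) 2 hm⟩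
  obtain ⟨a, b, c, d⟩ := z 3 fun i hi m hm => (hfib i hi m hm).1
  obtain ⟨a', b', c', d'⟩ := z 4 fun i hi m hm => (hfib i hi m hm).2
  constructor
  · rw [VF.jac, hpd, a, b, c, d]
    simp
    ring
  · rw [VF.jac, hpd, a', b', c', d']
    simp

/-- The equations imposed on the base components by the third-order equation of model (ii). -/
theorem third_order_ii {V : VF U}
    (hV : ∀ m ∈ U, SymmetryEquations (fun m => 1 / 4 * m 3 ^ 2) (fun m => 1 * m 4 ^ 3) V.1 m)
    {m : Jet} (hm : m ∈ U) :
    3 * VF.jac V 0 0 m - 2 * VF.jac V 2 2 m + 2 * (m 3 * VF.jac V 0 2 m) = 0 ∧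
      VF.jac V 3 0 m + m 3 * VF.jac V 3 2 m = 0 := by
  have hfib := SymmetryEquations.jac_fiber hV
  -- The second equation on D gives the r component as A + r B, with A and B independent of r.
  set A : Jet → ℝ := fun m => VF.jac V 3 0 m + m 3 * VF.jac V 3 2 m with hA
  set B : Jet → ℝ := fun m => VF.jac V 2 2 m - 2 * VF.jac V 0 0 m - m 3 * VF.jac V 0 2 m with hB
  have sA : ContDiffOn ℝ ∞ A U :=
    (VF.contDiffOn_jac V 3 0).add ((contDiffOn_coord 3).mul (VF.contDiffOn_jac V 3 2))
  have sB : ContDiffOn ℝ ∞ B U :=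
    ((VF.contDiffOn_jac V 2 2).sub (contDiffOn_const.mul (VF.contDiffOn_jac V 0 0))).sub
      ((contDiffOn_coord 3).mul (VF.contDiffOn_jac V 0 2))
  have pA : ∀ m ∈ U, pd 4 A m = 0 := fun m hm => by
    have d3 := differentiableAt_coord 3 m
    have d30 := VF.differentiableAt_jac V 3 0 hm
    have d32 := VF.differentiableAt_jac V 3 2 hm
    rw [hA, pd_add d30 (d3.fun_mul d32), pd_mul d3 d32, pd_coord,
      VF.pd_jac_eq_zero V (fun m hm => (p_component_ii hV hm).2) 0 hm,
      VF.pd_jac_eq_zero V (fun m hm => (p_component_ii hV hm).2) 2 hm]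
    simp
  have pB (i : Fin 5) (m : Jet) (hm : m ∈ U) : pd i B m =
      pd i (VF.jac V 2 2) m - 2 * pd i (VF.jac V 0 0) m
        - (m 3 * pd i (VF.jac V 0 2) m + VF.jac V 0 2 m * (if i = 3 then 1 else 0)) := by
    have d3 := differentiableAt_coord 3 m
    have d22 := VF.differentiableAt_jac V 2 2 hm
    have d00 := VF.differentiableAt_jac V 0 0 hm
    have d02 := VF.differentiableAt_jac V 0 2 hm
    rw [hB, pd_sub (d22.fun_sub (d00.const_mul 2)) (d3.fun_mul d02),
      pd_sub d22 (d00.const_mul 2), pd_const_mul d00, pd_mul d3 d02, pd_coord]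
  have pB4 : ∀ m ∈ U, pd 4 B m = 0 := fun m hm => by
    rw [pB 4 m hm, VF.pd_jac_eq_zero V (fun m hm => (hfib 2 (by simp) m hm).2) 2 hm,
      VF.pd_jac_eq_zero V (fun m hm => (hfib 0 (by simp) m hm).2) 0 hm,
      VF.pd_jac_eq_zero V (fun m hm => (hfib 0 (by simp) m hm).2) 2 hm]
    simp
  have pB3 : pd 3 B m = -VF.jac V 0 2 m := by
    rw [pB 3 m hm, VF.pd_jac_eq_zero V (fun m hm => (hfib 2 (by simp) m hm).1) 2 hm,
      VF.pd_jac_eq_zero V (fun m hm => (hfib 0 (by simp) m hm).1) 0 hm,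
      VF.pd_jac_eq_zero V (fun m hm => (hfib 0 (by simp) m hm).1) 2 hm]
    simp
  have eF (m : Jet) : totalD (fun m => 1 * m 4 ^ 3) (fun m => 1 / 4 * m 3 ^ 2) m =
      1 / 2 * m 3 * m 4 := modelData_ii.totalD_F _ (Set.mem_univ (m 3))
  have eFF (m : Jet) : totalD (fun m => 1 * m 4 ^ 3)
      (totalD (fun m => 1 * m 4 ^ 3) (fun m => 1 / 4 * m 3 ^ 2)) m =
      1 / 2 * m 4 ^ 2 + 1 / 2 * m 3 * (1 * m 4 ^ 3) :=
    modelData_ii.totalD_totalD_F _ (Set.mem_univ (m 3))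
  have e4 : ∀ m ∈ U, V.1 m 4 = A m + m 4 * B m := by
    intro m hm
    obtain ⟨-, -, -, h10, h12⟩ := conformal_of_symmetry hV hm
    obtain ⟨h33, h34⟩ := p_component_ii hV hm
    have := (hV m hm).second ![1, 0, m 3, m 4, 1 * m 4 ^ 3] (by simp) (by simp) (by simp)
    simp only [VF.fderiv_eq_jac V hm, Matrix.cons_val, eF, h33, h34, h10, h12,
      (hfib 0 (by simp) m hm).1, (hfib 0 (by simp) m hm).2, (hfib 1 (by simp) m hm).1,
      (hfib 1 (by simp) m hm).2] at this
    simp only [hA, hB]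
    linear_combination -this
  have j4 (i : Fin 5) (m : Jet) (hm : m ∈ U) : VF.jac V 4 i m =
      pd i A m + (m 4 * pd i B m + B m * (if i = 4 then 1 else 0)) := by
    have dA := differentiableAt_of_smooth sA hm
    have dB := differentiableAt_of_smooth sB hm
    have d4 := differentiableAt_coord 4 m
    rw [VF.jac, pd_congr e4 hm, pd_add dA (d4.fun_mul dB), pd_mul d4 dB, pd_coord]
  -- The third equation on D, sorted by powers of r. It is cubic; the zero quartic term only fits
  -- the shape of `eq_zero_of_quartic`.
  have eq : ∀ m ∈ U, (pd 0 A m + m 3 * pd 2 A m)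
      + (pd 0 B m + m 3 * pd 2 B m + pd 3 A m) * m 4
      + (pd 3 B m + VF.jac V 0 2 m - 3 * A m) * m 4 ^ 2
      + (-2 * B m - VF.jac V 0 0 m) * m 4 ^ 3 + 0 * m 4 ^ 4 = 0 := by
    intro m hm
    obtain ⟨-, -, -, h10, h12⟩ := conformal_of_symmetry hV hm
    have := (hV m hm).third ![1, 0, m 3, m 4, 1 * m 4 ^ 3] (by simp) (by simp) (by simp)
    rw [(hasFDerivAt_mul_pow (φ := fun _ => 1) (hasDerivAt_const (m 3) (1 : ℝ)) 3).fderiv] at this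
    simp only [VF.fderiv_eq_jac V hm, Matrix.cons_val, eFF, h10, h12, j4 _ m hm, pA m hm,
      pB4 m hm, dCoord, ContinuousLinearMap.proj_apply, _root_.smul_apply, _root_.add_apply,
      smul_eq_mul, e4 m hm, if_neg (show (0 : Fin 5) ≠ 4 by decide),
      if_neg (show (2 : Fin 5) ≠ 4 by decide), if_neg (show (3 : Fin 5) ≠ 4 by decide),
      (hfib 0 (by simp) m hm).1, (hfib 0 (by simp) m hm).2, (hfib 1 (by simp) m hm).1,
      (hfib 1 (by simp) m hm).2] at this
    norm_num at this
    linear_combination this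
  obtain ⟨-, -, h2, h3, -⟩ := eq_zero_of_quartic (p₀ := m 4) (by
    filter_upwards [eventually_update_mem hm 4, eventually_update_eq sA pA hm,
      eventually_update_eq sB pB4 hm, eventually_pd_update_eq sA pA hm,
      eventually_pd_update_eq sB pB4 hm,
      eventually_pd_update_eq (VF.contDiffOn_comp V 0) (fun m hm => (hfib 0 (by simp) m hm).2) hm]
      with r hr hA' hB' hpA hpB h0
    have := eq _ hr
    simpa only [hpA, hpB, hA', hB', VF.jac, h0, Function.update_self,
      Function.update_of_ne (show (3 : Fin 5) ≠ 4 by decide)] using this)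
  -- Since ∂_p B = -J₀₂, the r² coefficient is -3A. The r³ coefficient -2B - J₀₀ gives the other
  -- claim.
  rw [pB3] at h2
  refine ⟨?_, ?_⟩
  · simp only [VF.jac, hB] at h3 ⊢
    linear_combination h3
  · change A m = 0
    simp only [VF.jac] at h2
    linarith

/-- Classification for model (ii). -/
theorem exists_base_components_ii (hconn : IsConnected (U : Set Jet)) {V : VF U}
    (hV : ∀ m ∈ U, SymmetryEquations (fun m => 1 / 4 * m 3 ^ 2) (fun m => 1 * m 4 ^ 3) V.1 m) :
    ∃ (α β : ℝ) (d : Fin 3 → ℝ), ∀ m ∈ U,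
      V.1 m 0 = α * m 0 + β * m 1 + d 0 ∧ V.1 m 1 = α / 2 * m 1 + d 1 ∧
      V.1 m 2 = -2 * β * m 0 + 3 / 2 * α * m 2 + d 2 := by
  have hfib := SymmetryEquations.jac_fiber hV
  have hinv (i j : Fin 5) (hi : i ∈ ({0, 1, 2} : Set (Fin 5))) {m : Jet} (hm : m ∈ U) :
      pd 3 (VF.jac V i j) m = 0 ∧ pd 4 (VF.jac V i j) m = 0 :=
    ⟨VF.pd_jac_eq_zero V (fun m hm => (hfib i hi m hm).1) j hm,
      VF.pd_jac_eq_zero V (fun m hm => (hfib i hi m hm).2) j hm⟩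
  have hJ : ∀ m ∈ U, VF.jac V 0 2 m = 0 ∧ VF.jac V 2 2 m = 3 / 2 * VF.jac V 0 0 m := by
    intro m hm
    -- The first conclusion of `third_order_ii` is affine in p with coefficients depending only on
    -- the base point, so both coefficients vanish.
    obtain ⟨h0, h1, -⟩ := eq_zero_of_quartic (p₀ := m 3)
      (c₀ := 3 * VF.jac V 0 0 m - 2 * VF.jac V 2 2 m) (c₁ := 2 * VF.jac V 0 2 m) (c₂ := 0)
      (c₃ := 0) (c₄ := 0) (by
        filter_upwards [eventually_update_mem hm 3,
          eventually_pd_update_eq (VF.contDiffOn_comp V 0)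
            (fun m hm => (hfib 0 (by simp) m hm).1) hm,
          eventually_pd_update_eq (VF.contDiffOn_comp V 2)
            (fun m hm => (hfib 2 (by simp) m hm).1) hm] with p hp h0 h2
        have := (third_order_ii hV hp).1
        simp only [VF.jac, h0, h2, Function.update_self] at this ⊢
        linear_combination this)
    exact ⟨by linarith, by linarith⟩
  have hpd22 (i : Fin 5) (m : Jet) (hm : m ∈ U) :
      pd i (VF.jac V 2 2) m = 3 / 2 * pd i (VF.jac V 0 0) m := by
    rw [pd_congr (fun m hm => (hJ m hm).2) hm, pd_const_mul (VF.differentiableAt_jac V 0 0 hm)]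
  have hpd02 (m : Jet) (hm : m ∈ U) : pd 2 (VF.jac V 0 0) m = 0 :=
    VF.pd_jac_eq_zero V (fun m hm => (hJ m hm).1) 0 hm
  have hpd20 (m : Jet) (hm : m ∈ U) :
      pd 2 (VF.jac V 2 0) m = 3 / 2 * pd 0 (VF.jac V 0 0) m := by
    rw [VF.pd_jac V 2 0 2 hm, hpd22 0 m hm]
  have e3 : ∀ m ∈ U, V.1 m 3 = VF.jac V 2 0 m + m 3 * (1 / 2 * VF.jac V 0 0 m) := by
    intro m hm
    obtain ⟨-, -, -, h10, h12⟩ := conformal_of_symmetry hV hm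
    rw [SymmetryEquations.contact_x hm hV, h10, h12, (hJ m hm).1, (hJ m hm).2]
    ring
  have j3 (i : Fin 5) (hi : i ≠ 3) (m : Jet) (hm : m ∈ U) : VF.jac V 3 i m =
      pd i (VF.jac V 2 0) m + m 3 * (1 / 2 * pd i (VF.jac V 0 0) m) := by
    have d20 := VF.differentiableAt_jac V 2 0 hm
    have d00 := (VF.differentiableAt_jac V 0 0 hm).const_mul (1 / 2)
    have d3 := differentiableAt_coord 3 m
    rw [VF.jac, pd_congr e3 hm, pd_add d20 (d3.fun_mul d00), pd_mul d3 d00,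
      pd_const_mul (VF.differentiableAt_jac V 0 0 hm), pd_coord, if_neg hi]
    ring
  have hzero : ∀ m ∈ U, pd 0 (VF.jac V 2 0) m = 0 ∧ pd 0 (VF.jac V 0 0) m = 0 := by
    intro m hm
    -- With `e3`, the second conclusion of `third_order_ii` becomes ∂₀J₂₀ + 2p ∂₀J₀₀ = 0. The factor
    -- 2 is 1/2 from the p component plus 3/2 from ∂₂J₂₀.
    obtain ⟨h0, h1, -⟩ := eq_zero_of_quartic (p₀ := m 3)
      (c₀ := pd 0 (VF.jac V 2 0) m) (c₁ := 2 * pd 0 (VF.jac V 0 0) m) (c₂ := 0)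
      (c₃ := 0) (c₄ := 0) (by
        filter_upwards [eventually_update_mem hm 3,
          eventually_pd_update_eq (VF.contDiffOn_jac V 2 0)
            (fun m hm => (hinv 2 0 (by simp) hm).1) hm,
          eventually_pd_update_eq (VF.contDiffOn_jac V 0 0)
            (fun m hm => (hinv 0 0 (by simp) hm).1) hm] with p hp h20 h00
        have := (third_order_ii hV hp).2
        rw [j3 0 (by decide) _ hp, j3 2 (by decide) _ hp, hpd02 _ hp, hpd20 _ hp, h20, h00,
          Function.update_self] at this
        linear_combination this)
    exact ⟨h0, by linarith⟩
  obtain ⟨α, hα⟩ := exists_eq_const hconn (VF.contDiffOn_jac V 0 0)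
    (fun m hm => (hzero m hm).2)
    (fun m hm => by
      rw [VF.pd_jac V 0 0 1 hm, pd_congr (fun m hm => (conformal_of_symmetry hV hm).2.1) hm,
        pd_const_mul (VF.differentiableAt_jac V 2 0 hm), (hzero m hm).1, mul_zero])
    hpd02 (fun m hm => (hinv 0 0 (by simp) hm).1) (fun m hm => (hinv 0 0 (by simp) hm).2)
  obtain ⟨γ, hγ⟩ := exists_eq_const hconn (VF.contDiffOn_jac V 2 0)
    (fun m hm => (hzero m hm).1)
    (fun m hm => VF.pd_jac_eq_zero V (fun m hm => (conformal_of_symmetry hV hm).1) 0 hm)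
    (fun m hm => by rw [hpd20 m hm, (hzero m hm).2, mul_zero])
    (fun m hm => (hinv 2 0 (by simp) hm).1) (fun m hm => (hinv 2 0 (by simp) hm).2)
  obtain ⟨d₀, h0⟩ := exists_eq_affine hconn (VF.contDiffOn_comp V 0) hα
    (fun m hm => ((conformal_of_symmetry hV hm).2.1).trans (by rw [hγ m hm]))
    (fun m hm => (hJ m hm).1)
    (fun m hm => (hfib 0 (by simp) m hm).1) (fun m hm => (hfib 0 (by simp) m hm).2)
  obtain ⟨d₁, h1⟩ := exists_eq_affine hconn (VF.contDiffOn_comp V 1) (a₀ := 0)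
    (fun m hm => ((conformal_of_symmetry hV hm).2.2.2.1).trans (by rw [(hJ m hm).1, mul_zero]))
    (fun m hm => ((conformal_of_symmetry hV hm).2.2.1).trans (by rw [(hJ m hm).2, hα m hm]))
    (fun m hm => (conformal_of_symmetry hV hm).2.2.2.2)
    (fun m hm => (hfib 1 (by simp) m hm).1) (fun m hm => (hfib 1 (by simp) m hm).2)
  obtain ⟨d₂, h2⟩ := exists_eq_affine hconn (VF.contDiffOn_comp V 2) hγ
    (fun m hm => (conformal_of_symmetry hV hm).1)
    (fun m hm => ((hJ m hm).2).trans (by rw [hα m hm]))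
    (fun m hm => (hfib 2 (by simp) m hm).1) (fun m hm => (hfib 2 (by simp) m hm).2)
  -- β is the entry J₀₁, equal to -J₂₀/2 by conformality.
  refine ⟨α, -(1 / 2) * γ, ![d₀, d₁, d₂], fun m hm => ⟨?_, ?_, ?_⟩⟩
  · rw [h0 m hm]; simp
  · change _ = α / 2 * m 1 + d₁
    rw [h1 m hm]
    ring
  · rw [h2 m hm]; simp

end

/-! ### The scaling and rotation generators of the three models -/

/-- Model (ii): `x ∂_x + ½ y ∂_y + (3/2) z ∂_z + ½ p ∂_p - ½ r ∂_r`. -/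
noncomputable def scaling_ii : LinearData Set.univ where
  M := !![1, 0, 0; 0, 1 / 2, 0; 0, 0, 3 / 2]
  π p := 1 / 2 * p
  π' _ := 1 / 2
  σ _ := -(1 / 2)
  σ' _ := 0
  π_smooth := contDiffOn_const.mul contDiffOn_id
  σ_smooth := contDiffOn_const
  π_deriv p _ := ((hasDerivAt_id p).const_mul (1 / 2)).congr_deriv (by simp)
  σ_deriv p _ := hasDerivAt_const p _

/-- Model (ii): `y ∂_x - 2 x ∂_z - 2 ∂_p`. -/
noncomputable def shear_ii : LinearData Set.univ where
  M := !![0, 1, 0; 0, 0, 0; -2, 0, 0]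
  π _ := -2
  π' _ := 0
  σ _ := 0
  σ' _ := 0
  π_smooth := contDiffOn_const
  σ_smooth := contDiffOn_const
  π_deriv p _ := hasDerivAt_const p _
  σ_deriv p _ := hasDerivAt_const p _

/-- A diagonal field with `p` and `r` components proportional to `p` and `r`. -/
noncomputable def diagonalData (I : Set ℝ) (α β γ s t : ℝ) : LinearData I where
  M := !![α, 0, 0; 0, β, 0; 0, 0, γ]
  π p := s * p
  π' _ := s
  σ _ := t
  σ' _ := 0
  π_smooth := contDiffOn_const.mul contDiffOn_id
  σ_smooth := contDiffOn_const
  π_deriv p _ := ((hasDerivAt_id p).const_mul s).congr_deriv (by simp)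
  σ_deriv p _ := hasDerivAt_const p _

/-- The rotation generator `-y ∂_x + x ∂_y + b z ∂_z + (b p - f) ∂_p + (b - 2 f') r ∂_r`. -/
noncomputable def rotationData {I : Set ℝ} {f f₁ f₂ : ℝ → ℝ} (b : ℝ)
    (hf : ContDiffOn ℝ ∞ f I) (hf₁ : ContDiffOn ℝ ∞ f₁ I)
    (hd : ∀ p ∈ I, HasDerivAt f (f₁ p) p) (hd₁ : ∀ p ∈ I, HasDerivAt f₁ (f₂ p) p) :
    LinearData I where
  M := !![0, -1, 0; 1, 0, 0; 0, 0, b]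
  π p := -f p + b * p
  π' p := -f₁ p + b
  σ p := -2 * f₁ p + b
  σ' p := -2 * f₂ p
  π_smooth := hf.neg.add (contDiffOn_const.mul contDiffOn_id)
  σ_smooth := (contDiffOn_const.mul hf₁).add contDiffOn_const
  π_deriv p hp := ((hd p hp).fun_neg.fun_add ((hasDerivAt_id p).const_mul b)).congr_deriv (by simp)
  σ_deriv p hp := ((hd₁ p hp).const_mul (-2)).add_const b

/-! ### Model data -/

theorem modelData_iiia (b : ℝ) : ModelData (Set.Ioi 0) (fun p => 1 / 4 * p ^ b)
    (fun p => b / 4 * p ^ (b - 1)) (fun p => b * (b - 1) / 4 * p ^ (b - 2))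
    (fun p => b * (b - 1) * (b - 2) / 4 * p ^ (b - 3)) (fun p => (2 - b) / p)
    (fun p => -(2 - b) / p ^ 2) where
  isOpen := isOpen_Ioi
  f_deriv p hp := ((Real.hasDerivAt_rpow_const (Or.inl (ne_of_gt hp))).const_mul
    (1 / 4)).congr_deriv (by ring)
  f₁_deriv p hp := ((Real.hasDerivAt_rpow_const (p := b - 1) (Or.inl (ne_of_gt hp))).const_mul
    (b / 4)).congr_deriv (by rw [show b - 1 - 1 = b - 2 by ring]; ring)
  f₂_deriv p hp := ((Real.hasDerivAt_rpow_const (p := b - 2) (Or.inl (ne_of_gt hp))).const_mul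
    (b * (b - 1) / 4)).congr_deriv (by rw [show b - 2 - 1 = b - 3 by ring]; ring)
  k_deriv p hp := ((hasDerivAt_const p (2 - b)).fun_div (hasDerivAt_id p)
    (ne_of_gt hp)).congr_deriv (by simp)

/-- The first derivative of a logarithmic spiral. -/
noncomputable def spiral₁ (b : ℝ) (f : ℝ → ℝ) (p : ℝ) : ℝ := (p + b * f p) / (b * p - f p)

/-- The second derivative of a logarithmic spiral. -/
noncomputable def spiral₂ (b : ℝ) (f : ℝ → ℝ) (p : ℝ) : ℝ :=
  (1 + spiral₁ b f p ^ 2) / (b * p - f p)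

/-- The third derivative of a logarithmic spiral. -/
noncomputable def spiral₃ (b : ℝ) (f : ℝ → ℝ) (p : ℝ) : ℝ :=
  (3 * spiral₁ b f p - b) * spiral₂ b f p / (b * p - f p)

/-- The derivative of the coefficient `h` of model (iiib). -/
noncomputable def spiralCoeff₁ (b : ℝ) (f : ℝ → ℝ) (p : ℝ) : ℝ :=
  (-3 * spiral₂ b f p - h₃b b f p * (b - spiral₁ b f p)) / (b * p - f p)

theorem IsImplicitSolution.denom_ne {b : ℝ} {I : Set ℝ} {f : ℝ → ℝ}
    (hf : IsImplicitSolution b I f) {p : ℝ} (hp : p ∈ I) : b * p - f p ≠ 0 := fun h =>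
  hf.h_denom_ne p hp (by linarith)

/-- This form has the same denominator bp - f as the derivatives of f. Compared with `spiral₃`, it
shows that h = -f'''/f''. -/
theorem IsImplicitSolution.spiralCoeff_eq {b : ℝ} {I : Set ℝ} {f : ℝ → ℝ}
    (hf : IsImplicitSolution b I f) {p : ℝ} (hp : p ∈ I) :
    h₃b b f p = (b - 3 * spiral₁ b f p) / (b * p - f p) := by
  have hn := hf.denom_ne hp
  have hn' := hf.h_denom_ne p hp
  rw [h₃b, spiral₁, div_eq_div_iff (pow_ne_zero 2 hn') hn]
  field_simp
  ring

/-- Everything follows by differentiating the product forms f'(bp - f) = p + b f, f''(bp - f) = 1 +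
f'² and h (bp - f) = b - 3f'. -/
theorem IsImplicitSolution.modelData {b : ℝ} {I : Set ℝ} {f : ℝ → ℝ}
    (hf : IsImplicitSolution b I f) :
    ModelData I f (spiral₁ b f) (spiral₂ b f) (spiral₃ b f) (h₃b b f) (spiralCoeff₁ b f) := by
  have hd (p : ℝ) (hp : p ∈ I) : HasDerivAt f (spiral₁ b f p) p := hf.hasDerivAt hp
  have hden (p : ℝ) (hp : p ∈ I) :
      HasDerivAt (fun p => b * p - f p) (b - spiral₁ b f p) p :=
    (((hasDerivAt_id p).const_mul b).fun_sub (hd p hp)).congr_deriv (by simp)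
  have hd₁ (p : ℝ) (hp : p ∈ I) : HasDerivAt (spiral₁ b f) (spiral₂ b f p) p := by
    have hn := hf.denom_ne hp
    refine (((hasDerivAt_id p).fun_add ((hd p hp).const_mul b)).fun_div (hden p hp)
      hn).congr_deriv ?_
    have e : id p + b * f p = spiral₁ b f p * (b * p - f p) := by
      rw [spiral₁, div_mul_cancel₀ _ hn, id]
    rw [e, spiral₂, div_eq_div_iff (pow_ne_zero 2 hn) hn]
    ring
  have hd₂ (p : ℝ) (hp : p ∈ I) : HasDerivAt (spiral₂ b f) (spiral₃ b f p) p := by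
    have hn := hf.denom_ne hp
    refine ((((hd₁ p hp).fun_pow 2).const_add 1).fun_div (hden p hp) hn).congr_deriv ?_
    have e : 1 + spiral₁ b f p ^ 2 = spiral₂ b f p * (b * p - f p) := by
      rw [spiral₂, div_mul_cancel₀ _ hn]
    rw [e, spiral₃, div_eq_div_iff (pow_ne_zero 2 hn) hn]
    norm_num
    ring
  refine ⟨hf.isOpen, hd, hd₁, hd₂, fun p hp => ?_⟩
  have hn := hf.denom_ne hp
  have e : h₃b b f =ᶠ[nhds p] fun p => (b - 3 * spiral₁ b f p) / (b * p - f p) := by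
    filter_upwards [hf.isOpen.mem_nhds hp] with q hq using hf.spiralCoeff_eq hq
  refine (((((hd₁ p hp).const_mul 3).const_sub b).fun_div (hden p hp)
    hn).congr_of_eventuallyEq e).congr_deriv ?_
  have e' : b - 3 * spiral₁ b f p = h₃b b f p * (b * p - f p) := by
    rw [hf.spiralCoeff_eq hp, div_mul_cancel₀ _ hn]
  rw [e', spiralCoeff₁, div_eq_div_iff (pow_ne_zero 2 hn) hn]
  ring

theorem IsImplicitSolution.contDiffOn_spiral₁ {b : ℝ} {I : Set ℝ} {f : ℝ → ℝ}
    (hf : IsImplicitSolution b I f) : ContDiffOn ℝ ∞ (spiral₁ b f) I :=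
  (contDiffOn_id.add (contDiffOn_const.mul hf.smooth)).div
    ((contDiffOn_const.mul contDiffOn_id).sub hf.smooth) fun _ hp => hf.denom_ne hp

/-! ### The generators satisfy the symmetry conditions -/

theorem affineConditions_scaling_ii (p r : ℝ) :
    AffineConditions (1 / 4 * p ^ 2) (1 / 2 * p) (1 / 2) 0 1 0 3 scaling_ii.M
      (scaling_ii.π p) (scaling_ii.π' p) (scaling_ii.σ p) (scaling_ii.σ' p) p r := by
  constructor <;> simp [scaling_ii] <;> ring

theorem affineConditions_shear_ii (p r : ℝ) :
    AffineConditions (1 / 4 * p ^ 2) (1 / 2 * p) (1 / 2) 0 1 0 3 shear_ii.M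
      (shear_ii.π p) (shear_ii.π' p) (shear_ii.σ p) (shear_ii.σ' p) p r := by
  constructor <;> simp [shear_ii] <;> ring

/-- The free weights are α for x and s for p. Then z = p·x fixes γ, homogeneity of f of degree b
fixes β through γ - β = b s, and r = p/x fixes t. Writing the derivatives of f as multiples of f/pⁿ
makes all conditions rational in p and f. -/
theorem affineConditions_diagonal (I : Set ℝ) {b α s p f : ℝ} (hp : p ≠ 0) (r : ℝ)
    {β γ t : ℝ} (hβ : β = α + (1 - b) * s) (hγ : γ = s + α) (ht : t = s - α) :
    AffineConditions f (b * f / p) (b * (b - 1) * f / p ^ 2) (b * (b - 1) * (b - 2) * f / p ^ 3)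
      ((2 - b) / p) (-(2 - b) / p ^ 2) 2 (diagonalData I α β γ s t).M
      ((diagonalData I α β γ s t).π p) ((diagonalData I α β γ s t).π' p)
      ((diagonalData I α β γ s t).σ p) ((diagonalData I α β γ s t).σ' p) p r := by
  subst hβ hγ ht
  constructor <;> simp [diagonalData] <;> field_simp <;> ring

theorem affineConditions_rotation {b p f f₁ f₂ f₃ k k₁ : ℝ} (h₁ : f₁ * (b * p - f) = p + b * f)
    (h₂ : f₂ * (b * p - f) = 1 + f₁ ^ 2) (h₃ : f₃ * (b * p - f) = (3 * f₁ - b) * f₂)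
    (hk₁ : k₁ * (b * p - f) = -3 * f₂ - k * (b - f₁))
    (r : ℝ) :
    AffineConditions f f₁ f₂ f₃ k k₁ 2 !![0, -1, 0; 1, 0, 0; 0, 0, b] (-f + b * p) (-f₁ + b)
      (-2 * f₁ + b) (-2 * f₂) p r where
  contact_x := by simp; ring
  contact_y := by simp; linear_combination -h₁
  second_x := by simp; ring
  second_y := by simp; linear_combination -r * h₂
  third_x := by simp; linear_combination -r ^ 2 * hk₁
  third_y := by
    simp
    linear_combination r ^ 2 * (-f₁ * hk₁ - h₃ - k * h₂)

theorem rpow_sub_natCast_div {p : ℝ} (hp : 0 < p) (b : ℝ) (n : ℕ) :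
    p ^ (b - n) = p ^ b / p ^ n := by
  rw [Real.rpow_sub hp, Real.rpow_natCast]

/-! ### The point symmetries of the three models -/

section

variable {U : TopologicalSpace.Opens Jet}

theorem bracket_ii (hU : ∀ m ∈ U, m 3 ∈ Set.univ) :
    ⁅scaling_ii.toVF hU, shear_ii.toVF hU⁆ = (-(1 / 2) : ℝ) • shear_ii.toVF hU := by
  refine scaling_ii.bracket_toVF shear_ii hU ?_ (fun p _ => by simp [scaling_ii, shear_ii])
    (fun p _ => by simp [scaling_ii, shear_ii])
  ext i j
  fin_cases i <;> fin_cases j <;> simp [scaling_ii, shear_ii] <;> norm_num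

theorem mem_span_generators_ii (hconn : IsConnected (U : Set Jet))
    (hU : ∀ m ∈ U, m 3 ∈ Set.univ) (V : VF U) :
    V ∈ Submodule.span ℝ (Set.range (generators scaling_ii shear_ii hU)) ↔
      IsPointSymmetry F₂ H₂ U V.1 := by
  have hH : H₂ = fun m => 1 * m 4 ^ 3 := by funext m; simp [H₂]
  rw [hH]
  refine mem_span_generators_iff modelData_ii 3 (fun p _ r => affineConditions_scaling_ii p r)
    (fun p _ r => affineConditions_shear_ii p r) (fun V hV => ?_) V
  obtain ⟨α, β, d, hd⟩ := exists_base_components_ii hconn hV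
  refine ⟨α, β, d, fun m hm => ?_⟩
  obtain ⟨h0, h1, h2⟩ := hd m hm
  rw [h0, h1, h2]
  refine ⟨?_, ?_, ?_⟩ <;>
    simp [affineField, scaling_ii, shear_ii, -add_left_inj, -mul_eq_mul_right_iff] <;> ring

/-- The first generator of model (iiia). -/
noncomputable def scaling_iiia (b : ℝ) : LinearData (Set.Ioi 0) :=
  diagonalData (Set.Ioi 0) 1 0 (b / (b - 1)) (1 / (b - 1)) (-((b - 2) / (b - 1)))

/-- The second generator of model (iiia). -/
noncomputable def scaling_iiia' (b : ℝ) : LinearData (Set.Ioi 0) :=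
  diagonalData (Set.Ioi 0) 0 1 (-(1 / (b - 1))) (-(1 / (b - 1))) (-(1 / (b - 1)))

theorem bracket_iiia (b : ℝ) (hU : ∀ m ∈ U, m 3 ∈ Set.Ioi 0) :
    ⁅(scaling_iiia b).toVF hU, (scaling_iiia' b).toVF hU⁆ =
      (0 : ℝ) • (scaling_iiia' b).toVF hU := by
  refine LinearData.bracket_toVF _ _ hU ?_
    (fun p _ => by simp [scaling_iiia, scaling_iiia', diagonalData])
    (fun p _ => by simp [scaling_iiia, scaling_iiia', diagonalData])
  ext i j
  fin_cases i <;> fin_cases j <;> simp [scaling_iiia, scaling_iiia', diagonalData]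
  ring

theorem affineConditions_iiia {b α β γ s t : ℝ} (hβ : β = α + (1 - b) * s) (hγ : γ = s + α)
    (ht : t = s - α) (p : ℝ) (hp : p ∈ Set.Ioi (0 : ℝ)) (r : ℝ) :
    AffineConditions (1 / 4 * p ^ b) (b / 4 * p ^ (b - 1)) (b * (b - 1) / 4 * p ^ (b - 2))
      (b * (b - 1) * (b - 2) / 4 * p ^ (b - 3)) ((2 - b) / p) (-(2 - b) / p ^ 2) 2
      (diagonalData (Set.Ioi 0) α β γ s t).M ((diagonalData (Set.Ioi 0) α β γ s t).π p)
      ((diagonalData (Set.Ioi 0) α β γ s t).π' p) ((diagonalData (Set.Ioi 0) α β γ s t).σ p)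
      ((diagonalData (Set.Ioi 0) α β γ s t).σ' p) p r := by
  have hp' : (0 : ℝ) < p := hp
  have e1 := rpow_sub_natCast_div hp' b 1
  have e2 := rpow_sub_natCast_div hp' b 2
  have e3 := rpow_sub_natCast_div hp' b 3
  norm_num at e1 e2 e3
  rw [e1, e2, e3]
  convert affineConditions_diagonal (Set.Ioi 0) (f := 1 / 4 * p ^ b) (b := b) hp'.ne' r
    hβ hγ ht using 1 <;> ring

theorem mem_span_generators_iiia {b : ℝ} (hb1 : 1 < b) (hb2 : b < 2)
    (hconn : IsConnected (U : Set Jet)) (hU : ∀ m ∈ U, m 3 ∈ Set.Ioi 0) (V : VF U) :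
    V ∈ Submodule.span ℝ (Set.range (generators (scaling_iiia b) (scaling_iiia' b) hU)) ↔
      IsPointSymmetry (F₃a b) (H₃a b) U V.1 := by
  have hH : H₃a b = fun m => (2 - b) / m 3 * m 4 ^ 2 := by
    funext m
    rw [H₃a]
    ring
  have hb : b - 1 ≠ 0 := by linarith
  rw [hH]
  -- The two generators are the cases (α, β) = (1, 0) and (0, 1) of the diagonal family, with γ =
  -- (bα - β)/(b - 1) and s = γ - α.
  refine mem_span_generators_iff (modelData_iiia b) 2
    (affineConditions_iiia (by field_simp; ring) (by field_simp; ring) (by field_simp; ring))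
    (affineConditions_iiia (by field_simp; ring) (by ring) (by ring)) (fun V hV => ?_) V
  obtain ⟨α, β, d, hd⟩ := (modelData_iiia b).exists_diagonal hconn hU hb1 hb2
    (fun p hp => ne_of_gt hp)
    (fun p hp => mul_ne_zero (by norm_num) (Real.rpow_pos_of_pos hp b).ne')
    (fun p hp => by
      have e1 := rpow_sub_natCast_div hp b 1
      have hp' : p ≠ 0 := ne_of_gt hp
      norm_num at e1
      rw [e1]
      field_simp) hV
  refine ⟨α, β, d, fun m hm => ?_⟩
  obtain ⟨h0, h1, h2⟩ := hd m hm
  rw [h0, h1, h2]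
  refine ⟨?_, ?_, ?_⟩ <;>
    simp [affineField, diagonalData, -add_left_inj, -mul_eq_mul_right_iff]
  ring

/-- The rotation generator of model (iiib). -/
noncomputable def IsImplicitSolution.rotation {b : ℝ} {I : Set ℝ} {f : ℝ → ℝ}
    (hf : IsImplicitSolution b I f) : LinearData I :=
  rotationData b hf.smooth hf.contDiffOn_spiral₁ hf.modelData.f_deriv hf.modelData.f₁_deriv

theorem bracket_iiib {b : ℝ} {I : Set ℝ} {f : ℝ → ℝ} (hf : IsImplicitSolution b I f)
    (hU : ∀ m ∈ U, m 3 ∈ I) :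
    ⁅(diagonalData I 1 1 1 0 (-1)).toVF hU, hf.rotation.toVF hU⁆ =
      (0 : ℝ) • hf.rotation.toVF hU := by
  refine LinearData.bracket_toVF _ _ hU ?_ (fun p _ => by simp [diagonalData])
    (fun p _ => by simp [diagonalData])
  ext i j
  fin_cases i <;> fin_cases j <;>
    simp [diagonalData, IsImplicitSolution.rotation, rotationData]

theorem mem_span_generators_iiib {b : ℝ} (hb : 0 < b) {I : Set ℝ} {f : ℝ → ℝ}
    (hf : IsImplicitSolution b I f) (hconn : IsConnected (U : Set Jet))
    (hU : ∀ m ∈ U, m 3 ∈ I) (V : VF U) :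
    V ∈ Submodule.span ℝ
        (Set.range (generators (diagonalData I 1 1 1 0 (-1)) hf.rotation hU)) ↔
      IsPointSymmetry (F₃b f) (H₃b b f) U V.1 := by
  refine mem_span_generators_iff hf.modelData 2
    -- The homothety fixes p and scales r with weight -1; it is a symmetry because H is quadratic in
    -- r, matching the weight -2 of z_xxx.
    (fun p _ r => by constructor <;> simp [diagonalData] <;> ring)
    (fun p hp r => ?_) (fun V hV => ?_) V
  · have hn := hf.denom_ne hp
    refine affineConditions_rotation ?_ ?_ ?_ ?_ r
    · rw [spiral₁, div_mul_cancel₀ _ hn]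
    · rw [spiral₂, div_mul_cancel₀ _ hn]
    · rw [spiral₃, div_mul_cancel₀ _ hn]
    · rw [spiralCoeff₁, div_mul_cancel₀ _ hn]
  · obtain ⟨α, β, d, hd⟩ := hf.modelData.exists_spiral hconn hU hb
      (fun p hp => hf.denom_ne hp) (fun p _ => rfl) hV
    refine ⟨α, β, d, fun m hm => ?_⟩
    obtain ⟨h0, h1, h2⟩ := hd m hm
    rw [h0, h1, h2]
    refine ⟨?_, ?_, ?_⟩ <;>
      simp [affineField, diagonalData, IsImplicitSolution.rotation, rotationData,
        -add_left_inj, -mul_eq_mul_right_iff] <;> ring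

end

end ParaCR

/-! ### Assembly of the three models -/

theorem mainTheorem11 :
    (∀ U : TopologicalSpace.Opens Jet, IsConnected (U : Set Jet) →
      ∃ L : LieSubalgebra ℝ (VF U), IsPointSymmetryAlgebra F₂ H₂ U L ∧
        Module.finrank ℝ L = 5 ∧ LieAlgebra.IsSolvable L ∧
        ∃ X : Module.Basis (Fin 5) ℝ L,
          (∀ m ∈ U,
            (X 0 : VF U).1 m = ![m 0, 1 / 2 * m 1, 3 / 2 * m 2, 1 / 2 * m 3, -(1 / 2) * m 4] ∧
            (X 1 : VF U).1 m = ![m 1, 0, -2 * m 0, -2, 0] ∧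
            (X 2 : VF U).1 m = ![1, 0, 0, 0, 0] ∧
            (X 3 : VF U).1 m = ![0, 1, 0, 0, 0] ∧
            (X 4 : VF U).1 m = ![0, 0, 1, 0, 0]) ∧
          ⁅X 0, X 1⁆ = (-(1 / 2) : ℝ) • X 1 ∧
          ⁅X 0, X 2⁆ = -X 2 ∧
          ⁅X 0, X 3⁆ = (-(1 / 2) : ℝ) • X 3 ∧
          ⁅X 0, X 4⁆ = (-(3 / 2) : ℝ) • X 4 ∧
          ⁅X 1, X 2⁆ = (2 : ℝ) • X 4 ∧
          ⁅X 1, X 3⁆ = -X 2 ∧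
          ⁅X 1, X 4⁆ = 0 ∧
          ⁅X 2, X 3⁆ = 0 ∧
          ⁅X 2, X 4⁆ = 0 ∧
          ⁅X 3, X 4⁆ = 0 ∧
          ∃ A : LieIdeal ℝ L, A.toSubmodule = Submodule.span ℝ {X 2, X 3, X 4} ∧
            Module.finrank ℝ A = 3 ∧ IsLieAbelian A) ∧
    (∀ b : ℝ, 1 < b → b < 2 →
      ∀ U : TopologicalSpace.Opens Jet, IsConnected (U : Set Jet) → (∀ m ∈ U, 0 < m 3) →
      ∃ L : LieSubalgebra ℝ (VF U), IsPointSymmetryAlgebra (F₃a b) (H₃a b) U L ∧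
        Module.finrank ℝ L = 5 ∧ LieAlgebra.IsSolvable L ∧
        ∃ X : Module.Basis (Fin 5) ℝ L,
          (∀ m ∈ U,
            (X 0 : VF U).1 m =
              ![m 0, 0, b / (b - 1) * m 2, 1 / (b - 1) * m 3, -((b - 2) / (b - 1)) * m 4] ∧
            (X 1 : VF U).1 m =
              ![0, m 1, -(1 / (b - 1)) * m 2, -(1 / (b - 1)) * m 3, -(1 / (b - 1)) * m 4] ∧
            (X 2 : VF U).1 m = ![1, 0, 0, 0, 0] ∧
            (X 3 : VF U).1 m = ![0, 1, 0, 0, 0] ∧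
            (X 4 : VF U).1 m = ![0, 0, 1, 0, 0]) ∧
          ⁅X 0, X 1⁆ = 0 ∧
          ⁅X 0, X 2⁆ = -X 2 ∧
          ⁅X 0, X 3⁆ = 0 ∧
          ⁅X 0, X 4⁆ = (-(b / (b - 1))) • X 4 ∧
          ⁅X 1, X 2⁆ = 0 ∧
          ⁅X 1, X 3⁆ = -X 3 ∧
          ⁅X 1, X 4⁆ = (1 / (b - 1)) • X 4 ∧
          ⁅X 2, X 3⁆ = 0 ∧
          ⁅X 2, X 4⁆ = 0 ∧
          ⁅X 3, X 4⁆ = 0 ∧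
          ∃ A : LieIdeal ℝ L, A.toSubmodule = Submodule.span ℝ {X 2, X 3, X 4} ∧
            Module.finrank ℝ A = 3 ∧ IsLieAbelian A) ∧
    (∀ b : ℝ, 0 < b → ∀ (I : Set ℝ) (f : ℝ → ℝ), IsImplicitSolution b I f →
      ∀ U : TopologicalSpace.Opens Jet, IsConnected (U : Set Jet) → (∀ m ∈ U, m 3 ∈ I) →
      ∃ L : LieSubalgebra ℝ (VF U), IsPointSymmetryAlgebra (F₃b f) (H₃b b f) U L ∧
        Module.finrank ℝ L = 5 ∧ LieAlgebra.IsSolvable L ∧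
        ∃ X : Module.Basis (Fin 5) ℝ L,
          (∀ m ∈ U,
            (X 0 : VF U).1 m = ![m 0, m 1, m 2, 0, -m 4] ∧
            (X 1 : VF U).1 m = ![-m 1, m 0, b * m 2, -f (m 3) + b * m 3,
              -2 * totalD (H₃b b f) (F₃b f) m + b * m 4] ∧
            (X 2 : VF U).1 m = ![1, 0, 0, 0, 0] ∧
            (X 3 : VF U).1 m = ![0, 1, 0, 0, 0] ∧
            (X 4 : VF U).1 m = ![0, 0, 1, 0, 0]) ∧
          ⁅X 0, X 1⁆ = 0 ∧
          ⁅X 0, X 2⁆ = -X 2 ∧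
          ⁅X 0, X 3⁆ = -X 3 ∧
          ⁅X 0, X 4⁆ = -X 4 ∧
          ⁅X 1, X 2⁆ = -X 3 ∧
          ⁅X 1, X 3⁆ = X 2 ∧
          ⁅X 1, X 4⁆ = (-b) • X 4 ∧
          ⁅X 2, X 3⁆ = 0 ∧
          ⁅X 2, X 4⁆ = 0 ∧
          ⁅X 3, X 4⁆ = 0 ∧
          ∃ A : LieIdeal ℝ L, A.toSubmodule = Submodule.span ℝ {X 2, X 3, X 4} ∧
            Module.finrank ℝ A = 3 ∧ IsLieAbelian A) := by
  refine ⟨fun U hconn => ?_, fun b hb1 hb2 U hconn hU => ?_, fun b hb I f hf U hconn hU => ?_⟩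
  · have hU : ∀ m ∈ U, m 3 ∈ (Set.univ : Set ℝ) := fun _ _ => Set.mem_univ _
    obtain ⟨L, hL, hfin, hsol, X, hX, h01, h02, h03, h04, h12, h13, h14, h23, h24, h34, hA⟩ :=
      exists_symmetryAlgebra_generators hconn.nonempty
        (fun a b h => by
          have h0 := congrFun (congrFun h 0) 0
          have h1 := congrFun (congrFun h 0) 1
          simp [scaling_ii, shear_ii] at h0 h1
          exact ⟨h0, h1⟩) (bracket_ii hU) (mem_span_generators_ii hconn hU)
    refine ⟨L, hL, hfin, hsol, X, fun m hm => ?_, ?_, ?_, ?_, ?_, ?_, ?_, ?_, h23, h24, h34, hA⟩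
    · obtain ⟨e0, e1, e2, e3, e4⟩ := hX m hm
      refine ⟨?_, ?_, e2, e3, e4⟩
      · rw [e0]
        simp [affineField, scaling_ii]
      · rw [e1]
        simp [affineField, shear_ii]
    · exact h01
    · rw [h02]; simp [scaling_ii]
    · rw [h03]; simp [scaling_ii]
    · rw [h04]; simp [scaling_ii]
    · rw [h12]; simp [shear_ii]
    · rw [h13]; simp [shear_ii]
    · rw [h14]; simp [shear_ii]
  · obtain ⟨L, hL, hfin, hsol, X, hX, h01, h02, h03, h04, h12, h13, h14, h23, h24, h34, hA⟩ :=
      exists_symmetryAlgebra_generators hconn.nonempty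
        (fun a b h => by
          have h0 := congrFun (congrFun h 0) 0
          have h1 := congrFun (congrFun h 1) 1
          simp [scaling_iiia, diagonalData, scaling_iiia', diagonalData] at h0 h1
          exact ⟨h0, h1⟩) (bracket_iiia b hU) (mem_span_generators_iiia hb1 hb2 hconn hU)
    refine ⟨L, hL, hfin, hsol, X, fun m hm => ?_, ?_, ?_, ?_, ?_, ?_, ?_, ?_, h23, h24, h34, hA⟩
    · obtain ⟨e0, e1, e2, e3, e4⟩ := hX m hm
      refine ⟨?_, ?_, e2, e3, e4⟩
      · rw [e0]
        simp [affineField, scaling_iiia, diagonalData]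
      · rw [e1]
        simp [affineField, scaling_iiia', diagonalData]
    · rw [h01, zero_smul]
    · rw [h02]; simp [scaling_iiia, diagonalData]
    · rw [h03]; simp [scaling_iiia, diagonalData]
    · rw [h04]; simp [scaling_iiia, diagonalData]
    · rw [h12]; simp [scaling_iiia', diagonalData]
    · rw [h13]; simp [scaling_iiia', diagonalData]
    · rw [h14]; simp [scaling_iiia', diagonalData]
  · obtain ⟨L, hL, hfin, hsol, X, hX, h01, h02, h03, h04, h12, h13, h14, h23, h24, h34, hA⟩ :=
      exists_symmetryAlgebra_generators hconn.nonempty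
        (fun a b h => by
          have h0 := congrFun (congrFun h 0) 0
          have h1 := congrFun (congrFun h 1) 0
          simp [diagonalData, IsImplicitSolution.rotation, rotationData] at h0 h1
          exact ⟨h0, h1⟩) (bracket_iiib hf hU) (mem_span_generators_iiib hb hf hconn hU)
    refine ⟨L, hL, hfin, hsol, X, fun m hm => ?_, ?_, ?_, ?_, ?_, ?_, ?_, ?_, h23, h24, h34, hA⟩
    · obtain ⟨e0, e1, e2, e3, e4⟩ := hX m hm
      refine ⟨?_, ?_, e2, e3, e4⟩
      · rw [e0]
        simp [affineField, diagonalData]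
      -- DF = f'(p) r, so the r component -2 DF + b r is (b - 2f'(p)) r, as in `rotationData`.
      · rw [e1, show totalD (H₃b b f) (F₃b f) m = _ from hf.modelData.totalD_F _ (hU m hm)]
        simp [affineField, IsImplicitSolution.rotation, rotationData]
        ring
    · rw [h01, zero_smul]
    · rw [h02]; simp [diagonalData]
    · rw [h03]; simp [diagonalData]
    · rw [h04]; simp [diagonalData]
    · rw [h12]; simp [IsImplicitSolution.rotation, rotationData]
    · rw [h13]; simp [IsImplicitSolution.rotation, rotationData]
    · rw [h14]; simp [IsImplicitSolution.rotation, rotationData]
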